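/- All graphs are finite and simple. A graph $G$ is $(4,2)$-choosable if, for every assignment to each vertex $v$ of a list $L(v)$ of exactly $4$ colors, there are sets $\varphi(v)\subseteq L(v)$ with $|\varphi(v)|=2$ for all $v$ and $\varphi(v)\cap\varphi(w)=\emptyset$ for every edge $vw$. The core of a connected graph is what remains when vertices of degree $1$ are deleted repeatedly, one at a time, for as long as possible (so the core of a tree is a single vertex). Let $\theta_{a,b,c}$ be the graph formed by three internally disjoint paths of lengths $a,b,c$ with the same two endpoints. A cut-vertex of a connected graph is a vertex whose deletion leaves a disconnected graph; a block of $G$ is a maximal connected subgraph that has no cut-vertex of its own. Let $\mathcal B(G)$ be the multiset of (isomorphism types of) blocks of $G$ that contain a cycle. **Theorem.** Let $G$ be a connected $(4,2)$-choosable graph. Then at least one of the following holds, for some positive integers $s,t$ (with $s\ge 2$, respectively $t\ge 2$, whenever the cycle $C_{2s}$, respectively $C_{2t}$, is named): (i) the core of $G$ is $K_1$; (ii) the core of $G$ is $C_{2s}$; (iii) the core of $G$ is $\theta_{2,2s,2t}$; (iv) the core of $G$ is $\theta_{1,2s+1,2t+1}$; (v) the core of $G$ is $K_{2,4}$; (vi)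 the core of $G$ is formed from $K_{3,3}-e$ ($K_{3,3}$ minus one edge) by subdividing a single edge incident to a vertex of degree $2$ an even number (possibly zero) of times; (vii) $\mathcal B(G)=\{C_{2s},C_{2t}\}$; (viii) $\mathcal B(G)=\{\theta_{2,2,2},C_{2s}\}$; (ix) $\mathcal B(G)=\{C_4,C_{2s},C_{2t}\}$; some path in $G$ contains at least one edge of each of these three blocks, with the block $C_4$ appearing second along the path; and exactly two vertices of this $C_4$ are cut-vertices of the core of $G$, and these two are non-adjacent. -/

import Mathlib

open SimpleGraph

universe u

namespace FourTwo

/-- `G` is `(a,b)`-choosable: for every assignment of lists of exactly `a` colors there is a choice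
of `b`-element subsets of the lists that are disjoint on adjacent vertices. -/
def Choosable {V : Type u} (G : SimpleGraph V) (a b : ℕ) : Prop :=
  ∀ L : V → Finset ℕ, (∀ v, (L v).card = a) →
    ∃ φ : V → Finset ℕ, (∀ v, φ v ⊆ L v) ∧ (∀ v, (φ v).card = b) ∧
      ∀ v w, G.Adj v w → Disjoint (φ v) (φ w)

/-- `PrunesTo G S`: the vertex set `S` is what remains of `G` after deleting, one at a time,
finitely many vertices that have degree `1` in the graph that is left at that moment. -/
inductive PrunesTo {V : Type u} (G : SimpleGraph V) : Set V → Prop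
  | start : PrunesTo G Set.univ
  | delete {S : Set V} {v : V} (h : PrunesTo G S) (hv : v ∈ S)
      (hdeg : {w ∈ S | G.Adj v w}.ncard = 1) : PrunesTo G (S \ {v})

/-- `S` is the vertex set of a core of `G`: vertices of degree `1` have been deleted for as long as
possible. (The result is unique if `G` has a cycle; for a tree it is a single vertex, which may
depend on the order of the deletions.) The core itself is `G.induce S`. -/
def IsCore {V : Type u} (G : SimpleGraph V) (S : Set V) : Prop :=
  PrunesTo G S ∧ ∀ v ∈ S, {w ∈ S | G.Adj v w}.ncard ≠ 1

/-- Every finite graph has a core. -/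
theorem exists_isCore {V : Type u} [Finite V] (G : SimpleGraph V) : ∃ S, IsCore G S := by
  obtain ⟨S, hS⟩ := (Set.toFinite {S : Set V | PrunesTo G S}).exists_minimal ⟨_, PrunesTo.start⟩
  refine ⟨S, hS.prop, fun v hv hdeg => ?_⟩
  exact (hS.le_of_le (PrunesTo.delete hS.prop hv hdeg) Set.sdiff_subset hv).2 rfl

/-- A vertex of a connected graph whose deletion leaves a disconnected graph. -/
def IsCutVertex {V : Type u} (G : SimpleGraph V) (v : V) : Prop :=
  ¬ (G.induce {v}ᶜ).Preconnected

/-- Connected and without cut-vertex (so `K₁` and `K₂` are included). -/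
def TwoConnected {V : Type u} (G : SimpleGraph V) : Prop :=
  G.Connected ∧ ∀ v, ¬ IsCutVertex G v

/-- A block is a maximal subgraph that is connected and has no cut-vertex. -/
def IsBlock {V : Type u} (G : SimpleGraph V) (B : G.Subgraph) : Prop :=
  Maximal (fun H : G.Subgraph => TwoConnected H.coe) B

/-- The blocks of `G` that contain a cycle. -/
def cyclicBlocks {V : Type u} (G : SimpleGraph V) : Set G.Subgraph :=
  {B | IsBlock G B ∧ ¬ B.coe.IsAcyclic}

/-- The `j`-th vertex on the `i`-th path of the theta graph with path lengths `ℓ`. The common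
endpoints are `inl false` (`j = 0`) and `inl true` (`j = ℓ i`). -/
def thetaVertex {k : ℕ} (ℓ : Fin k → ℕ) (i : Fin k) (j : ℕ) : Bool ⊕ (Σ i, Fin (ℓ i - 1)) :=
  if j = 0 then Sum.inl false
  else if h : j - 1 < ℓ i - 1 then Sum.inr ⟨i, ⟨j - 1, h⟩⟩
  else Sum.inl true

/-- The theta graph with path lengths `ℓ 0, ℓ 1, …` (all positive, at most one of them `1`). -/
def theta {k : ℕ} (ℓ : Fin k → ℕ) : SimpleGraph (Bool ⊕ (Σ i, Fin (ℓ i - 1))) :=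
  SimpleGraph.fromRel fun x y =>
    ∃ i, ∃ j < ℓ i, x = thetaVertex ℓ i j ∧ y = thetaVertex ℓ i (j + 1)

/-- `K_{3,3}` minus an edge. -/
def K33e : SimpleGraph (Fin 3 ⊕ Fin 3) :=
  (completeBipartiteGraph (Fin 3) (Fin 3)).deleteEdges {s(Sum.inl 0, Sum.inr 0)}

/-- The `j`-th vertex of the path `a, x₀, …, x_{k-1}, b` that replaces the edge `ab`. -/
def subdivVertex {V : Type u} (a b : V) (k j : ℕ) : V ⊕ Fin k :=
  if j = 0 then Sum.inl a
  else if h : j - 1 < k then Sum.inr ⟨j - 1, h⟩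
  else Sum.inl b

/-- The graph formed from `G` by subdividing the edge `ab` `k` times. -/
def subdivideEdge {V : Type u} (G : SimpleGraph V) (a b : V) (k : ℕ) : SimpleGraph (V ⊕ Fin k) :=
  SimpleGraph.fromRel fun x y =>
    (∃ c d, G.Adj c d ∧ s(c, d) ≠ s(a, b) ∧ x = Sum.inl c ∧ y = Sum.inl d) ∨
    ∃ j < k + 1, x = subdivVertex a b k j ∧ y = subdivVertex a b k (j + 1)

end FourTwo

set_option linter.unnecessarySeqFocus false
set_option linter.unreachableTactic false
set_option linter.unusedTactic false

namespace FourTwo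

/-! ### Colour sets as bit masks -/

/-! A choosable graph is bipartite: if all lists are equal, neighbours get complementary pairs, and
a fixed colour tells the two classes apart. Choosability passes to subgraphs, so it suffices to
exclude enough subdivisions of small graphs and to show that what survives is on the list.

Each exclusion covers infinitely many path lengths but is a finite check. On a stretch of vertices
with one and the same list of four colours the chosen pairs alternate between a set and its
complement, so an even number of such vertices can be inserted into a path without changing which
pairs its ends may have (`link_piece`). Only the parity of each path, known from the bipartition,
and a small lower bound on its length matter. What remains is an exhaustive search over the pairs of
the few branch vertices, for explicit lists inside seven colours (`gad_of_search`).

Pieces that hang at a vertex are treated as gadgets, which restrict the six pairs of the root's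
list, seen as the edges of K₄. A lollipop (an arm with a cycle at its end) excludes two intersecting
pairs. A theta graph, or a cycle with a lollipop at another vertex, leaves only two intersecting
pairs (`Gad4`), except for K_{2,3} and for a four-cycle with opposite roots, which still leave a
path of three pairs (`Gad3`). The complement of a path on four vertices in K₄ is again such a path,
so two `Gad3` at a common root exclude everything; so do a `Gad4` and a lollipop, and so do three
lollipops.

The core is a single vertex or has minimum degree two. In the latter case every proper subgraph has
an ear or a lollipop attached to it (`exists_ear`). If some theta graph has an ear, the core is
K_{2,4} or comes from K_{3,3} minus an edge. If there are theta graphs but none has an ear, the core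
is a theta graph, or K_{2,3} with one lollipop. If there is no theta graph, cycles are joined in a
tree-like way, and the gadgets leave one cycle, two cycles, or two cycles on either side of a
four-cycle (`exists_shape`).

These shapes are turned into isomorphisms with the named graphs. Blocks are recognized by means of
retractions: deleting leaves retracts `G` onto its core, the core retracts onto each cyclic block,
and every other edge separates the graph (`cyclicBlocks_eq`). -/

/-- The masks of the two-element subsets of `{0, …, 6}`. -/
def pairMasks : List ℕ :=
  [3, 5, 6, 9, 10, 12, 17, 18, 20, 24, 33, 34, 36, 40, 48, 65, 66, 68, 72, 80, 96]

/-- The masks of the two-element subsets of the set with mask `m`. -/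
def prs (m : ℕ) : List ℕ := pairMasks.filter fun k => k &&& m == k

/-- `m` is the mask of a four-element subset of `{0, …, 6}`. -/
def Quad (m : ℕ) : Prop := m < 128 ∧ (prs m).length = 6

instance : DecidablePred Quad := fun m => inferInstanceAs (Decidable (m < 128 ∧ (prs m).length = 6))

/-- The subset of `{0, …, 6}` with mask `m`. -/
def colors (m : ℕ) : Finset ℕ := (Finset.range 7).filter fun i => m.testBit i

theorem card_colors : ∀ m < 128, (prs m).length = 6 → (colors m).card = 4 := by decide +kernel

theorem exists_mem_prs {m : ℕ} (hm : m < 128) {X : Finset ℕ} (hX : X ⊆ colors m)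
    (h2 : X.card = 2) : ∃ k ∈ prs m, X = colors k := by
  have key : ∀ m < 128, ∀ i < 7, ∀ j < 7, m.testBit i = true → m.testBit j = true → i ≠ j →
      (2 ^ i ||| 2 ^ j) ∈ prs m := by
    have h : ((List.range 128).all fun m => (List.range 7).all fun i => (List.range 7).all fun j =>
      !m.testBit i || !m.testBit j || i == j || (prs m).contains (2 ^ i ||| 2 ^ j)) = true := by
      decide +kernel
    intro m hm i hi j hj h1 h2 h3
    have := List.all_eq_true.1 (List.all_eq_true.1 (List.all_eq_true.1 h m (List.mem_range.2 hm)) i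
      (List.mem_range.2 hi)) j (List.mem_range.2 hj)
    simpa [h1, h2, h3] using this
  have key' : ∀ i < 7, ∀ j < 7, colors (2 ^ i ||| 2 ^ j) = {i, j} := by decide +kernel
  obtain ⟨i, j, hij, rfl⟩ := Finset.card_eq_two.1 h2
  have hi := hX (Finset.mem_insert_self i {j})
  have hj := hX (Finset.mem_insert_of_mem (Finset.mem_singleton_self j) : j ∈ ({i, j} : Finset ℕ))
  simp only [colors, Finset.mem_filter, Finset.mem_range] at hi hj
  exact ⟨_, key m hm i hi.1 j hj.1 hi.2 hj.2 hij, (key' i hi.1 j hj.1).symm⟩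

theorem land_eq_zero_of_disjoint : ∀ k ∈ pairMasks, ∀ k' ∈ pairMasks,
    Disjoint (colors k) (colors k') → k &&& k' = 0 := by decide +kernel

theorem mem_pairMasks {m k : ℕ} (h : k ∈ prs m) : k ∈ pairMasks := List.mem_of_mem_filter h

/-- In a set of four colours a pair is disjoint from only one other pair. Hence neighbours with
equal lists determine each other, which is what allows paths to be padded. -/
theorem quad_xor {B X : ℕ} (hB : Quad B) (hX : X ∈ prs B) :
    B ^^^ X ∈ prs B ∧ B ^^^ (B ^^^ X) = X ∧ ∀ Y ∈ prs B, X &&& Y = 0 → Y = B ^^^ X := by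
  have key : ∀ B < 128, (prs B).length = 6 → ∀ X ∈ prs B,
    B ^^^ X ∈ prs B ∧ B ^^^ (B ^^^ X) = X ∧ ∀ Y ∈ prs B, X &&& Y = 0 → Y = B ^^^ X := by
    decide +kernel
  exact key B hB.1 hB.2 X hX

variable {V : Type u} {G : SimpleGraph V}

/-- `ψ` chooses disjoint pairs from the lists `L` on the subgraph induced by `K`. -/
def MaskColoring (G : SimpleGraph V) (K : Set V) (L ψ : V → ℕ) : Prop :=
  (∀ v ∈ K, ψ v ∈ prs (L v)) ∧ ∀ v ∈ K, ∀ w ∈ K, G.Adj v w → ψ v &&& ψ w = 0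

theorem MaskColoring.mono {K K' : Set V} {L L' ψ : V → ℕ} (h : MaskColoring G K' L' ψ)
    (hK : K ⊆ K') (hL : ∀ v ∈ K, L v = L' v) : MaskColoring G K L ψ :=
  ⟨fun v hv => hL v hv ▸ h.1 v (hK hv), fun v hv w hw => h.2 v (hK hv) w (hK hw)⟩

/-- Lists inside seven colours suffice for every obstruction below, so choosability is used only in
this computable form. -/
theorem Choosable.exists_maskColoring (h : Choosable G 4 2) (L : V → ℕ) (hL : ∀ v, Quad (L v)) :
    ∃ ψ, MaskColoring G Set.univ L ψ := by
  obtain ⟨φ, h1, h2, h3⟩ := h (fun v => colors (L v)) fun v => card_colors _ (hL v).1 (hL v).2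
  choose ψ hψ hψ' using fun v => exists_mem_prs (hL v).1 (h1 v) (h2 v)
  refine ⟨ψ, fun v _ => hψ v, fun v _ w _ hvw => ?_⟩
  have := h3 v w hvw
  rw [hψ' v, hψ' w] at this
  exact land_eq_zero_of_disjoint _ (mem_pairMasks (hψ v)) _ (mem_pairMasks (hψ w)) this

/-! ### Gluing list assignments -/

/-- There are lists on the vertices of `l` such that every colouring of the graph induced by `bs`
and `l`, with the lists `A` on `bs`, has the property `Q`. -/
def Part (G : SimpleGraph V) (bs : List V) (A : V → ℕ) (l : List V) (Q : (V → ℕ) → Prop) : Prop :=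
  ∃ L : V → ℕ, (∀ v ∈ l, Quad (L v)) ∧ (∀ v ∈ bs, L v = A v) ∧
    ∀ ψ, MaskColoring G {v | v ∈ bs ∨ v ∈ l} L ψ → Q ψ

/-- `Part`, provided that the vertices are distinct. -/
def Piece (G : SimpleGraph V) (bs : List V) (A : V → ℕ) (l : List V) (Q : (V → ℕ) → Prop) :
    Prop :=
  (bs ++ l).Nodup → Part G bs A l Q

theorem Piece.mono {bs : List V} {A : V → ℕ} {l : List V} {Q Q' : (V → ℕ) → Prop}
    (h : Piece G bs A l Q) (hQ : ∀ ψ, (∀ v ∈ bs, ψ v ∈ prs (A v)) → Q ψ → Q' ψ) :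
    Piece G bs A l Q' := by
  intro hnd
  obtain ⟨L, h1, h2, h3⟩ := h hnd
  refine ⟨L, h1, h2, fun ψ hψ => hQ ψ (fun v hv => ?_) (h3 ψ hψ)⟩
  rw [← h2 v hv]
  exact hψ.1 v (Or.inl hv)

theorem Piece.nil {bs : List V} {A : V → ℕ} : Piece G bs A [] fun _ => True :=
  fun _ => ⟨A, by simp, fun _ _ => rfl, fun _ _ => trivial⟩

/-- Edges between `l` and `l'` can be ignored: a colouring of the whole restricts to colourings of
both parts. -/
theorem Piece.append {bs : List V} {A : V → ℕ} {l l' : List V} {Q Q' : (V → ℕ) → Prop}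
    (h : Piece G bs A l Q) (h' : Piece G bs A l' Q') :
    Piece G bs A (l ++ l') fun ψ => Q ψ ∧ Q' ψ := by
  classical
  intro hnd
  have hnd1 : (bs ++ l).Nodup := hnd.sublist (by simp)
  have hnd2 : (bs ++ l').Nodup := hnd.sublist (by simp)
  have hll : ∀ v ∈ l, v ∉ l' := fun v hv hv' => by
    have := hnd.sublist (List.sublist_append_right bs (l ++ l'))
    exact (List.nodup_append'.1 this).2.2 hv hv'
  have hbl : ∀ v ∈ bs, v ∉ l ∧ v ∉ l' := fun v hv =>
    ⟨fun hv' => (List.nodup_append'.1 hnd1).2.2 hv hv',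
      fun hv' => (List.nodup_append'.1 hnd2).2.2 hv hv'⟩
  obtain ⟨L, h1, h2, h3⟩ := h hnd1
  obtain ⟨L', h1', h2', h3'⟩ := h' hnd2
  refine ⟨fun v => if v ∈ l then L v else if v ∈ l' then L' v else A v, ?_, ?_, ?_⟩
  · intro v hv
    by_cases hvl : v ∈ l
    · simp [hvl, h1]
    · have : v ∈ l' := by simpa [hvl] using hv
      simp [hvl, this, h1']
  · intro v hv
    simp [hbl v hv]
  · intro ψ hψ
    refine ⟨h3 ψ (hψ.mono ?_ ?_), h3' ψ (hψ.mono ?_ ?_)⟩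
    · rintro v (hv | hv) <;> simp [hv]
    · rintro v (hv | hv)
      · simp [hbl v hv, h2 v hv]
      · simp [hv]
    · rintro v (hv | hv) <;> simp [hv]
    · rintro v (hv | hv)
      · simp [hbl v hv, h2' v hv]
      · have : v ∉ l := fun hv' => hll v hv' hv
        simp [hv, this]

theorem Piece.all {bs : List V} {A : V → ℕ} {ps : List (List V × ((V → ℕ) → Prop))}
    (h : ps.Forall fun p => Piece G bs A p.1 p.2) :
    Piece G bs A (ps.flatMap Prod.fst) fun ψ => ps.Forall fun p => p.2 ψ := by
  induction ps with
  | nil => exact Piece.nil.mono fun _ _ _ => by simp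
  | cons p ps ih =>
    rw [List.forall_cons] at h
    exact (h.1.append (ih h.2)).mono fun ψ _ hψ => by rwa [List.forall_cons]

/-- Vertices with prescribed lists may be counted among the others. -/
theorem Piece.absorb {bs ws : List V} {A A' : V → ℕ} {l : List V} {Q : (V → ℕ) → Prop}
    (hA : ∀ v ∈ bs, A' v = A v) (hw : ∀ w ∈ ws, Quad (A' w)) (h : Piece G (ws ++ bs) A' l Q) :
    Piece G bs A (ws ++ l) fun ψ => (∀ w ∈ ws, ψ w ∈ prs (A' w)) ∧ Q ψ := by
  intro hnd
  have hp : (bs ++ (ws ++ l)).Perm (ws ++ bs ++ l) := by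
    rw [← List.append_assoc]
    exact List.perm_append_comm.append_right l
  obtain ⟨L, h1, h2, h3⟩ := h (hp.nodup_iff.1 hnd)
  refine ⟨L, ?_, ?_, ?_⟩
  · intro v hv
    rcases List.mem_append.1 hv with hv | hv
    · rw [h2 v (by simp [hv])]
      exact hw v hv
    · exact h1 v hv
  · intro v hv
    rw [h2 v (by simp [hv]), hA v hv]
  · intro ψ hψ
    refine ⟨fun w hw => ?_, h3 ψ (hψ.mono ?_ fun _ _ => rfl)⟩
    · rw [← h2 w (by simp [hw])]
      exact hψ.1 w (by simp [hw])
    · rintro v (hv | hv)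
      · rcases List.mem_append.1 hv with hv | hv <;> simp [hv]
      · simp [hv]

theorem Piece.subset {bs : List V} {A : V → ℕ} {l l' : List V} {Q : (V → ℕ) → Prop}
    (h : Piece G bs A l Q) (hl : l.Nodup) (hll : l ⊆ l') : Piece G bs A l' Q := by
  classical
  intro hnd
  rw [List.nodup_append'] at hnd
  have hdis : ∀ v ∈ bs, v ∉ l' := fun v hv hv' => hnd.2.2 hv hv'
  obtain ⟨L, h1, h2, h3⟩ := h (List.nodup_append'.2
    ⟨hnd.1, hl, fun v hv hv' => hdis v hv (hll hv')⟩)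
  -- The vertices of `l'` outside `l` play no role; 15 is an arbitrary list of four colours.
  refine ⟨fun v => if v ∈ l then L v else if v ∈ l' then 15 else A v, ?_, ?_, ?_⟩
  · intro v hv
    by_cases hvl : v ∈ l
    · simp [hvl, h1]
    · simp only [hvl, hv, if_true, if_false]
      decide
  · intro v hv
    have : v ∉ l := fun h => hdis v hv (hll h)
    simp [hdis v hv, this]
  · intro ψ hψ
    refine h3 ψ (hψ.mono ?_ ?_)
    · rintro v (hv | hv)
      · simp [hv]
      · simp [hll hv]
    · rintro v (hv | hv)
      · have : v ∉ l := fun h => hdis v hv (hll h)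
        simp [hdis v hv, this, h2 v hv]
      · simp [hv]

theorem not_choosable_of_piece {r : V} {A : V → ℕ} {l : List V} (hA : Quad (A r))
    (hnd : (r :: l).Nodup) (h : Piece G [r] A l fun _ => False) : ¬ Choosable G 4 2 := by
  classical
  intro hch
  obtain ⟨L, h1, h2, h3⟩ := h hnd
  obtain ⟨ψ, hψ⟩ := hch.exists_maskColoring (fun v => if v ∈ r :: l then L v else 15) fun v => by
    by_cases hv : v ∈ r :: l
    · simp only [hv, if_true]
      rcases List.mem_cons.1 hv with rfl | hv
      · rwa [h2 v (by simp)]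
      · exact h1 v hv
    · simp only [hv, if_false]
      decide
  refine h3 ψ (hψ.mono (Set.subset_univ _) ?_)
  rintro v (hv | hv)
  · have : v = r := by simpa using hv
    simp [this]
  · simp [hv]

/-! ### Links -/

/-- A walk from `u` to `v` whose interior vertices are the members of `l`, in this order. -/
def Link (G : SimpleGraph V) (u : V) (l : List V) (v : V) : Prop :=
  List.IsChain G.Adj (u :: (l ++ [v]))

@[simp] theorem link_nil {u v : V} : Link G u [] v ↔ G.Adj u v := by simp [Link]

theorem link_cons {u v w : V} {l : List V} : Link G u (w :: l) v ↔ G.Adj u w ∧ Link G w l v := by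
  simp [Link]

theorem link_append {u v x : V} {l l' : List V} :
    Link G u (l ++ x :: l') v ↔ Link G u l x ∧ Link G x l' v := by
  induction l generalizing u with
  | nil => simp [link_cons]
  | cons w l ih => simp [link_cons, ih, and_assoc]

theorem Link.symm {u v : V} {l : List V} (h : Link G u l v) : Link G v l.reverse u := by
  induction l generalizing u with
  | nil => simpa using (link_nil.1 h).symm
  | cons w l ih =>
    rw [link_cons] at h
    rw [List.reverse_cons, link_append]
    exact ⟨ih h.2, by simpa using h.1.symm⟩

/-- A path with lists `ms` on its interior vertices can be coloured if its ends get `X`, `Y`. -/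
def linkOK : List ℕ → ℕ → ℕ → Bool
  | [], X, Y => X &&& Y == 0
  | m :: ms, X, Y => (prs m).any fun Z => X &&& Z == 0 && linkOK ms Z Y

/-- `ms` is a list of quads that can be the lists of a path with interior `l`, except possibly for
an even number of vertices at the end. -/
def Fits (l : List V) (ms : List ℕ) : Prop :=
  (∃ k, l.length = ms.length + 2 * k) ∧ ∀ m ∈ ms, Quad m

/-- Along a walk of even length whose vertices have the same list, the two ends agree. -/
theorem eq_of_same_list {K : Set V} {L ψ : V → ℕ} {B : ℕ} (hB : Quad B)
    (hψ : MaskColoring G K L ψ) (k : ℕ) : ∀ {w v : V} {l : List V}, Link G w l v →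
    l.length = 2 * k + 1 → (∀ x ∈ w :: (l ++ [v]), x ∈ K ∧ L x = B) → ψ w = ψ v := by
  have step : ∀ {x y : V}, x ∈ K → y ∈ K → L x = B → L y = B → G.Adj x y → ψ y = B ^^^ ψ x :=
    fun {x y} hx hy hLx hLy hxy => (quad_xor hB (hLx ▸ hψ.1 x hx)).2.2 _ (hLy ▸ hψ.1 y hy)
      (hψ.2 x hx y hy hxy)
  induction k with
  | zero =>
    intro w v l hl hlen hK
    match l, hlen with
    | [a], _ =>
      rw [link_cons, link_nil] at hl
      have h1 := step (hK w (by simp)).1 (hK a (by simp)).1 (hK w (by simp)).2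
        (hK a (by simp)).2 hl.1
      have h2 := step (hK a (by simp)).1 (hK v (by simp)).1 (hK a (by simp)).2
        (hK v (by simp)).2 hl.2
      have hw := hψ.1 w (hK w (by simp)).1
      rw [(hK w (by simp)).2] at hw
      rw [h2, h1, (quad_xor hB hw).2.1]
  | succ k ih =>
    intro w v l hl hlen hK
    match l, hlen with
    | a :: b :: l, hlen =>
      rw [link_cons, link_cons] at hl
      have h1 := step (hK w (by simp)).1 (hK a (by simp)).1 (hK w (by simp)).2
        (hK a (by simp)).2 hl.1
      have h2 := step (hK a (by simp)).1 (hK b (by simp)).1 (hK a (by simp)).2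
        (hK b (by simp)).2 hl.2.1
      have hw := hψ.1 w (hK w (by simp)).1
      rw [(hK w (by simp)).2] at hw
      rw [← ih hl.2.2 (by simp at hlen; omega) fun x hx => hK x (by simp at hx ⊢; tauto), h2, h1,
        (quad_xor hB hw).2.1]

/-- The first interior vertices get the lists `ms`, the remaining even number of them the list of
the end `v`. On this tail the pairs alternate, so its first vertex has the pair of `v`, and the path
acts as if only the vertices with lists `ms` were there. -/
theorem link_piece {bs : List V} {A : V → ℕ} {u v : V} {l : List V} {ms : List ℕ}
    (hl : Link G u l v) (hu : u ∈ bs) (hv : v ∈ bs) (hA : Quad (A v)) (hms : Fits l ms) :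
    Piece G bs A l fun ψ => linkOK ms (ψ u) (ψ v) = true := by
  classical
  obtain ⟨⟨k, hk⟩, hq⟩ := hms
  induction ms generalizing bs A u l with
  | nil =>
    intro hnd
    have hdis : ∀ x ∈ bs, x ∉ l := fun x hx hx' => (List.nodup_append'.1 hnd).2.2 hx hx'
    refine ⟨fun x => if x ∈ l then A v else A x, fun x hx => by simp [hx, hA],
      fun x hx => by simp [hdis x hx], fun ψ hψ => ?_⟩
    simp only [linkOK, beq_iff_eq]
    match l with
    | [] => exact hψ.2 u (Or.inl hu) v (Or.inl hv) (link_nil.1 hl)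
    | a :: l =>
      rw [link_cons] at hl
      -- The vertices after `a` number `2 * k - 1`, hence the index `k - 1`.
      rw [← eq_of_same_list hA hψ (k - 1) hl.2 (by simp at hk; omega)]
      · exact hψ.2 u (Or.inl hu) a (Or.inr (by simp)) hl.1
      · intro x hx
        have : x ∈ a :: l ∨ x = v := by simp at hx ⊢; tauto
        rcases this with hx | rfl
        · exact ⟨Or.inr hx, by simp only [hx, if_true]⟩
        · exact ⟨Or.inl hv, by simp only [hdis x hv, if_false]⟩
  | cons m ms ih =>
    match l, hk with
    | [], hk => simp at hk; omega
    | w :: l, hk =>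
      rw [link_cons] at hl
      intro hnd
      have hwbs : w ∉ bs := fun h => (List.nodup_append'.1 hnd).2.2 h (by simp)
      have hne : ∀ x ∈ bs, x ≠ w := fun x hx h => hwbs (h ▸ hx)
      -- The first vertex `w` joins the boundary with the list `m`; `Piece.absorb` returns it to the
      -- interior afterwards.
      have h1 := ih (bs := [w] ++ bs) (A := Function.update A w m) hl.2 (by simp) (by simp [hv])
        (by rwa [Function.update_of_ne (hne v hv)])
        (fun m' hm' => hq m' (by simp [hm'])) (by simp at hk; omega)
      have h2 := h1.absorb (A := A) (fun x hx => Function.update_of_ne (hne x hx) _ _)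
        (by simp [hq]) hnd
      obtain ⟨L, hL1, hL2, hL3⟩ := h2
      refine ⟨L, hL1, hL2, fun ψ hψ => ?_⟩
      obtain ⟨h3, h4⟩ := hL3 ψ hψ
      simp only [linkOK, List.any_eq_true, Bool.and_eq_true, beq_iff_eq]
      exact ⟨ψ w, by simpa using h3, hψ.2 u (Or.inl hu) w (Or.inr (by simp)) hl.1, h4⟩

/-- An arm followed by a cycle, hanging at `x`; the vertices other than `x` are the members of
`q`. -/
def Lolli (G : SimpleGraph V) (x : V) (q : List V) : Prop :=
  ∃ q₁ z q₂, x :: q = q₁ ++ z :: q₂ ∧ List.IsChain G.Adj (q₁ ++ z :: (q₂ ++ [z])) ∧ 2 ≤ q₂.length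

/-- A function that separates adjacent vertices. -/
def IsBicoloring (G : SimpleGraph V) (c : V → Bool) : Prop := ∀ x y, G.Adj x y → c x ≠ c y

theorem Link.parity {c : V → Bool} (hc : IsBicoloring G c) {u v : V} {l : List V}
    (h : Link G u l v) : c u = c v ↔ l.length % 2 = 1 := by
  induction l generalizing u with
  | nil => simpa using hc _ _ (link_nil.1 h)
  | cons w l ih =>
    rw [link_cons] at h
    have h1 := hc _ _ h.1
    have h2 := ih h.2
    simp only [List.length_cons]
    by_cases h3 : c w = c v
    · have := h2.1 h3
      constructor
      · intro h4; exact absurd (h4.trans h3.symm) h1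
      · omega
    · have : ¬ l.length % 2 = 1 := fun h => h3 (h2.2 h)
      constructor
      · omega
      · intro; revert h1 h3; cases c u <;> cases c v <;> cases c w <;> simp

/-- All arm vertices get the list `B`, so the pair where the cycle begins is that of `x` or its
complement, depending on the parity of the arm. Two triples of lists are needed since this parity is
not known: each step along the arm interchanges them and composes `R` with complementation. -/
theorem lolli_piece {c : V → Bool} (hc : IsBicoloring G c) {x : V} {q : List V} (hl : Lolli G x q)
    {bs : List V} {A : V → ℕ} {B : ℕ} (hB : Quad B) (hx : x ∈ bs) (hA : A x = B)
    {a b d a' b' d' : ℕ} (hq : ∀ m ∈ [a, b, d, a', b', d'], Quad m) {R : ℕ → Prop}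
    (h0 : ∀ X ∈ prs B, linkOK [a, b, d] X X = true → R X)
    (h1 : ∀ X ∈ prs B, linkOK [a', b', d'] X X = true → R (B ^^^ X)) :
    Piece G bs A q fun ψ => R (ψ x) := by
  classical
  obtain ⟨q₁, z, q₂, he, hch, hlen⟩ := hl
  induction q₁ generalizing x q bs A a b d a' b' d' R with
  | nil =>
    simp only [List.nil_append, List.cons.injEq] at he
    obtain ⟨rfl, rfl⟩ := he
    have hlk : Link G x q x := hch
    have hpar := (hlk.parity hc).1 rfl
    -- The cycle is even, so `q` has odd length at least 3: three prescribed lists, then an even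
    -- number of copies of `B`.
    refine (link_piece (ms := [a, b, d]) hlk hx hx (hA ▸ hB) ⟨⟨(q.length - 3) / 2, ?_⟩, ?_⟩).mono
      fun ψ hψ h => h0 _ (hA ▸ hψ x hx) h
    · simp only [List.length_cons, List.length_nil]; omega
    · intro m hm; exact hq m (by simp at hm ⊢; tauto)
  | cons x' q₁ ih =>
    simp only [List.cons_append, List.cons.injEq] at he
    obtain ⟨rfl, rfl⟩ := he
    have : ∃ y q', q₁ ++ z :: q₂ = y :: q' := by
      cases q₁ with
      | nil => exact ⟨_, _, rfl⟩
      | cons y q' => exact ⟨_, _, rfl⟩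
    obtain ⟨y, q', hy⟩ := this
    have hch2 : List.IsChain G.Adj (x :: (y :: q' ++ [z])) := by
      rw [← hy]; simpa using hch
    have hxy : G.Adj x y := by simp at hch2; exact hch2.1
    rw [hy]
    intro hnd
    have hwbs : y ∉ bs := fun h => (List.nodup_append'.1 hnd).2.2 h (by simp)
    have hne : ∀ w ∈ bs, w ≠ y := fun w hw h => hwbs (h ▸ hw)
    have h1 := ih (x := y) (q := q') (bs := [y] ++ bs) (A := Function.update A y B)
      (R := fun X => R (B ^^^ X)) (by simp) (by simp) (a := a') (b := b') (d := d') (a' := a)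
      (b' := b) (d' := d) (fun m hm => hq m (by simp at hm ⊢; tauto)) h1
      (fun X hX h => by
        rw [(quad_xor hB hX).2.1]
        exact h0 X hX h) hy.symm (by simpa using hch.tail)
    have h2 := h1.absorb (A := A) (fun x hx => Function.update_of_ne (hne x hx) _ _)
      (by simp [hB]) hnd
    obtain ⟨L, hL1, hL2, hL3⟩ := h2
    refine ⟨L, hL1, hL2, fun ψ hψ => ?_⟩
    obtain ⟨h3, h4⟩ := hL3 ψ hψ
    have hxm := hψ.1 x (Or.inl hx)
    rw [hL2 x hx, hA] at hxm
    have := (quad_xor hB hxm).2.2 (ψ y) (by simpa using h3)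
      (hψ.2 x (Or.inl hx) y (Or.inr (by simp)) hxy)
    rw [this, (quad_xor hB hxm).2.1] at h4
    exact h4


/-! ### Rooted gadgets -/

/-- If the root `r` has the list `B`, suitable lists on `l` force the pair of `r` to be in `P`. -/
def Gad (G : SimpleGraph V) (r : V) (B : ℕ) (l : List V) (P : List ℕ) : Prop :=
  Piece G [r] (fun _ => B) l fun ψ => ψ r ∈ P

theorem Gad.piece {r : V} {B : ℕ} {l : List V} {P : List ℕ} (h : Gad G r B l P) {bs : List V}
    {A : V → ℕ} (hr : r ∈ bs) (hA : A r = B) : Piece G bs A l fun ψ => ψ r ∈ P := by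
  classical
  intro hnd
  have hdis : ∀ v ∈ bs, v ∉ l := fun v hv hv' => (List.nodup_append'.1 hnd).2.2 hv hv'
  obtain ⟨L, h1, h2, h3⟩ := h (by
    simpa using ⟨hdis r hr, (List.nodup_append'.1 hnd).2.1⟩)
  refine ⟨fun v => if v ∈ l then L v else A v, fun v hv => by simp [hv, h1],
    fun v hv => by simp [hdis v hv], fun ψ hψ => h3 ψ (hψ.mono ?_ ?_)⟩
  · rintro v (hv | hv)
    · have : v = r := by simpa using hv
      simp [this, hr]
    · simp [hv]
  · rintro v (hv | hv)
    · have h4 : v = r := by simpa using hv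
      have h5 := h2 r (by simp)
      subst h4
      simp [hdis v hr, h5, hA]
    · simp [hv]

theorem Gad.mono {r : V} {B : ℕ} {l : List V} {P P' : List ℕ} (h : Gad G r B l P)
    (hP : ∀ X ∈ prs B, X ∈ P → X ∈ P') : Gad G r B l P' :=
  Piece.mono h fun _ hψ h => hP _ (hψ r (by simp)) h

theorem Gad.subset {r : V} {B : ℕ} {l l' : List V} {P : List ℕ} (h : Gad G r B l P) (hl : l.Nodup)
    (hll : l ⊆ l') : Gad G r B l' P :=
  Piece.subset h hl hll

theorem Gad.append {r : V} {B : ℕ} {l l' : List V} {P P' Q : List ℕ} (h : Gad G r B l P)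
    (h' : Gad G r B l' P') (hP : ∀ X ∈ P, X ∈ P' → X ∈ Q) : Gad G r B (l ++ l') Q :=
  (Piece.append h h').mono fun _ _ h => hP _ h.1 h.2

theorem Gad.not_choosable {r : V} {B : ℕ} {l : List V} (h : Gad G r B l []) (hB : Quad B)
    (hnd : (r :: l).Nodup) : ¬ Choosable G 4 2 :=
  not_choosable_of_piece (A := fun _ => B) hB hnd (Piece.mono h fun _ _ h => by simp at h)

/-- With the list `B` at both ends of the edge, the pair of `x` is the complement of the pair of
`y`. -/
theorem Gad.arm {x y : V} {B : ℕ} (hB : Quad B) {l : List V} {P : List ℕ} (h : Gad G y B l P)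
    (hxy : G.Adj x y) : Gad G x B (y :: l) (P.map (B ^^^ ·)) := by
  intro hnd
  have h1 : Piece G ([y] ++ [x]) (fun _ => B) l fun ψ => ψ y ∈ P := h.piece (by simp) rfl
  obtain ⟨L, hL1, hL2, hL3⟩ := h1.absorb (A := fun _ => B) (by simp) (by simp [hB]) hnd
  refine ⟨L, hL1, hL2, fun ψ hψ => ?_⟩
  obtain ⟨h3, h4⟩ := hL3 ψ hψ
  have hx := hψ.1 x (by simp)
  rw [hL2 x (by simp)] at hx
  have := (quad_xor hB hx).2.2 (ψ y) (by simpa using h3) (hψ.2 x (by simp) y (by simp) hxy)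
  rw [List.mem_map]
  exact ⟨ψ y, h4, by rw [this, (quad_xor hB hx).2.1]⟩

/-- Interchange the bits `i` and `j`. -/
def swapBits (i j m : ℕ) : ℕ := if m.testBit i = m.testBit j then m else m ^^^ (2 ^ i + 2 ^ j)

theorem Quad.swapBits {i j m : ℕ} (hi : i < 4) (hj : j < 4) (hm : Quad m) :
    Quad (swapBits i j m) ∧ ∀ k ∈ prs (swapBits i j m),
      FourTwo.swapBits i j k ∈ prs m ∧ FourTwo.swapBits i j (FourTwo.swapBits i j k) = k := by
  have key : ∀ i ∈ List.range 4, ∀ j ∈ List.range 4, ∀ m ∈ (List.range 128).filter (Quad ·),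
    Quad (FourTwo.swapBits i j m) ∧ ∀ k ∈ prs (FourTwo.swapBits i j m),
      FourTwo.swapBits i j k ∈ prs m ∧ FourTwo.swapBits i j (FourTwo.swapBits i j k) = k := by
    decide +kernel
  exact key i (List.mem_range.2 hi) j (List.mem_range.2 hj) m
    (List.mem_filter.2 ⟨List.mem_range.2 hm.1, by simpa using hm⟩)

theorem land_swapBits : ∀ i < 4, ∀ j < 4, ∀ k ∈ pairMasks, ∀ k' ∈ pairMasks, k &&& k' = 0 →
    swapBits i j k &&& swapBits i j k' = 0 := by
  decide +kernel

/-- Colours may be interchanged. -/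
theorem Gad.swap {r : V} {l : List V} {P : List ℕ} (h : Gad G r 15 l P) {i j : ℕ} (hi : i < 4)
    (hj : j < 4) : Gad G r 15 l (P.map (swapBits i j)) := by
  intro hnd
  -- Only the colours 0 to 3 are permuted, so that the root keeps the list 15.
  have h15 : ∀ i < 4, ∀ j < 4, swapBits i j 15 = 15 := by decide
  obtain ⟨L, h1, h2, h3⟩ := h hnd
  refine ⟨fun v => swapBits i j (L v), ?_, ?_, ?_⟩
  · intro v hv
    exact ((h1 v hv).swapBits hi hj).1
  · intro v hv
    simp [h2 v hv, h15 i hi j hj]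
  · intro ψ hψ
    have hq : ∀ v ∈ {v | v ∈ [r] ∨ v ∈ l}, Quad (L v) := by
      rintro v (hv | hv)
      · rw [h2 v hv]; exact (by decide : Quad 15)
      · exact h1 v hv
    have key : ∀ v ∈ {v | v ∈ [r] ∨ v ∈ l}, swapBits i j (ψ v) ∈ prs (L v) ∧
        swapBits i j (swapBits i j (ψ v)) = ψ v := fun v hv =>
      ((hq v hv).swapBits hi hj).2 _ (hψ.1 v hv)
    have := h3 (fun v => swapBits i j (ψ v)) ⟨fun v hv => (key v hv).1, fun v hv w hw hvw =>
      land_swapBits i hi j hj _ (mem_pairMasks (hψ.1 v hv)) _ (mem_pairMasks (hψ.1 w hw))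
        (hψ.2 v hv w hw hvw)⟩
    rw [List.mem_map]
    exact ⟨_, this, (key r (by simp)).2⟩

/-- Lists on `l` restrict the root to three pairs that form a path in `K₄`. -/
def Gad3 (G : SimpleGraph V) (r : V) (l : List V) : Prop := Gad G r 15 l [5, 9, 10]

/-- Lists on `l` restrict the root to two intersecting pairs. -/
def Gad4 (G : SimpleGraph V) (r : V) (l : List V) : Prop := Gad G r 15 l [3, 5]

/-- Two intersecting pairs are two adjacent edges of K₄ and extend to a path; renaming colours makes
it the standard one. -/
theorem Gad4.gad3 {r : V} {l : List V} (h : Gad4 G r l) : Gad3 G r l :=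
  ((Gad.swap h (i := 1) (j := 3) (by simp) (by simp)).swap (i := 2) (j := 3) (by simp)
    (by simp)).mono (by decide)

theorem Gad3.subset {r : V} {l l' : List V} (h : Gad3 G r l) (hl : l.Nodup) (hll : l ⊆ l') :
    Gad3 G r l' := Gad.subset h hl hll

theorem Gad4.subset {r : V} {l l' : List V} (h : Gad4 G r l) (hl : l.Nodup) (hll : l ⊆ l') :
    Gad4 G r l' := Gad.subset h hl hll

/-- `t` consists of the vertices after `x` of a walk from `x` to `r`. -/
def Arm (G : SimpleGraph V) : V → List V → V → Prop
  | x, [], r => x = r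
  | x, y :: t, r => G.Adj x y ∧ Arm G y t r

/-- Complementation in `{0, 1, 2, 3}` maps the path 2-0-3-1, whose edges are the allowed pairs, to
the path 3-1-2-0. Up to renaming colours the restriction is therefore unchanged by a step along the
arm, and the parity of the arm is irrelevant. -/
theorem Gad3.arm {x r : V} {t l : List V} (h : Gad3 G r l) (ht : Arm G x t r) :
    Gad3 G x (t ++ l) := by
  induction t generalizing x with
  | nil => exact ht ▸ h
  | cons y t ih =>
    have := Gad.arm (by decide) (ih ht.2) ht.1
    exact ((this.swap (i := 0) (j := 1) (by simp) (by simp)).swap (i := 2) (j := 3) (by simp)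
      (by simp)).mono (by decide)

/-- The complement in K₄ of a path on four vertices is again such a path: after renaming, the second
gadget allows 01, 12, 23, whereas the first allows 02, 03, 13. -/
theorem not_choosable_of_gad3 {r : V} {l l' : List V} (h : Gad3 G r l) (h' : Gad3 G r l')
    (hnd : (r :: (l ++ l')).Nodup) : ¬ Choosable G 4 2 := by
  have : Gad G r 15 l' [3, 6, 12] :=
    (((Gad.swap h' (i := 0) (j := 2) (by simp) (by simp)).swap (i := 1) (j := 2) (by simp)
      (by simp)).swap (i := 2) (j := 3) (by simp) (by simp)).mono (by decide)
  exact (Gad.append h this (by decide)).not_choosable (by decide) hnd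

/-! ### Certificates -/

/-- A piece that works whenever the vertices `vs` have the lists `ms`. -/
def Frag (G : SimpleGraph V) (vs : List V) (ms : List ℕ) (p : List V × ((V → ℕ) → Prop)) : Prop :=
  ∀ bs A, vs ⊆ bs → vs.map A = ms → Piece G bs A p.1 p.2

theorem exists_assign (A : V → ℕ) {ws : List V} {ms : List ℕ} (hnd : ws.Nodup)
    (hlen : ws.length = ms.length) : ∃ A', ws.map A' = ms ∧ ∀ x, x ∉ ws → A' x = A x := by
  classical
  induction ws generalizing ms with
  | nil => exact ⟨A, by simpa [eq_comm] using hlen, fun _ _ => rfl⟩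
  | cons w ws ih =>
    match ms, hlen with
    | m :: ms, hlen =>
      rw [List.nodup_cons] at hnd
      obtain ⟨A', h1, h2⟩ := ih hnd.2 (by simpa using hlen)
      refine ⟨Function.update A' w m, ?_, fun x hx => ?_⟩
      · rw [List.map_cons, Function.update_self, ← h1]
        congr 1
        refine List.map_congr_left fun x hx => Function.update_of_ne ?_ _ _
        rintro rfl
        exact hnd.1 hx
      · simp only [List.mem_cons, not_or] at hx
        rw [Function.update_of_ne hx.1, h2 x hx.2]

theorem forall₂_map {A ψ : V → ℕ} (vs : List V) (h : ∀ v ∈ vs, ψ v ∈ prs (A v)) :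
    List.Forall₂ (fun v m => ψ v ∈ prs m) vs (vs.map A) := by
  rw [List.forall₂_map_right_iff]
  exact List.forall₂_same.2 h

/-- The lists on `ws` are fixed first, so that all fragments share the boundary `r :: ws`; absorbing
`ws` then leaves `r` as the only boundary vertex. -/
theorem gad_of_frags {r : V} {ws : List V} {B : ℕ} {ms P : List ℕ}
    (ps : List (List V × ((V → ℕ) → Prop))) (hq : ∀ m ∈ ms, Quad m) (hlen : ws.length = ms.length)
    (h : ps.Forall (Frag G (r :: ws) (B :: ms)))
    (hfin : ∀ ψ : V → ℕ, List.Forall₂ (fun v m => ψ v ∈ prs m) (r :: ws) (B :: ms) →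
      (ps.Forall fun p => p.2 ψ) → ψ r ∈ P) :
    Gad G r B (ws ++ ps.flatMap Prod.fst) P := by
  intro hnd
  have hws : ws.Nodup := hnd.sublist (by simp)
  have hr : r ∉ ws := fun h => by
    simp [h] at hnd
  obtain ⟨A', hA, hA'⟩ := exists_assign (fun _ => B) hws hlen
  have h1 : Piece G (ws ++ [r]) A' (ps.flatMap Prod.fst) fun ψ => ps.Forall fun p => p.2 ψ :=
    Piece.all (h.imp fun p hp => hp _ A' (by
      intro x hx; simp at hx ⊢; tauto) (by simp [hA, hA' r hr]))
  have hquad : ∀ w ∈ ws, Quad (A' w) := fun w hw => hq _ (hA ▸ List.mem_map_of_mem hw)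
  refine (h1.absorb (A := fun _ => B) ?_ hquad).mono (fun ψ hψ h2 => hfin ψ ?_ h2.2) hnd
  · intro v hv
    rw [List.mem_singleton.1 hv, hA' r hr]
  · have := forall₂_map (A := A') (r :: ws) (ψ := ψ) (by
      intro v hv
      rcases List.mem_cons.1 hv with rfl | hv
      · rw [hA' v hr]; exact hψ v (by simp)
      · exact h2.1 v hv)
    rwa [List.map_cons, hA, hA' r hr] at this

/-- `l` has at least `n` members, and the same parity. -/
def AtLeast (l : List V) (n : ℕ) : Prop := n ≤ l.length ∧ l.length % 2 = n % 2

/-- The fragment of a link with lists `c`. -/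
def lk (u : V) (l : List V) (v : V) (c : List ℕ) : List V × ((V → ℕ) → Prop) :=
  (l, fun ψ => linkOK c (ψ u) (ψ v) = true)

theorem frag_link {vs : List V} {ms c : List ℕ} {u v : V} {l : List V} (hl : Link G u l v)
    (hlen : AtLeast l c.length) (hu : u ∈ vs) (hv : v ∈ vs)
    (hq : (∀ m ∈ ms, Quad m) ∧ ∀ m ∈ c, Quad m) : Frag G vs ms (lk u l v c) := by
  intro bs A hbs hA
  refine link_piece hl (hbs hu) (hbs hv) (hq.1 _ (hA ▸ List.mem_map_of_mem hv))
    ⟨⟨(l.length - c.length) / 2, ?_⟩, hq.2⟩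
  have := hlen.1
  have := hlen.2
  simp only [lk]
  omega

/-- The fragment of a gadget. -/
def gd (x : V) (l : List V) (P : List ℕ) : List V × ((V → ℕ) → Prop) := (l, fun ψ => ψ x ∈ P)

theorem frag_gad {vs : List V} {ms P : List ℕ} {x : V} {B : ℕ} {l : List V} (h : Gad G x B l P)
    (hx : (x, B) ∈ vs.zip ms) : Frag G vs ms (gd x l P) := by
  intro bs A hbs hA
  subst hA
  have h1 : ∀ vs : List V, (x, B) ∈ vs.zip (vs.map A) → A x = B := by
    intro vs
    induction vs with
    | nil => simp
    | cons v vs ih =>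
      simp only [List.map_cons, List.zip_cons_cons, List.mem_cons, Prod.mk.injEq]
      rintro (⟨rfl, rfl⟩ | h)
      · rfl
      · exact ih h
  exact h.piece (hbs (List.of_mem_zip hx).1) (h1 vs hx)

theorem Lolli.gad {c : V → Bool} (hc : IsBicoloring G c) {x : V} {q : List V} (hl : Lolli G x q)
    {B : ℕ} {P : List ℕ} (a b d a' b' d' : ℕ)
    (hq : ∀ m ∈ B :: [a, b, d, a', b', d'], Quad m)
    (h : ∀ X ∈ prs B, (linkOK [a, b, d] X X = true → X ∈ P) ∧
      (linkOK [a', b', d'] X X = true → B ^^^ X ∈ P)) : Gad G x B q P :=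
  lolli_piece hc hl (hq B (by simp)) (by simp) rfl (fun m hm => hq m (List.mem_cons_of_mem _ hm))
    (R := fun X => X ∈ P) (fun X hX => (h X hX).1) fun X hX => (h X hX).2


/-- The choices `Ys` for the first vertices are compatible with the links and gadgets that end at
the last of them. A link `(i, j, c)` joins the vertices `i` and `j` and has the lists `c`. -/
def stepOK (E : List (ℕ × ℕ × List ℕ)) (gs : List (ℕ × List ℕ)) (Ys : List ℕ) : Bool :=
  (E.all fun e => !(max e.1 e.2.1 + 1 == Ys.length) ||
    linkOK e.2.2 (Ys.getD e.1 0) (Ys.getD e.2.1 0)) &&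
  gs.all fun g => !(g.1 + 1 == Ys.length) || g.2.contains (Ys.getD g.1 0)

/-- Every compatible choice that extends `Xs` by pairs from the lists `ms` begins with a member of
`P`. -/
def search (E : List (ℕ × ℕ × List ℕ)) (gs : List (ℕ × List ℕ)) (P : List ℕ) :
    List ℕ → List ℕ → Bool
  | [], Xs => P.contains (Xs.getD 0 0)
  | m :: ms, Xs => (prs m).all fun X => !stepOK E gs (Xs ++ [X]) || search E gs P ms (Xs ++ [X])

/-- Soundness of the search: the pairs given by `ψ` follow one branch of the search tree, and no
test fails on it. The default 0 is never read, because a constraint is tested only when all its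
vertices have received a pair. -/
theorem mem_of_search {E : List (ℕ × ℕ × List ℕ)} {gs : List (ℕ × List ℕ)} {P : List ℕ}
    {vs : List V} {r : V} {ψ : V → ℕ}
    (hE : ∀ e ∈ E, linkOK e.2.2 (ψ (vs.getD e.1 r)) (ψ (vs.getD e.2.1 r)) = true)
    (hg : ∀ g ∈ gs, ψ (vs.getD g.1 r) ∈ g.2) {ms : List ℕ} :
    ∀ {pre post : List V}, vs = pre ++ post → vs ≠ [] →
      List.Forall₂ (fun v m => ψ v ∈ prs m) post ms →
      search E gs P ms (pre.map ψ) = true → ψ (vs.getD 0 r) ∈ P := by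
  have hget : ∀ {l l' : List V} {i : ℕ}, i < l.length →
      (l.map ψ).getD i 0 = ψ ((l ++ l').getD i r) := by
    intro l l' i hi
    simp [List.getD_eq_getElem?_getD, List.getElem?_append_left, hi]
  induction ms with
  | nil =>
    rintro pre post rfl hne hpost hs
    cases hpost
    simp only [search, List.contains_iff_mem] at hs
    rwa [hget (l' := []) (List.length_pos_iff.2 (by simpa using hne))] at hs
  | cons m ms ih =>
    rintro pre post rfl hne hpost hs
    obtain _ | ⟨hv, hpost⟩ := hpost
    rename_i v post
    simp only [search, List.all_eq_true] at hs
    have := hs _ hv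
    simp only [Bool.or_eq_true, Bool.not_eq_true'] at this
    have hmap : pre.map ψ ++ [ψ v] = (pre ++ [v]).map ψ := by simp
    have heq : pre ++ v :: post = (pre ++ [v]) ++ post := by simp
    rw [hmap] at this
    refine ih heq hne hpost (this.resolve_left ?_)
    rw [Bool.not_eq_false, stepOK, Bool.and_eq_true, List.all_eq_true, List.all_eq_true]
    constructor
    · intro e he
      by_cases hl : max e.1 e.2.1 + 1 = ((pre ++ [v]).map ψ).length
      · rw [List.length_map] at hl
        rw [hget (l' := post) (by omega), hget (l' := post) (by omega), ← heq, hE e he,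
          Bool.or_true]
      · rw [beq_false_of_ne hl, Bool.not_false, Bool.true_or]
    · intro g hg'
      by_cases hl : g.1 + 1 = ((pre ++ [v]).map ψ).length
      · rw [List.length_map] at hl
        rw [hget (l' := post) (by omega), ← heq, List.contains_iff_mem.2 (hg g hg'), Bool.or_true]
      · rw [beq_false_of_ne hl, Bool.not_false, Bool.true_or]

/-- A link with at least `n` interior vertices, and the same parity. -/
def LongLink (G : SimpleGraph V) (u : V) (l : List V) (v : V) (n : ℕ) : Prop :=
  Link G u l v ∧ AtLeast l n

/-- A system of links and gadgets between the vertices `r :: ws` with lists `B :: ms`. -/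
theorem gad_of_search {r : V} {ws : List V} {B : ℕ} {ms P : List ℕ}
    {E : List (ℕ × ℕ × List ℕ)} {ls : List (List V)} {gs : List (ℕ × List ℕ)} {qs : List (List V)}
    (hE : List.Forall₂ (fun e l => LongLink G ((r :: ws).getD e.1 r) l
      ((r :: ws).getD e.2.1 r) e.2.2.length) E ls)
    (hg : List.Forall₂ (fun g q => Gad G ((r :: ws).getD g.1 r) ((B :: ms).getD g.1 0) q g.2) gs qs)
    (hlen : ws.length = ms.length)
    (hq : (∀ m ∈ B :: ms, Quad m) ∧ (∀ e ∈ E, (e.1 ≤ ms.length ∧ e.2.1 ≤ ms.length) ∧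
      ∀ m ∈ e.2.2, Quad m) ∧ ∀ g ∈ gs, g.1 ≤ ms.length)
    (hs : search E gs P (B :: ms) [] = true) :
    Gad G r B (ws ++ (ls ++ qs).flatten) P := by
  have hmem : ∀ i ≤ ms.length, (r :: ws).getD i r ∈ r :: ws := fun i hi => by
    rw [List.getD_eq_getElem _ _ (by simp; omega)]
    exact List.getElem_mem _
  have key : Gad G r B (ws ++ ((List.zipWith (fun e l => lk ((r :: ws).getD e.1 r) l
      ((r :: ws).getD e.2.1 r) e.2.2) E ls) ++ List.zipWith
      (fun g q => gd ((r :: ws).getD g.1 r) q g.2) gs qs).flatMap Prod.fst) P := by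
    refine gad_of_frags _ (fun m hm => hq.1 m (List.mem_cons_of_mem _ hm)) hlen ?_ ?_
    · rw [List.forall_append]
      constructor
      · obtain ⟨h0, h1, -⟩ := hq
        clear hs
        induction hE with
        | nil => simp
        | @cons e l E ls he _ ih =>
          rw [List.zipWith_cons_cons, List.forall_cons]
          refine ⟨frag_link he.1 he.2 (hmem _ (h1 e (by simp)).1.1) (hmem _ (h1 e (by simp)).1.2)
            ⟨h0, (h1 e (by simp)).2⟩, ih fun e he => h1 e (by simp [he])⟩
      · have h1 := hq.2.2
        clear hq hs
        induction hg with
        | nil => simp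
        | @cons g q gs qs hg _ ih =>
          rw [List.zipWith_cons_cons, List.forall_cons]
          refine ⟨frag_gad hg ?_, ih fun g hg => h1 g (by simp [hg])⟩
          have h2 := h1 g (by simp)
          rw [List.getD_eq_getElem _ _ (by simp; omega), List.getD_eq_getElem _ _ (by simp; omega)]
          rw [← List.getElem_zip]
          · exact List.getElem_mem _
          · simp; omega
    · intro ψ h1 h0
      obtain ⟨h2, h3⟩ := List.forall_append.1 h0
      clear h0
      refine mem_of_search (r := r) (ψ := ψ) (vs := r :: ws) ?_ ?_ (pre := []) rfl (by simp) h1 hs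
      · clear hq hs
        induction hE with
        | nil => simp
        | @cons e l E ls he _ ih =>
          rw [List.zipWith_cons_cons, List.forall_cons] at h2
          rw [List.forall_mem_cons]
          exact ⟨h2.1, ih h2.2⟩
      · clear hq hs
        induction hg with
        | nil => simp
        | @cons g q gs qs hg _ ih =>
          rw [List.zipWith_cons_cons, List.forall_cons] at h3
          rw [List.forall_mem_cons]
          exact ⟨h3.1, ih h3.2⟩
  have e1 : (List.zipWith (fun (e : ℕ × ℕ × List ℕ) l => lk ((r :: ws).getD e.1 r) l
      ((r :: ws).getD e.2.1 r) e.2.2) E ls).flatMap Prod.fst = ls.flatten := by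
    clear hq hs key
    induction hE with
    | nil => simp
    | cons _ _ ih => simpa [lk] using ih
  have e2 : (List.zipWith (fun (g : ℕ × List ℕ) q => gd ((r :: ws).getD g.1 r) q g.2)
      gs qs).flatMap Prod.fst = qs.flatten := by
    clear hq hs key
    induction hg with
    | nil => simp
    | cons _ _ ih => simpa [gd] using ih
  rwa [List.flatMap_append, e1, e2, ← List.flatten_append] at key

/-- Rearrangements of concatenated vertex lists are verified by comparing multiplicities, which
reduces them to linear arithmetic. -/
theorem nodup_of_count [DecidableEq V] {l l' : List V} (h : l'.Nodup)
    (hle : ∀ a, l.count a ≤ l'.count a) : l.Nodup :=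
  List.nodup_iff_count_le_one.2 fun a => (hle a).trans (List.nodup_iff_count_le_one.1 h a)


/-! ### Lower bounds on the lengths of links from the bipartition -/

section Parity

variable {c : V → Bool} {u v : V} {l : List V}

theorem Link.long_zero (h : Link G u l v) (hc : IsBicoloring G c) (hne : c u ≠ c v) :
    LongLink G u l v 0 := by
  have := mt (h.parity hc).2 hne
  exact ⟨h, by simp [AtLeast]; omega⟩

theorem Link.long_one (h : Link G u l v) (hc : IsBicoloring G c) (he : c u = c v) :
    LongLink G u l v 1 := by
  have := (h.parity hc).1 he
  exact ⟨h, by simp [AtLeast]; omega⟩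

theorem Link.long_two (h : Link G u l v) (hc : IsBicoloring G c) (hne : c u ≠ c v) (hl : l ≠ []) :
    LongLink G u l v 2 := by
  have := mt (h.parity hc).2 hne
  have := List.length_pos_iff.2 hl
  exact ⟨h, by simp [AtLeast]; omega⟩

theorem Link.long_three (h : Link G u l v) (hc : IsBicoloring G c) (he : c u = c v)
    (hl : l.length ≠ 1) : LongLink G u l v 3 := by
  have := (h.parity hc).1 he
  exact ⟨h, by simp [AtLeast]; omega⟩

end Parity

/-! ### Layouts that are not choosable -/

section NotChoosable

variable {u v x y : V} {l₁ l₂ l₃ l₄ l₅ l₆ : List V}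

/-- The numbers here and in the next lemmas are certificates: lists `B`, `ms` at the branch vertices
and lists in `E` on the links, for which the search leaves no pair at the root (`P` is empty).
Longer links of the same parity are covered by padding. -/
theorem not_choosable_theta_odd (h₁ : LongLink G u l₁ v 2) (h₂ : LongLink G u l₂ v 2)
    (h₃ : LongLink G u l₃ v 2) (hnd : (u :: v :: (l₁ ++ l₂ ++ l₃)).Nodup) : ¬ Choosable G 4 2 :=
  (gad_of_search (ws := [v]) (B := 29) (ms := [29]) (ls := [l₁, l₂, l₃]) (qs := []) (gs := [])
    (E := [(0, 1, [27, 30]), (0, 1, [30, 15]), (0, 1, [15, 27])]) (P := [])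
    (.cons h₁ (.cons h₂ (.cons h₃ .nil))) .nil rfl (by decide +kernel)
    (by decide +kernel)).not_choosable (by decide) (by simpa using hnd)

theorem not_choosable_theta_even (h₁ : LongLink G u l₁ v 3) (h₂ : LongLink G u l₂ v 3)
    (h₃ : LongLink G u l₃ v 3) (hnd : (u :: v :: (l₁ ++ l₂ ++ l₃)).Nodup) : ¬ Choosable G 4 2 :=
  (gad_of_search (ws := [v]) (B := 23) (ms := [23]) (ls := [l₁, l₂, l₃]) (qs := []) (gs := [])
    (E := [(0, 1, [23, 29, 30]), (0, 1, [23, 27, 29]), (0, 1, [23, 30, 27])]) (P := [])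
    (.cons h₁ (.cons h₂ (.cons h₃ .nil))) .nil rfl (by decide +kernel)
    (by decide +kernel)).not_choosable (by decide) (by simpa using hnd)

theorem not_choosable_four_links (h₁ : LongLink G u l₁ v 1) (h₂ : LongLink G u l₂ v 1)
    (h₃ : LongLink G u l₃ v 1) (h₄ : LongLink G u l₄ v 3)
    (hnd : (u :: v :: (l₁ ++ l₂ ++ l₃ ++ l₄)).Nodup) : ¬ Choosable G 4 2 :=
  (gad_of_search (ws := [v]) (B := 46) (ms := [53]) (ls := [l₁, l₂, l₃, l₄]) (qs := []) (gs := [])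
    (E := [(0, 1, [30]), (0, 1, [45]), (0, 1, [39]), (0, 1, [60, 29, 53])]) (P := [])
    (.cons h₁ (.cons h₂ (.cons h₃ (.cons h₄ .nil)))) .nil rfl (by decide +kernel)
    (by decide +kernel)).not_choosable (by decide) (by simpa using hnd)

theorem not_choosable_five_links (h₁ : LongLink G u l₁ v 1) (h₂ : LongLink G u l₂ v 1)
    (h₃ : LongLink G u l₃ v 1) (h₄ : LongLink G u l₄ v 1) (h₅ : LongLink G u l₅ v 1)
    (hnd : (u :: v :: (l₁ ++ l₂ ++ l₃ ++ l₄ ++ l₅)).Nodup) : ¬ Choosable G 4 2 :=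
  (gad_of_search (ws := [v]) (B := 75) (ms := [60]) (ls := [l₁, l₂, l₃, l₄, l₅]) (qs := [])
    (gs := []) (E := [(0, 1, [30]), (0, 1, [108]), (0, 1, [43]), (0, 1, [120]), (0, 1, [29])])
    (P := []) (.cons h₁ (.cons h₂ (.cons h₃ (.cons h₄ (.cons h₅ .nil))))) .nil rfl
    (by decide +kernel) (by decide +kernel)).not_choosable (by decide) (by simpa using hnd)

theorem atLeast_nil : AtLeast ([] : List V) 0 := by simp [AtLeast]

theorem not_choosable_of_K33 {a₁ a₂ a₃ b₁ b₂ b₃ : V} (hnd : [a₁, a₂, a₃, b₁, b₂, b₃].Nodup)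
    (h : ∀ a ∈ [a₁, a₂, a₃], ∀ b ∈ [b₁, b₂, b₃], G.Adj a b) : ¬ Choosable G 4 2 := by
  have hl : ∀ a ∈ [a₁, a₂, a₃], ∀ b ∈ [b₁, b₂, b₃], LongLink G a [] b 0 :=
    fun a ha b hb => ⟨link_nil.2 (h a ha b hb), atLeast_nil⟩
  simp only [List.forall_mem_cons, List.not_mem_nil, false_imp_iff, implies_true, and_true] at hl
  obtain ⟨⟨h1, h2, h3⟩, ⟨h4, h5, h6⟩, h7, h8, h9⟩ := hl
  exact (gad_of_search (ws := [a₂, a₃, b₁, b₂, b₃]) (B := 29) (ms := [51, 15, 23, 45, 27])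
    (ls := [[], [], [], [], [], [], [], [], []]) (qs := []) (gs := [])
    (E := [(0, 3, []), (0, 4, []), (0, 5, []), (1, 3, []), (1, 4, []), (1, 5, []), (2, 3, []),
      (2, 4, []), (2, 5, [])]) (P := [])
    (.cons h1 (.cons h2 (.cons h3 (.cons h4 (.cons h5 (.cons h6 (.cons h7 (.cons h8
      (.cons h9 .nil))))))))) .nil rfl (by decide +kernel)
    (by decide +kernel)).not_choosable (by decide) (by simpa using hnd)

/-- Six links between four vertices. The indices of the links are `uv, ux, uy, vx, vy, xy`. -/
structure K4Layout (G : SimpleGraph V) (u v x y : V) (l₁ l₂ l₃ l₄ l₅ l₆ : List V) : Prop where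
  h₁ : Link G u l₁ v
  h₂ : Link G u l₂ x
  h₃ : Link G u l₃ y
  h₄ : Link G v l₄ x
  h₅ : Link G v l₅ y
  h₆ : Link G x l₆ y
  nd : (u :: v :: x :: y :: (l₁ ++ l₂ ++ l₃ ++ l₄ ++ l₅ ++ l₆)).Nodup

theorem K4Layout.swap₁ (h : K4Layout G u v x y l₁ l₂ l₃ l₄ l₅ l₆) :
    K4Layout G v u x y l₁.reverse l₄ l₅ l₂ l₃ l₆ := by
  classical
  exact ⟨h.h₁.symm, h.h₄, h.h₅, h.h₂, h.h₃, h.h₆, nodup_of_count h.nd fun a => by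
    simp [List.count_cons]; omega⟩

theorem K4Layout.swap₂ (h : K4Layout G u v x y l₁ l₂ l₃ l₄ l₅ l₆) :
    K4Layout G u x v y l₂ l₁ l₃ l₄.reverse l₆ l₅ := by
  classical
  exact ⟨h.h₂, h.h₁, h.h₃, h.h₄.symm, h.h₆, h.h₅, nodup_of_count h.nd fun a => by
    simp [List.count_cons]; omega⟩

theorem K4Layout.swap₃ (h : K4Layout G u v x y l₁ l₂ l₃ l₄ l₅ l₆) :
    K4Layout G u v y x l₁ l₃ l₂ l₅ l₄ l₆.reverse := by
  classical
  exact ⟨h.h₁, h.h₃, h.h₂, h.h₅, h.h₄, h.h₆.symm, nodup_of_count h.nd fun a => by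
    simp [List.count_cons]; omega⟩

theorem K4Layout.not_choosable_star (h : K4Layout G u v x y l₁ l₂ l₃ l₄ l₅ l₆) {c : V → Bool}
    (hc : IsBicoloring G c) (hv : c u ≠ c v) (hx : c u ≠ c x) (hy : c u ≠ c y)
    (hvx : c v = c x) (hvy : c v = c y) : ¬ Choosable G 4 2 :=
  (gad_of_search (ws := [v, x, y]) (B := 89) (ms := [75, 29, 120])
    (ls := [l₁, l₂, l₃, l₄, l₅, l₆]) (qs := []) (gs := [])
    (E := [(0, 1, []), (0, 2, []), (0, 3, []), (1, 2, [30]), (1, 3, [43]), (2, 3, [108])])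
    (P := []) (.cons (h.h₁.long_zero hc hv) (.cons (h.h₂.long_zero hc hx)
      (.cons (h.h₃.long_zero hc hy) (.cons (h.h₄.long_one hc hvx) (.cons (h.h₅.long_one hc hvy)
      (.cons (h.h₆.long_one hc (hvx ▸ hvy)) .nil)))))) .nil rfl (by decide +kernel)
    (by decide +kernel)).not_choosable (by decide) (by simpa using h.nd)

theorem K4Layout.not_choosable_even (h : K4Layout G u v x y l₁ l₂ l₃ l₄ l₅ l₆) {c : V → Bool}
    (hc : IsBicoloring G c) (hv : c u = c v) (hx : c u = c x) (hy : c u = c y) :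
    ¬ Choosable G 4 2 :=
  (gad_of_search (ws := [v, x, y]) (B := 27) (ms := [23, 30, 29])
    (ls := [l₁, l₂, l₃, l₄, l₅, l₆]) (qs := []) (gs := [])
    (E := [(0, 1, [27]), (0, 2, [23]), (0, 3, [30]), (1, 2, [29]), (1, 3, [29]), (2, 3, [27])])
    (P := []) (.cons (h.h₁.long_one hc hv) (.cons (h.h₂.long_one hc hx)
      (.cons (h.h₃.long_one hc hy) (.cons (h.h₄.long_one hc (hv ▸ hx))
      (.cons (h.h₅.long_one hc (hv ▸ hy)) (.cons (h.h₆.long_one hc (hx ▸ hy)) .nil)))))) .nil rfl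
    (by decide +kernel) (by decide +kernel)).not_choosable (by decide) (by simpa using h.nd)

theorem K4Layout.not_choosable_long_side (h : K4Layout G u v x y l₁ l₂ l₃ l₄ l₅ l₆) {c : V → Bool}
    (hc : IsBicoloring G c) (hv : c u = c v) (hxy : c x = c y) (hx : c u ≠ c x) (hl : l₂ ≠ []) :
    ¬ Choosable G 4 2 :=
  (gad_of_search (ws := [v, x, y]) (B := 15) (ms := [23, 15, 30])
    (ls := [l₁, l₂, l₃, l₄, l₅, l₆]) (qs := []) (gs := [])
    (E := [(0, 1, [27]), (0, 2, [23, 30]), (0, 3, []), (1, 2, []), (1, 3, []), (2, 3, [27])])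
    (P := []) (.cons (h.h₁.long_one hc hv) (.cons (h.h₂.long_two hc hx hl)
      (.cons (h.h₃.long_zero hc (hxy ▸ hx)) (.cons (h.h₄.long_zero hc (hv ▸ hx))
      (.cons (h.h₅.long_zero hc (hv ▸ hxy ▸ hx)) (.cons (h.h₆.long_one hc hxy) .nil)))))) .nil rfl
    (by decide +kernel) (by decide +kernel)).not_choosable (by decide) (by simpa using h.nd)

theorem K4Layout.not_choosable_long_diagonals (h : K4Layout G u v x y l₁ l₂ l₃ l₄ l₅ l₆)
    {c : V → Bool} (hc : IsBicoloring G c) (hv : c u = c v) (hxy : c x = c y) (hx : c u ≠ c x)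
    (hl : l₁.length ≠ 1) (hl' : l₆.length ≠ 1) : ¬ Choosable G 4 2 :=
  (gad_of_search (ws := [v, x, y]) (B := 23) (ms := [27, 23, 29])
    (ls := [l₁, l₂, l₃, l₄, l₅, l₆]) (qs := []) (gs := [])
    (E := [(0, 1, [27, 29, 15]), (0, 2, []), (0, 3, []), (1, 2, []), (1, 3, []),
      (2, 3, [29, 27, 15])])
    (P := []) (.cons (h.h₁.long_three hc hv hl) (.cons (h.h₂.long_zero hc hx)
      (.cons (h.h₃.long_zero hc (hxy ▸ hx)) (.cons (h.h₄.long_zero hc (hv ▸ hx))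
      (.cons (h.h₅.long_zero hc (hv ▸ hxy ▸ hx)) (.cons (h.h₆.long_three hc hxy hl') .nil))))))
    .nil rfl (by decide +kernel) (by decide +kernel)).not_choosable (by decide) (by simpa using h.nd)

/-- The symmetries of K₄ that preserve the partition into `{u, v}` and `{x, y}` carry each of the
four links between the classes to `l₂`, so one certificate serves for all of them. -/
theorem K4Layout.links_eq_nil (h : K4Layout G u v x y l₁ l₂ l₃ l₄ l₅ l₆) {c : V → Bool}
    (hc : IsBicoloring G c) (hch : Choosable G 4 2) (hv : c u = c v) (hxy : c x = c y)
    (hx : c u ≠ c x) :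
    l₂ = [] ∧ l₃ = [] ∧ l₄ = [] ∧ l₅ = [] ∧ (l₁.length = 1 ∨ l₆.length = 1) := by
  refine ⟨?_, ?_, ?_, ?_, ?_⟩ <;> by_contra hl
  · exact h.not_choosable_long_side hc hv hxy hx hl hch
  · exact h.swap₃.not_choosable_long_side hc hv hxy.symm (hxy ▸ hx) hl hch
  · exact h.swap₁.not_choosable_long_side hc hv.symm hxy (hv ▸ hx) hl hch
  · exact h.swap₁.swap₃.not_choosable_long_side hc hv.symm hxy.symm (hv ▸ hxy ▸ hx) hl hch
  · rw [not_or] at hl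
    exact h.not_choosable_long_diagonals hc hv hxy hx hl.1 hl.2 hch

/-- In a choosable graph, a subdivided `K₄` has a four-cycle that is not subdivided, and one of the
two other edges is subdivided once. -/
theorem K4Layout.classify (h : K4Layout G u v x y l₁ l₂ l₃ l₄ l₅ l₆) {c : V → Bool}
    (hc : IsBicoloring G c) (hch : Choosable G 4 2) :
    (l₂ = [] ∧ l₃ = [] ∧ l₄ = [] ∧ l₅ = [] ∧ (l₁.length = 1 ∨ l₆.length = 1)) ∨
    (l₁ = [] ∧ l₃ = [] ∧ l₄ = [] ∧ l₆ = [] ∧ (l₂.length = 1 ∨ l₅.length = 1)) ∨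
    (l₁ = [] ∧ l₂ = [] ∧ l₅ = [] ∧ l₆ = [] ∧ (l₃.length = 1 ∨ l₄.length = 1)) := by
  have hB : ∀ {a b d : Bool}, a ≠ b → a ≠ d → b = d := by decide
  -- The bipartition splits the four branch vertices as 4+0, 3+1 or 2+2. The first two are
  -- impossible, and each of the three 2+2 splits singles out the four-cycle of links between its
  -- classes.
  by_cases hv : c u = c v <;> by_cases hx : c u = c x <;> by_cases hy : c u = c y
  · exact absurd hch (h.not_choosable_even hc hv hx hy)
  · exact absurd hch (h.swap₃.swap₂.swap₁.not_choosable_star hc (Ne.symm hy) (hv ▸ Ne.symm hy)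
      (hx ▸ Ne.symm hy) hv hx)
  · exact absurd hch (h.swap₂.swap₁.not_choosable_star hc (Ne.symm hx) (hv ▸ Ne.symm hx)
      (hy ▸ Ne.symm hx) hv hy)
  · exact Or.inl (h.links_eq_nil hc hch hv (hB hx hy) hx)
  · exact absurd hch (h.swap₁.not_choosable_star hc (Ne.symm hv) (hx ▸ Ne.symm hv)
      (hy ▸ Ne.symm hv) hx hy)
  · obtain ⟨h1, h2, h3, h4, h5⟩ := h.swap₂.links_eq_nil hc hch hx (hB hv hy) hv
    exact Or.inr (Or.inl ⟨h1, h2, by simpa using h3, h4, h5⟩)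
  · obtain ⟨h1, h2, h3, h4, h5⟩ := h.swap₃.swap₂.links_eq_nil hc hch hy (hB hv hx) hv
    exact Or.inr (Or.inr ⟨h1, h2, by simpa using h3, by simpa using h4, h5⟩)
  · exact absurd hch (h.not_choosable_star hc hv hx hy (hB hv hx) (hB hv hy))

/-- This is a triangle of links with two sides doubled. Of two parallel links of odd length one may
be a single edge, so the one known to be longer is first moved to the second, respectively fourth,
place; then the parities of the two double sides are distinguished. -/
theorem not_choosable_two_double_links {c : V → Bool} (hc : IsBicoloring G c)
    (h₁ : Link G u l₁ v) (h₂ : Link G u l₂ v) (h₃ : Link G u l₃ x) (h₄ : Link G u l₄ x)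
    (h₅ : Link G v l₅ x) (hnd : (u :: v :: x :: (l₁ ++ l₂ ++ l₃ ++ l₄ ++ l₅)).Nodup)
    (hne : l₁ ≠ [] ∨ l₂ ≠ []) (hne' : l₃ ≠ [] ∨ l₄ ≠ []) : ¬ Choosable G 4 2 := by
  classical
  wlog hne₂ : l₂ ≠ [] generalizing l₁ l₂
  · exact this h₂ h₁ (nodup_of_count hnd fun a => by simp [List.count_cons]; omega) hne.symm
      (hne.resolve_right hne₂)
  wlog hne₄ : l₄ ≠ [] generalizing l₃ l₄
  · exact this h₄ h₃ hne'.symm (nodup_of_count hnd fun a => by simp [List.count_cons]; omega)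
      (hne'.resolve_right hne₄)
  -- Mixed parities: the first double link is odd, the second even. The opposite case follows by
  -- interchanging them.
  have key : ∀ {v x : V} {l₁ l₂ l₃ l₄ l₅ : List V}, Link G u l₁ v → Link G u l₂ v → Link G u l₃ x →
      Link G u l₄ x → Link G v l₅ x → (u :: v :: x :: (l₁ ++ l₂ ++ l₃ ++ l₄ ++ l₅)).Nodup →
      l₂ ≠ [] → c u ≠ c v → c u = c x → ¬ Choosable G 4 2 := by
    intro v x l₁ l₂ l₃ l₄ l₅ h₁ h₂ h₃ h₄ h₅ hnd hne hv hx
    exact (gad_of_search (ws := [v, x]) (B := 15) (ms := [27, 57]) (ls := [l₁, l₂, l₃, l₄, l₅])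
      (qs := []) (gs := [])
      (E := [(0, 1, []), (0, 1, [45, 58]), (0, 2, [60]), (0, 2, [43]), (1, 2, [])]) (P := [])
      (.cons (h₁.long_zero hc hv) (.cons (h₂.long_two hc hv hne) (.cons (h₃.long_one hc hx)
        (.cons (h₄.long_one hc hx) (.cons (h₅.long_zero hc (hx ▸ hv.symm)) .nil))))) .nil rfl
      (by decide +kernel) (by decide +kernel)).not_choosable (by decide) (by simpa using hnd)
  by_cases hv : c u = c v <;> by_cases hx : c u = c x
  · exact (gad_of_search (ws := [v, x]) (B := 15) (ms := [58, 53]) (ls := [l₁, l₂, l₃, l₄, l₅])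
      (qs := []) (gs := [])
      (E := [(0, 1, [60]), (0, 1, [27]), (0, 2, [30]), (0, 2, [57]), (1, 2, [39])]) (P := [])
      (.cons (h₁.long_one hc hv) (.cons (h₂.long_one hc hv) (.cons (h₃.long_one hc hx)
        (.cons (h₄.long_one hc hx) (.cons (h₅.long_one hc (hv ▸ hx)) .nil))))) .nil rfl
      (by decide +kernel) (by decide +kernel)).not_choosable (by decide) (by simpa using hnd)
  · exact key h₃ h₄ h₁ h₂ h₅.symm (nodup_of_count hnd fun a => by simp [List.count_cons]; omega)
      hne₄ hx hv
  · exact key h₁ h₂ h₃ h₄ h₅ hnd hne₂ hv hx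
  · have hvx : c v = c x := by revert hv hx; cases c u <;> cases c v <;> cases c x <;> simp
    exact (gad_of_search (ws := [v, x]) (B := 29) (ms := [15, 27]) (ls := [l₁, l₂, l₃, l₄, l₅])
      (qs := []) (gs := [])
      (E := [(0, 1, []), (0, 1, [60, 39]), (0, 2, []), (0, 2, [53, 43]), (1, 2, [30])]) (P := [])
      (.cons (h₁.long_zero hc hv) (.cons (h₂.long_two hc hv hne₂) (.cons (h₃.long_zero hc hx)
        (.cons (h₄.long_two hc hx hne₄) (.cons (h₅.long_one hc hvx) .nil))))) .nil rfl
      (by decide +kernel) (by decide +kernel)).not_choosable (by decide) (by simpa using hnd)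

/-- Contracting `l₅` would give the layout with two double links at one vertex. The parities between
`u` and `v`, `x` and `y`, `u` and `x` give eight cases; the four with just one odd double link agree
up to symmetry and are reduced to `key`. -/
theorem not_choosable_two_disjoint_double_links {c : V → Bool} (hc : IsBicoloring G c)
    (h₁ : Link G u l₁ v) (h₂ : Link G u l₂ v) (h₃ : Link G x l₃ y) (h₄ : Link G x l₄ y)
    (h₅ : Link G u l₅ x) (h₆ : Link G v l₆ y)
    (hnd : (u :: v :: x :: y :: (l₁ ++ l₂ ++ l₃ ++ l₄ ++ l₅ ++ l₆)).Nodup)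
    (hne : l₁ ≠ [] ∨ l₂ ≠ []) (hne' : l₃ ≠ [] ∨ l₄ ≠ []) : ¬ Choosable G 4 2 := by
  classical
  wlog hne₂ : l₂ ≠ [] generalizing l₁ l₂
  · exact this h₂ h₁ (nodup_of_count hnd fun a => by simp [List.count_cons]; omega) hne.symm
      (hne.resolve_right hne₂)
  wlog hne₄ : l₄ ≠ [] generalizing l₃ l₄
  · exact this h₄ h₃ hne'.symm (nodup_of_count hnd fun a => by simp [List.count_cons]; omega)
      (hne'.resolve_right hne₄)
  have key : ∀ {u v x y : V} {l₁ l₂ l₃ l₄ l₅ l₆ : List V}, Link G u l₁ v → Link G u l₂ v →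
      Link G x l₃ y → Link G x l₄ y → Link G u l₅ x → Link G v l₆ y →
      (u :: v :: x :: y :: (l₁ ++ l₂ ++ l₃ ++ l₄ ++ l₅ ++ l₆)).Nodup →
      l₂ ≠ [] → c u ≠ c v → c x = c y → c u = c x → ¬ Choosable G 4 2 := by
    intro u v x y l₁ l₂ l₃ l₄ l₅ l₆ h₁ h₂ h₃ h₄ h₅ h₆ hnd hne hv hxy hux
    exact (gad_of_search (ws := [v, x, y]) (B := 15) (ms := [27, 15, 57])
      (ls := [l₁, l₂, l₃, l₄, l₅, l₆]) (qs := []) (gs := [])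
      (E := [(0, 1, []), (0, 1, [45, 58]), (2, 3, [60]), (2, 3, [43]), (0, 2, [15]), (1, 3, [])])
      (P := []) (.cons (h₁.long_zero hc hv) (.cons (h₂.long_two hc hv hne)
        (.cons (h₃.long_one hc hxy) (.cons (h₄.long_one hc hxy) (.cons (h₅.long_one hc hux)
        (.cons (h₆.long_zero hc (hxy ▸ hux ▸ hv.symm)) .nil)))))) .nil rfl
      (by decide +kernel) (by decide +kernel)).not_choosable (by decide) (by simpa using hnd)
  have hB : ∀ {a b d : Bool}, a ≠ b → a ≠ d → b = d := by decide
  by_cases hv : c u = c v <;> by_cases hxy : c x = c y <;> by_cases hux : c u = c x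
  · exact (gad_of_search (ws := [v, x, y]) (B := 15) (ms := [58, 15, 53])
      (ls := [l₁, l₂, l₃, l₄, l₅, l₆]) (qs := []) (gs := [])
      (E := [(0, 1, [60]), (0, 1, [27]), (2, 3, [30]), (2, 3, [57]), (0, 2, [15]), (1, 3, [39])])
      (P := []) (.cons (h₁.long_one hc hv) (.cons (h₂.long_one hc hv) (.cons (h₃.long_one hc hxy)
        (.cons (h₄.long_one hc hxy) (.cons (h₅.long_one hc hux)
        (.cons (h₆.long_one hc (hv ▸ hux.trans hxy)) .nil)))))) .nil rfl
      (by decide +kernel) (by decide +kernel)).not_choosable (by decide) (by simpa using hnd)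
  · exact (gad_of_search (ws := [v, x, y]) (B := 29) (ms := [23, 29, 23])
      (ls := [l₁, l₂, l₃, l₄, l₅, l₆]) (qs := []) (gs := [])
      (E := [(0, 1, [15]), (0, 1, [30]), (2, 3, [15]), (2, 3, [30]), (0, 2, []), (1, 3, [])])
      (P := []) (.cons (h₁.long_one hc hv) (.cons (h₂.long_one hc hv) (.cons (h₃.long_one hc hxy)
        (.cons (h₄.long_one hc hxy) (.cons (h₅.long_zero hc hux)
        (.cons (h₆.long_zero hc (hv ▸ hxy ▸ hux)) .nil)))))) .nil rfl
      (by decide +kernel) (by decide +kernel)).not_choosable (by decide) (by simpa using hnd)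
  · exact key h₃ h₄ h₁ h₂ h₅.symm h₆.symm
      (nodup_of_count hnd fun a => by simp [List.count_cons]; omega) hne₄ hxy hv hux.symm
  · exact key h₃.symm h₄.symm h₁.symm h₂.symm h₆.symm h₅.symm
      (nodup_of_count hnd fun a => by simp [List.count_cons]; omega) (by simpa using hne₄)
      (Ne.symm hxy) hv.symm (hv ▸ (hB (Ne.symm hux) hxy).symm)
  · exact key h₁ h₂ h₃ h₄ h₅ h₆ hnd hne₂ hv hxy hux
  · exact key h₁.symm h₂.symm h₃.symm h₄.symm h₆ h₅
      (nodup_of_count hnd fun a => by simp [List.count_cons]; omega) (by simpa using hne₂)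
      (Ne.symm hv) hxy.symm (hxy ▸ hB hv hux)
  · have hvy : c v = c y := hB hv (hux ▸ hxy)
    exact (gad_of_search (ws := [v, x, y]) (B := 29) (ms := [15, 29, 27])
      (ls := [l₁, l₂, l₃, l₄, l₅, l₆]) (qs := []) (gs := [])
      (E := [(0, 1, []), (0, 1, [60, 39]), (2, 3, []), (2, 3, [53, 43]), (0, 2, [29]),
        (1, 3, [30])])
      (P := []) (.cons (h₁.long_zero hc hv) (.cons (h₂.long_two hc hv hne₂)
        (.cons (h₃.long_zero hc hxy) (.cons (h₄.long_two hc hxy hne₄) (.cons (h₅.long_one hc hux)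
        (.cons (h₆.long_one hc hvy) .nil)))))) .nil rfl
      (by decide +kernel) (by decide +kernel)).not_choosable (by decide) (by simpa using hnd)
  · have hvy : c v ≠ c y := fun h => hux (hB (Ne.symm hv) (h ▸ Ne.symm hxy))
    exact (gad_of_search (ws := [v, x, y]) (B := 23) (ms := [30, 23, 15])
      (ls := [l₁, l₂, l₃, l₄, l₅, l₆]) (qs := []) (gs := [])
      (E := [(0, 1, []), (0, 1, [39, 58]), (2, 3, []), (2, 3, [54, 43]), (0, 2, []), (1, 3, [])])
      (P := []) (.cons (h₁.long_zero hc hv) (.cons (h₂.long_two hc hv hne₂)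
        (.cons (h₃.long_zero hc hxy) (.cons (h₄.long_two hc hxy hne₄) (.cons (h₅.long_zero hc hux)
        (.cons (h₆.long_zero hc hvy) .nil)))))) .nil rfl
      (by decide +kernel) (by decide +kernel)).not_choosable (by decide) (by simpa using hnd)

end NotChoosable

/-! ### Theta graphs and cycles in choosable graphs -/

/-- Three internally disjoint paths from `u` to `v`, with interiors `l₁`, `l₂`, `l₃`. -/
structure Theta (G : SimpleGraph V) (u v : V) (l₁ l₂ l₃ : List V) : Prop where
  h₁ : Link G u l₁ v
  h₂ : Link G u l₂ v
  h₃ : Link G u l₃ v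
  nd : (u :: v :: (l₁ ++ l₂ ++ l₃)).Nodup
  ne₁₂ : l₁ ≠ [] ∨ l₂ ≠ []
  ne₁₃ : l₁ ≠ [] ∨ l₃ ≠ []
  ne₂₃ : l₂ ≠ [] ∨ l₃ ≠ []

section Theta

variable {u v x y : V} {l₁ l₂ l₃ l : List V} {c : V → Bool}

theorem Theta.rotate (h : Theta G u v l₁ l₂ l₃) : Theta G u v l₂ l₃ l₁ := by
  classical
  exact ⟨h.h₂, h.h₃, h.h₁, nodup_of_count h.nd fun a => by simp [List.count_cons] <;> omega,
    h.ne₂₃, h.ne₁₂.symm, h.ne₁₃.symm⟩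

theorem Theta.swap (h : Theta G u v l₁ l₂ l₃) : Theta G u v l₂ l₁ l₃ := by
  classical
  exact ⟨h.h₂, h.h₁, h.h₃, nodup_of_count h.nd fun a => by simp [List.count_cons] <;> omega,
    h.ne₁₂.symm, h.ne₂₃, h.ne₁₃⟩

theorem Theta.flip (h : Theta G u v l₁ l₂ l₃) :
    Theta G v u l₁.reverse l₂.reverse l₃.reverse := by
  classical
  exact ⟨h.h₁.symm, h.h₂.symm, h.h₃.symm,
    nodup_of_count h.nd fun a => by simp [List.count_cons] <;> omega, by simpa using h.ne₁₂,
    by simpa using h.ne₁₃, by simpa using h.ne₂₃⟩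

theorem Theta.exists_length_eq_one (h : Theta G u v l₁ l₂ l₃) (hc : IsBicoloring G c)
    (hch : Choosable G 4 2) (hu : c u = c v) :
    l₁.length = 1 ∨ l₂.length = 1 ∨ l₃.length = 1 := by
  by_contra! hl
  exact not_choosable_theta_even (h.h₁.long_three hc hu hl.1) (h.h₂.long_three hc hu hl.2.1)
    (h.h₃.long_three hc hu hl.2.2) h.nd hch

theorem Theta.exists_eq_nil (h : Theta G u v l₁ l₂ l₃) (hc : IsBicoloring G c)
    (hch : Choosable G 4 2) (hu : c u ≠ c v) : l₁ = [] ∨ l₂ = [] ∨ l₃ = [] := by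
  by_contra! hl
  exact not_choosable_theta_odd (h.h₁.long_two hc hu hl.1) (h.h₂.long_two hc hu hl.2.1)
    (h.h₃.long_two hc hu hl.2.2) h.nd hch

/-- A fourth path between the ends of a theta graph. -/
theorem Theta.length_of_fourth_link (h : Theta G u v l₁ l₂ l₃) (hc : IsBicoloring G c)
    (hch : Choosable G 4 2) (hl : Link G u l v) (hnd : (u :: v :: (l₁ ++ l₂ ++ l₃ ++ l)).Nodup)
    (hne : l = [] → l₁ ≠ [] ∧ l₂ ≠ [] ∧ l₃ ≠ []) :
    c u = c v ∧ l₁.length = 1 ∧ l₂.length = 1 ∧ l₃.length = 1 ∧ l.length = 1 := by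
  classical
  by_cases hu : c u = c v
  · refine ⟨hu, ?_, ?_, ?_, ?_⟩ <;> by_contra h'
    · exact not_choosable_four_links (h.h₂.long_one hc hu) (h.h₃.long_one hc hu)
        (hl.long_one hc hu) (h.h₁.long_three hc hu h')
        (nodup_of_count hnd fun a => by simp [List.count_cons] <;> omega) hch
    · exact not_choosable_four_links (h.h₁.long_one hc hu) (h.h₃.long_one hc hu)
        (hl.long_one hc hu) (h.h₂.long_three hc hu h')
        (nodup_of_count hnd fun a => by simp [List.count_cons] <;> omega) hch
    · exact not_choosable_four_links (h.h₁.long_one hc hu) (h.h₂.long_one hc hu)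
        (hl.long_one hc hu) (h.h₃.long_three hc hu h')
        (nodup_of_count hnd fun a => by simp [List.count_cons] <;> omega) hch
    · exact not_choosable_four_links (h.h₁.long_one hc hu) (h.h₂.long_one hc hu)
        (h.h₃.long_one hc hu) (hl.long_three hc hu h') hnd hch
  · exfalso
    -- Between ends of different colours, three links longer than an edge already form an excluded
    -- theta graph, and at most one of the four links is an edge.
    have key : ∀ {m₁ m₂ m₃ : List V}, Link G u m₁ v → Link G u m₂ v → Link G u m₃ v →
        (u :: v :: (m₁ ++ m₂ ++ m₃)).Nodup → m₁ ≠ [] → m₂ ≠ [] → m₃ ≠ [] → False :=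
      fun h₁ h₂ h₃ hnd n₁ n₂ n₃ => not_choosable_theta_odd (h₁.long_two hc hu n₁)
        (h₂.long_two hc hu n₂) (h₃.long_two hc hu n₃) hnd hch
    by_cases hl0 : l = []
    · exact key h.h₁ h.h₂ h.h₃ h.nd (hne hl0).1 (hne hl0).2.1 (hne hl0).2.2
    · rcases h.exists_eq_nil hc hch hu with h0 | h0 | h0
      · exact key h.h₂ h.h₃ hl (nodup_of_count hnd fun a => by simp [List.count_cons] <;> omega)
          (h.ne₁₂.resolve_left (by simpa using h0)) (h.ne₁₃.resolve_left (by simpa using h0)) hl0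
      · exact key h.h₁ h.h₃ hl (nodup_of_count hnd fun a => by simp [List.count_cons] <;> omega)
          (h.ne₁₂.resolve_right (by simpa using h0)) (h.ne₂₃.resolve_left (by simpa using h0)) hl0
      · exact key h.h₁ h.h₂ hl (nodup_of_count hnd fun a => by simp [List.count_cons] <;> omega)
          (h.ne₁₃.resolve_right (by simpa using h0)) (h.ne₂₃.resolve_right (by simpa using h0)) hl0

/-- The ear doubles the segment from `u` to `x`, while `l₂` and `l₃` doubly link `u` to `v`; the
segment `t` closes the triangle. -/
theorem Theta.not_choosable_of_ear_end {s t : List V} (h : Theta G u v (s ++ x :: t) l₂ l₃)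
    (hc : IsBicoloring G c) (hl : Link G u l x)
    (hnd : (u :: v :: ((s ++ x :: t) ++ l₂ ++ l₃ ++ l)).Nodup) (hne : l = [] → s ≠ []) :
    ¬ Choosable G 4 2 := by
  classical
  have h₁ := link_append.1 h.h₁
  exact not_choosable_two_double_links hc h₁.1 hl h.h₂ h.h₃ h₁.2
    (nodup_of_count hnd fun a => by simp [List.count_cons] <;> omega) (by tauto) h.ne₂₃

/-- The ear and `m` form one double link, `l₂` and `l₃` another; `s` and `t` join the two. -/
theorem Theta.not_choosable_of_ear_same {s m t : List V}
    (h : Theta G u v (s ++ x :: (m ++ y :: t)) l₂ l₃) (hc : IsBicoloring G c) (hl : Link G x l y)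
    (hnd : (u :: v :: ((s ++ x :: (m ++ y :: t)) ++ l₂ ++ l₃ ++ l)).Nodup)
    (hne : l = [] → m ≠ []) : ¬ Choosable G 4 2 := by
  classical
  have h₁ := link_append.1 h.h₁
  have h₁' := link_append.1 h₁.2
  exact not_choosable_two_disjoint_double_links hc h₁'.1 hl h.h₂ h.h₃ h₁.1.symm h₁'.2
    (nodup_of_count hnd fun a => by simp [List.count_cons] <;> omega) (by tauto) h.ne₂₃

theorem Theta.K4Layout_of_ear {s t s' t' : List V} (h : Theta G u v (s ++ x :: t) (s' ++ y :: t') l₃)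
    (hl : Link G x l y) (hnd : (u :: v :: ((s ++ x :: t) ++ (s' ++ y :: t') ++ l₃ ++ l)).Nodup) :
    K4Layout G u v x y l₃ s s' t.reverse t'.reverse l := by
  classical
  have h₁ := link_append.1 h.h₁
  have h₂ := link_append.1 h.h₂
  exact ⟨h.h₃, h₁.1, h₂.1, h₁.2.symm, h₂.2.symm, hl,
    nodup_of_count hnd fun a => by simp [List.count_cons] <;> omega⟩

/-! ### Gadgets in theta graphs and cycles -/

/-- If the ends have equal colours, a single path longer than 2 gives the stronger gadget. If not,
at most one path is an edge, and the other two have room for two prescribed lists each, which is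
also enough. Only K_{2,3} is left over. -/
theorem Theta.gad_end (h : Theta G u v l₁ l₂ l₃) (hc : IsBicoloring G c) :
    Gad4 G u (v :: (l₁ ++ l₂ ++ l₃)) ∨ (l₁.length = 1 ∧ l₂.length = 1 ∧ l₃.length = 1) ∧
      Gad3 G u (v :: (l₁ ++ l₂ ++ l₃)) := by
  classical
  have nd := (List.nodup_cons.1 h.nd).2
  by_cases hu : c u = c v
  · have key : ∀ {l₁ l₂ l₃ : List V}, Link G u l₁ v → Link G u l₂ v → Link G u l₃ v →
        l₃.length ≠ 1 → Gad4 G u ([v] ++ ([l₁, l₂, l₃] ++ []).flatten) :=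
      fun h₁ h₂ h₃ hl => gad_of_search (ms := [23]) (gs := [])
        (E := [(0, 1, [29]), (0, 1, [15]), (0, 1, [23, 29, 30])])
        (.cons (h₁.long_one hc hu) (.cons (h₂.long_one hc hu)
          (.cons (h₃.long_three hc hu hl) .nil))) .nil rfl (by decide +kernel) (by decide +kernel)
    by_cases hl₃ : l₃.length = 1
    · by_cases hl₂ : l₂.length = 1
      · by_cases hl₁ : l₁.length = 1
        · refine Or.inr ⟨⟨hl₁, hl₂, hl₃⟩, ?_⟩
          have : Gad3 G u ([v] ++ ([l₁, l₂, l₃] ++ []).flatten) :=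
            gad_of_search (ms := [57]) (gs := []) (E := [(0, 1, [60]), (0, 1, [51]), (0, 1, [15])])
              (.cons (h.h₁.long_one hc hu) (.cons (h.h₂.long_one hc hu)
                (.cons (h.h₃.long_one hc hu) .nil))) .nil rfl (by decide +kernel)
              (by decide +kernel)
          simpa using this
        · exact Or.inl ((key h.h₂ h.h₃ h.h₁ hl₁).subset
            (nodup_of_count nd fun a => by simp [List.count_cons] <;> omega)
            (by intro a; simp; tauto))
      · exact Or.inl ((key h.h₁ h.h₃ h.h₂ hl₂).subset
          (nodup_of_count nd fun a => by simp [List.count_cons] <;> omega)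
          (by intro a; simp; tauto))
    · exact Or.inl ((key h.h₁ h.h₂ h.h₃ hl₃).subset
          (nodup_of_count nd fun a => by simp [List.count_cons] <;> omega)
          (by intro a; simp))
  · have key : ∀ {l₁ l₂ l₃ : List V}, Link G u l₁ v → Link G u l₂ v → Link G u l₃ v →
        l₂ ≠ [] → l₃ ≠ [] → Gad4 G u ([v] ++ ([l₁, l₂, l₃] ++ []).flatten) :=
      fun h₁ h₂ h₃ hl₂ hl₃ => gad_of_search (ms := [15]) (gs := [])
        (E := [(0, 1, []), (0, 1, [30, 29]), (0, 1, [29, 23])])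
        (.cons (h₁.long_zero hc hu) (.cons (h₂.long_two hc hu hl₂)
          (.cons (h₃.long_two hc hu hl₃) .nil))) .nil rfl (by decide +kernel) (by decide +kernel)
    left
    by_cases hl₃ : l₃ = []
    · exact (key h.h₃ h.h₁ h.h₂ (h.ne₁₃.resolve_right (by simpa using hl₃))
        (h.ne₂₃.resolve_right (by simpa using hl₃))).subset
          (nodup_of_count nd fun a => by simp [List.count_cons] <;> omega)
          (by intro a; simp; tauto)
    · by_cases hl₂ : l₂ = []
      · exact (key h.h₂ h.h₁ h.h₃ (h.ne₁₂.resolve_right (by simpa using hl₂)) hl₃).subset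
          (nodup_of_count nd fun a => by simp [List.count_cons] <;> omega)
          (by intro a; simp; tauto)
      · exact (key h.h₁ h.h₂ h.h₃ hl₂ hl₃).subset
          (nodup_of_count nd fun a => by simp [List.count_cons] <;> omega)
          (by intro a; simp)

/-- The root cuts its path into `s` and `t`. Only when `u` and `v` are on one side of the
bipartition, `x` is on the other, and all lengths are minimal does the search fall short of two
intersecting pairs; this is K_{2,3}. -/
theorem Theta.gad_inner {s t : List V} (h : Theta G u v (s ++ x :: t) l₂ l₃)
    (hc : IsBicoloring G c) : Gad4 G x (u :: v :: (s ++ t ++ l₂ ++ l₃)) ∨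
      ((s ++ x :: t).length = 1 ∧ l₂.length = 1 ∧ l₃.length = 1) ∧
        Gad3 G x (u :: v :: (s ++ t ++ l₂ ++ l₃)) := by
  classical
  have nd : (u :: v :: (s ++ t ++ l₂ ++ l₃)).Nodup :=
    nodup_of_count h.nd fun a => by simp [List.count_cons] <;> omega
  obtain ⟨hs, ht⟩ := link_append.1 h.h₁
  have hs := hs.symm
  by_cases hu : c u = c v
  · by_cases hx : c x = c u
    · left
      have : Gad4 G x ([u, v] ++ ([s.reverse, t, l₂, l₃] ++ []).flatten) :=
        gad_of_search (ms := [57, 39]) (gs := [])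
          (E := [(0, 1, [46]), (0, 2, [45]), (1, 2, [23]), (1, 2, [43])])
          (.cons (hs.long_one hc hx) (.cons (ht.long_one hc (hx.trans hu))
            (.cons (h.h₂.long_one hc hu) (.cons (h.h₃.long_one hc hu) .nil)))) .nil rfl
          (by decide +kernel) (by decide +kernel)
      exact this.subset (nodup_of_count nd fun a => by simp [List.count_cons] <;> omega)
        (by intro a; simp)
    · have hx' : c x ≠ c v := hu ▸ hx
      by_cases ht0 : t = []
      · by_cases hs0 : s = []
        · subst ht0 hs0
          have key : ∀ {l₂ l₃ : List V}, Link G u l₂ v → Link G u l₃ v → l₃.length ≠ 1 →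
              Gad4 G x ([u, v] ++ ([[], [], l₂, l₃] ++ []).flatten) :=
            fun h₂ h₃ hl => gad_of_search (ms := [30, 15]) (gs := [])
              (E := [(0, 1, []), (0, 2, []), (1, 2, [29]), (1, 2, [30, 29, 23])])
              (.cons (hs.long_zero hc hx) (.cons (ht.long_zero hc hx') (.cons (h₂.long_one hc hu)
                (.cons (h₃.long_three hc hu hl) .nil)))) .nil rfl (by decide +kernel)
              (by decide +kernel)
          by_cases hl₃ : l₃.length = 1
          · by_cases hl₂ : l₂.length = 1
            · refine Or.inr ⟨⟨by simp, hl₂, hl₃⟩, ?_⟩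
              have : Gad3 G x ([u, v] ++ ([[], [], l₂, l₃] ++ []).flatten) :=
                gad_of_search (ms := [23, 46]) (gs := [])
                  (E := [(0, 1, []), (0, 2, []), (1, 2, [60]), (1, 2, [51])])
                  (.cons (hs.long_zero hc hx) (.cons (ht.long_zero hc hx')
                    (.cons (h.h₂.long_one hc hu) (.cons (h.h₃.long_one hc hu) .nil)))) .nil rfl
                  (by decide +kernel) (by decide +kernel)
              simpa using this
            · exact Or.inl ((key h.h₃ h.h₂ hl₂).subset
                (nodup_of_count nd fun a => by simp [List.count_cons] <;> omega)
                (by intro a; simp; tauto))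
          · exact Or.inl ((key h.h₂ h.h₃ hl₃).subset
                (nodup_of_count nd fun a => by simp [List.count_cons])
                (by intro a; simp))
        · left
          have : Gad4 G x ([v, u] ++ ([t, s.reverse, l₂.reverse, l₃.reverse] ++ []).flatten) :=
            gad_of_search (ms := [30, 15]) (gs := [])
              (E := [(0, 1, []), (0, 2, [29, 23]), (1, 2, [29]), (1, 2, [30])])
              (.cons (ht.long_zero hc hx') (.cons (hs.long_two hc hx (by simpa using hs0))
                (.cons (h.h₂.symm.long_one hc hu.symm)
                (.cons (h.h₃.symm.long_one hc hu.symm) .nil)))) .nil rfl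
              (by decide +kernel) (by decide +kernel)
          exact this.subset (nodup_of_count nd fun a => by simp [List.count_cons] <;> omega)
            (by intro a; simp; tauto)
      · left
        have : Gad4 G x ([u, v] ++ ([s.reverse, t, l₂, l₃] ++ []).flatten) :=
          gad_of_search (ms := [30, 15]) (gs := [])
            (E := [(0, 1, []), (0, 2, [29, 23]), (1, 2, [29]), (1, 2, [30])])
            (.cons (hs.long_zero hc hx) (.cons (ht.long_two hc hx' ht0)
              (.cons (h.h₂.long_one hc hu) (.cons (h.h₃.long_one hc hu) .nil)))) .nil rfl
            (by decide +kernel) (by decide +kernel)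
        exact this.subset (nodup_of_count nd fun a => by simp [List.count_cons] <;> omega)
          (by intro a; simp)
  · left
    have key : ∀ {u v : V} {s t l₂ l₃ : List V}, Link G x s u → Link G x t v → Link G u l₂ v →
        Link G u l₃ v → l₃ ≠ [] → c u ≠ c v → c x = c v →
        Gad4 G x ([u, v] ++ ([s, t, l₂, l₃] ++ []).flatten) :=
      fun hs ht h₂ h₃ hl hu hx => gad_of_search (ms := [15, 39]) (gs := [])
        (E := [(0, 1, []), (0, 2, [43]), (1, 2, []), (1, 2, [27, 54])])
        (.cons (hs.long_zero hc (hx ▸ hu.symm)) (.cons (ht.long_one hc hx)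
          (.cons (h₂.long_zero hc hu) (.cons (h₃.long_two hc hu hl) .nil)))) .nil rfl
        (by decide +kernel) (by decide +kernel)
    by_cases hx : c x = c v
    · by_cases hl : l₃ = []
      · exact (key hs ht h.h₃ h.h₂ (h.ne₂₃.resolve_right (by simpa using hl)) hu hx).subset
          (nodup_of_count nd fun a => by simp [List.count_cons] <;> omega)
          (by intro a; simp; tauto)
      · exact (key hs ht h.h₂ h.h₃ hl hu hx).subset
          (nodup_of_count nd fun a => by simp [List.count_cons] <;> omega)
          (by intro a; simp)
    · have hx' : c x = c u := by
        revert hx hu; cases c x <;> cases c u <;> cases c v <;> simp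
      by_cases hl : l₃ = []
      · exact (key ht hs h.h₃.symm h.h₂.symm (by simpa using h.ne₂₃.resolve_right (by simpa using hl))
          (Ne.symm hu) hx').subset (nodup_of_count nd fun a => by simp [List.count_cons] <;> omega)
          (by intro a; simp; tauto)
      · exact (key ht hs h.h₂.symm h.h₃.symm (by simpa using hl) (Ne.symm hu) hx').subset
          (nodup_of_count nd fun a => by simp [List.count_cons] <;> omega)
          (by intro a; simp; tauto)

/-- A theta graph is a gadget, whichever vertex is the root. -/
theorem Theta.gad (h : Theta G u v l₁ l₂ l₃) (hc : IsBicoloring G c)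
    (hx : x ∈ u :: v :: (l₁ ++ l₂ ++ l₃)) :
    ∃ l, (x :: l).Perm (u :: v :: (l₁ ++ l₂ ++ l₃)) ∧ (Gad4 G x l ∨
      (l₁.length = 1 ∧ l₂.length = 1 ∧ l₃.length = 1) ∧ Gad3 G x l) := by
  classical
  simp only [List.mem_cons, List.mem_append] at hx
  rcases hx with rfl | rfl | (hx | hx) | hx
  · exact ⟨_, List.Perm.refl _, h.gad_end hc⟩
  · refine ⟨_, ?_, by simpa using h.flip.gad_end hc⟩
    refine List.perm_iff_count.2 fun a => ?_
    simp [List.count_cons]; omega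
  · obtain ⟨s, t, rfl⟩ := List.append_of_mem hx
    refine ⟨_, ?_, h.gad_inner hc⟩
    refine List.perm_iff_count.2 fun a => ?_
    simp [List.count_cons]; omega
  · obtain ⟨s, t, rfl⟩ := List.append_of_mem hx
    refine ⟨_, ?_, (h.swap.gad_inner hc).imp_right fun h => ⟨by tauto, h.2⟩⟩
    refine List.perm_iff_count.2 fun a => ?_
    simp [List.count_cons]; omega
  · obtain ⟨s, t, rfl⟩ := List.append_of_mem hx
    refine ⟨_, ?_, (h.rotate.rotate.gad_inner hc).imp_right fun h => ⟨by tauto, h.2⟩⟩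
    refine List.perm_iff_count.2 fun a => ?_
    simp [List.count_cons]; omega

/-- A cycle through `x` and `y`, with a further cycle hanging at `y`, rooted at `x`. -/
theorem gad_cycle_lolli {q : List V} (hc : IsBicoloring G c) (h₁ : Link G x l₁ y)
    (h₂ : Link G x l₂ y) (hne : l₁ ≠ [] ∨ l₂ ≠ []) (hq : Lolli G y q)
    (hnd : (x :: y :: (l₁ ++ l₂ ++ q)).Nodup) : Gad4 G x (y :: (l₁ ++ l₂ ++ q)) ∨
      (l₁.length = 1 ∧ l₂.length = 1) ∧ Gad3 G x (y :: (l₁ ++ l₂ ++ q)) := by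
  classical
  have nd := (List.nodup_cons.1 hnd).2
  by_cases hxy : c x = c y
  -- The lollipop leaves four of the six pairs at `y`, and the two links of the cycle pass this
  -- restriction on to `x`.
  · have key : ∀ {l₁ l₂ : List V}, Link G x l₁ y → Link G x l₂ y → l₂.length ≠ 1 →
        Gad4 G x ([y] ++ ([l₁, l₂] ++ [q]).flatten) :=
      fun h₁ h₂ hl => gad_of_search (ms := [23]) (gs := [(1, [3, 5, 6, 18])])
        (E := [(0, 1, [15]), (0, 1, [23, 29, 30])])
        (.cons (h₁.long_one hc hxy) (.cons (h₂.long_three hc hxy hl) .nil))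
        (.cons (hq.gad hc 23 15 29 23 29 15 (by decide) (by decide +kernel)) .nil) rfl
        (by decide +kernel) (by decide +kernel)
    by_cases hl₂ : l₂.length = 1
    · by_cases hl₁ : l₁.length = 1
      · refine Or.inr ⟨⟨hl₁, hl₂⟩, ?_⟩
        have : Gad3 G x ([y] ++ ([l₁, l₂] ++ [q]).flatten) :=
          gad_of_search (ms := [29]) (gs := [(1, [5, 17, 20, 24])])
            (E := [(0, 1, [23]), (0, 1, [29])])
            (.cons (h₁.long_one hc hxy) (.cons (h₂.long_one hc hxy) .nil))
            (.cons (hq.gad hc 29 23 15 29 15 23 (by decide) (by decide +kernel)) .nil) rfl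
            (by decide +kernel) (by decide +kernel)
        simpa using this
      · exact Or.inl ((key h₂ h₁ hl₁).subset
          (nodup_of_count nd fun a => by simp [List.count_cons] <;> omega)
          (by intro a; simp; tauto))
    · exact Or.inl ((key h₁ h₂ hl₂).subset
          (nodup_of_count nd fun a => by simp [List.count_cons] <;> omega)
          (by intro a; simp))
  · left
    have key : ∀ {l₁ l₂ : List V}, Link G x l₁ y → Link G x l₂ y → l₂ ≠ [] →
        Gad4 G x ([y] ++ ([l₁, l₂] ++ [q]).flatten) :=
      fun h₁ h₂ hl => gad_of_search (ms := [15]) (gs := [(1, [3, 6, 10, 12])])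
        (E := [(0, 1, []), (0, 1, [29, 23])])
        (.cons (h₁.long_zero hc hxy) (.cons (h₂.long_two hc hxy hl) .nil))
        (.cons (hq.gad hc 15 30 29 15 29 30 (by decide) (by decide +kernel)) .nil) rfl
        (by decide +kernel) (by decide +kernel)
    by_cases hl : l₂ = []
    · exact (key h₂ h₁ (hne.resolve_right (by simpa using hl))).subset
          (nodup_of_count nd fun a => by simp [List.count_cons] <;> omega)
          (by intro a; simp; tauto)
    · exact (key h₁ h₂ hl).subset
          (nodup_of_count nd fun a => by simp [List.count_cons] <;> omega)
          (by intro a; simp)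

/-- A lollipop can exclude two intersecting pairs, here just the pairs 3 and 5 that the gadget
leaves. -/
theorem not_choosable_of_gad4_lolli {q : List V} (hc : IsBicoloring G c) (h : Gad4 G x l)
    (hq : Lolli G x q) (hnd : (x :: (l ++ q)).Nodup) : ¬ Choosable G 4 2 :=
  (Gad.append h (hq.gad hc (B := 15) (P := [6, 9, 10, 12]) 15 30 23 15 23 30 (by decide)
    (by decide +kernel)) (by decide)).not_choosable (by decide) hnd

/-- Two cycles hanging at the same vertex. -/
theorem gad3_two_lollis {q q' : List V} (hc : IsBicoloring G c) (hq : Lolli G x q)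
    (hq' : Lolli G x q') : Gad3 G x (q ++ q') :=
  -- The first lollipop excludes 3 and 6, the second 9 and 12; the complementary pairs 5 and 10
  -- remain.
  ((hq.gad hc (B := 15) (P := [5, 9, 10, 12]) 15 29 23 15 23 29 (by decide)
    (by decide +kernel)).append (hq'.gad hc (B := 15) (P := [3, 5, 6, 10]) 15 23 29 15 29 23
    (by decide) (by decide +kernel)) (by decide))

/-- The six pairs split into three couples of intersecting pairs, namely 3 and 5, 6 and 10, 9 and
12, and each lollipop excludes one couple. -/
theorem not_choosable_of_three_lollis {q q' q'' : List V} (hc : IsBicoloring G c)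
    (hq : Lolli G x q) (hq' : Lolli G x q') (hq'' : Lolli G x q'')
    (hnd : (x :: (q ++ q' ++ q'')).Nodup) : ¬ Choosable G 4 2 :=
  (((hq.gad hc (B := 15) (P := [6, 9, 10, 12]) 15 30 23 15 23 30 (by decide)
    (by decide +kernel)).append (hq'.gad hc (B := 15) (P := [3, 5, 9, 12]) 15 29 30 15 30 29
    (by decide) (by decide +kernel)) (Q := [9, 12]) (by decide)).append
    (hq''.gad hc (B := 15) (P := [3, 5, 6, 10]) 15 23 29 15 29 23 (by decide)
    (by decide +kernel)) (by decide)).not_choosable (by decide) hnd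

/-- Two cycles hanging at different vertices of `K_{2,3}`. -/
theorem Theta.not_choosable_of_two_lollis {a b d : V} {q q' : List V} (h : Theta G u v [a] [b] [d])
    (hc : IsBicoloring G c) (hx : x ∈ [u, v, a, b, d]) (hy : y ∈ [u, v, a, b, d]) (hxy : x ≠ y)
    (hq : Lolli G x q) (hq' : Lolli G y q') (hnd : ([u, v, a, b, d] ++ (q ++ q')).Nodup) :
    ¬ Choosable G 4 2 := by
  classical
  -- Up to symmetry both roots have degree three in K_{2,3} (`hends`), one has degree two and one
  -- degree three (`hmid`), or both have degree two (`hmids`).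
  have hends : ∀ {u v a b d : V} {q q' : List V}, Theta G u v [a] [b] [d] → Lolli G u q →
      Lolli G v q' → ([u, v, a, b, d] ++ (q ++ q')).Nodup → ¬ Choosable G 4 2 := by
    intro u v a b d q q' h hq hq' hnd
    have hu := (h.h₁.parity hc).2 (by simp)
    exact (gad_of_search (r := u) (ws := [v]) (B := 15) (ms := [23]) (P := [])
      (E := [(0, 1, [29]), (0, 1, [27]), (0, 1, [15])])
      (gs := [(0, [5, 9, 10, 12]), (1, [6, 17, 18, 20])]) (.cons (h.h₁.long_one hc hu)
        (.cons (h.h₂.long_one hc hu) (.cons (h.h₃.long_one hc hu) .nil)))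
      (.cons (hq.gad hc 15 29 23 15 23 29 (by decide) (by decide +kernel))
        (.cons (hq'.gad hc 23 30 15 23 15 30 (by decide) (by decide +kernel)) .nil)) rfl
      (by decide +kernel) (by decide +kernel)).not_choosable (by decide) (by simpa using hnd)
  have hmid : ∀ {u v a b d : V} {q q' : List V}, Theta G u v [a] [b] [d] → Lolli G a q →
      Lolli G u q' → ([u, v, a, b, d] ++ (q ++ q')).Nodup → ¬ Choosable G 4 2 := by
    intro u v a b d q q' h hq hq' hnd
    have hu := (h.h₁.parity hc).2 (by simp)
    have h₁ := link_cons.1 h.h₁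
    exact (gad_of_search (r := a) (ws := [u, v]) (B := 15) (ms := [29, 15]) (P := [])
      (E := [(0, 1, []), (0, 2, []), (1, 2, [23]), (1, 2, [29])])
      (gs := [(0, [6, 9, 10, 12]), (1, [12, 17, 20, 24])])
      (.cons ⟨link_nil.2 h₁.1.symm, atLeast_nil⟩ (.cons ⟨h₁.2, atLeast_nil⟩
        (.cons (h.h₂.long_one hc hu) (.cons (h.h₃.long_one hc hu) .nil))))
      (.cons (hq.gad hc 15 30 23 15 23 30 (by decide) (by decide +kernel))
        (.cons (hq'.gad hc 29 30 15 29 15 30 (by decide) (by decide +kernel)) .nil)) rfl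
      (by decide +kernel) (by decide +kernel)).not_choosable (by decide)
      (nodup_of_count hnd fun a => by simp [List.count_cons] <;> omega)
  have hmids : ∀ {u v a b d : V} {q q' : List V}, Theta G u v [a] [b] [d] → Lolli G a q →
      Lolli G b q' → ([u, v, a, b, d] ++ (q ++ q')).Nodup → ¬ Choosable G 4 2 := by
    intro u v a b d q q' h hq hq' hnd
    have hu := (h.h₁.parity hc).2 (by simp)
    have h₁ := link_cons.1 h.h₁
    have h₂ := link_cons.1 h.h₂
    exact (gad_of_search (r := a) (ws := [u, v, b]) (B := 30) (ms := [29, 30, 27]) (P := [])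
      (E := [(0, 1, []), (0, 2, []), (3, 1, []), (3, 2, []), (1, 2, [23])])
      (gs := [(0, [6, 12, 20, 24]), (3, [9, 17, 18, 24])])
      (.cons ⟨link_nil.2 h₁.1.symm, atLeast_nil⟩ (.cons ⟨h₁.2, atLeast_nil⟩
        (.cons ⟨link_nil.2 h₂.1.symm, atLeast_nil⟩ (.cons ⟨h₂.2, atLeast_nil⟩
        (.cons (h.h₃.long_one hc hu) .nil)))))
      (.cons (hq.gad hc 30 29 27 30 27 29 (by decide) (by decide +kernel))
        (.cons (hq'.gad hc 27 29 15 27 15 29 (by decide) (by decide +kernel)) .nil)) rfl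
      (by decide +kernel) (by decide +kernel)).not_choosable (by decide)
      (nodup_of_count hnd fun a => by simp [List.count_cons] <;> omega)
  have hmid' : ∀ {u v a b d z : V} {q q' : List V}, Theta G u v [a] [b] [d] → z ∈ [u, v] →
      Lolli G a q → Lolli G z q' → ([u, v, a, b, d] ++ (q ++ q')).Nodup → ¬ Choosable G 4 2 := by
    intro u v a b d z q q' h hz hq hq' hnd
    simp only [List.mem_cons, List.not_mem_nil, or_false] at hz
    rcases hz with rfl | rfl
    · exact hmid h hq hq' hnd
    · exact hmid h.flip hq hq' (nodup_of_count hnd fun a => by simp [List.count_cons] <;> omega)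
  have hmid'' : ∀ {z w : V} {q q' : List V}, z ∈ [u, v] → w ∈ [a, b, d] →
      Lolli G w q → Lolli G z q' → ([u, v, a, b, d] ++ (q ++ q')).Nodup → ¬ Choosable G 4 2 := by
    intro z w q q' hz hw hq hq' hnd
    simp only [List.mem_cons, List.not_mem_nil, or_false] at hw
    rcases hw with rfl | rfl | rfl
    · exact hmid' h hz hq hq' hnd
    · exact hmid' h.swap hz hq hq' (nodup_of_count hnd fun a => by simp [List.count_cons] <;> omega)
    · exact hmid' h.rotate.rotate hz hq hq'
        (nodup_of_count hnd fun a => by simp [List.count_cons] <;> omega)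
  have hsplit : ∀ {z : V}, z ∈ [u, v, a, b, d] → z ∈ [u, v] ∨ z ∈ [a, b, d] := by
    intro z; simp; tauto
  rcases hsplit hx with hx | hx <;> rcases hsplit hy with hy | hy
  · simp only [List.mem_cons, List.not_mem_nil, or_false] at hx hy
    rcases hx with rfl | rfl <;> rcases hy with rfl | rfl
    · exact absurd rfl hxy
    · exact hends h hq hq' hnd
    · exact hends h.flip hq hq' (nodup_of_count hnd fun a => by simp [List.count_cons] <;> omega)
    · exact absurd rfl hxy
  · exact hmid'' hx hy hq' hq (nodup_of_count hnd fun a => by simp [List.count_cons] <;> omega)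
  · exact hmid'' hy hx hq hq' hnd
  · simp only [List.mem_cons, List.not_mem_nil, or_false] at hx hy
    rcases hx with rfl | rfl | rfl <;> rcases hy with rfl | rfl | rfl
    · exact absurd rfl hxy
    · exact hmids h hq hq' hnd
    · exact hmids h.rotate.rotate.swap hq hq'
        (nodup_of_count hnd fun a => by simp [List.count_cons] <;> omega)
    · exact hmids h.swap hq hq' (nodup_of_count hnd fun a => by simp [List.count_cons] <;> omega)
    · exact absurd rfl hxy
    · exact hmids h.rotate hq hq' (nodup_of_count hnd fun a => by simp [List.count_cons] <;> omega)
    · exact hmids h.rotate.rotate hq hq'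
        (nodup_of_count hnd fun a => by simp [List.count_cons] <;> omega)
    · exact hmids h.rotate.swap hq hq'
        (nodup_of_count hnd fun a => by simp [List.count_cons] <;> omega)
    · exact absurd rfl hxy

/-- `K_{2,4}`, rooted at a vertex of degree four. -/
theorem gad4_K24_end {a b d e : V} (h : Theta G u v [a] [b] [d]) (he : Link G u [e] v)
    (hc : IsBicoloring G c) : Gad4 G u [v, a, b, d, e] := by
  have hu := (h.h₁.parity hc).2 (by simp)
  have : Gad4 G u ([v] ++ ([[a], [b], [d], [e]] ++ []).flatten) :=
    gad_of_search (ms := [53]) (gs := [])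
      (E := [(0, 1, [45]), (0, 1, [23]), (0, 1, [54]), (0, 1, [29])])
      (.cons (h.h₁.long_one hc hu) (.cons (h.h₂.long_one hc hu) (.cons (h.h₃.long_one hc hu)
        (.cons (he.long_one hc hu) .nil)))) .nil rfl (by decide +kernel) (by decide +kernel)
  simpa using this

/-- `K_{2,4}`, rooted at a vertex of degree two. -/
theorem gad4_K24_mid {a b d e : V} (h : Theta G u v [a] [b] [d]) (he : Link G u [e] v)
    (hc : IsBicoloring G c) : Gad4 G e [u, v, a, b, d] := by
  have hu := (h.h₁.parity hc).2 (by simp)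
  have he := link_cons.1 he
  have : Gad4 G e ([u, v] ++ ([[], [], [a], [b], [d]] ++ []).flatten) :=
    gad_of_search (ms := [30, 45]) (gs := [])
      (E := [(0, 1, []), (0, 2, []), (1, 2, [58]), (1, 2, [54]), (1, 2, [29])])
      (.cons ⟨link_nil.2 he.1.symm, atLeast_nil⟩ (.cons ⟨he.2, atLeast_nil⟩
        (.cons (h.h₁.long_one hc hu) (.cons (h.h₂.long_one hc hu) (.cons (h.h₃.long_one hc hu)
        .nil))))) .nil rfl (by decide +kernel) (by decide +kernel)
  simpa using this

end Theta

/-! ### Cores and ears -/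

/-- With all lists equal, neighbours get complementary pairs, exactly one of which contains the
colour 0. -/
theorem Choosable.exists_isBicoloring (h : Choosable G 4 2) : ∃ c, IsBicoloring G c := by
  obtain ⟨ψ, hψ⟩ := h.exists_maskColoring (fun _ => 15) fun _ => by decide
  refine ⟨fun v => (ψ v).testBit 0, fun x y hxy => ?_⟩
  have key : ∀ X ∈ prs 15, ∀ Y ∈ prs 15, X &&& Y = 0 → X.testBit 0 ≠ Y.testBit 0 := by decide
  exact key _ (hψ.1 x trivial) _ (hψ.1 y trivial) (hψ.2 x trivial y trivial hxy)

/-- `S` is nonempty and cannot be split into two parts without edges in between. -/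
def Linked (G : SimpleGraph V) (S : Set V) : Prop :=
  S.Nonempty ∧ ∀ X : Set V, (∃ x ∈ S, x ∈ X) →
    (∀ x ∈ S, ∀ y ∈ S, x ∈ X → G.Adj x y → y ∈ X) → S ⊆ X

theorem linked_univ (h : G.Connected) : Linked G Set.univ := by
  refine ⟨⟨h.nonempty.some, trivial⟩, ?_⟩
  rintro X ⟨x, -, hx⟩ hX y -
  obtain ⟨p⟩ := h.preconnected x y
  induction p with
  | nil => exact hx
  | cons hadj p ih => exact ih (hX _ trivial _ trivial hx hadj)

/-- A set closed under adjacency in the smaller graph becomes closed in the larger one if the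
deleted leaf `v` is put on the side of its neighbour `w`. -/
theorem PrunesTo.linked {S : Set V} (h : PrunesTo G S) (hG : G.Connected) : Linked G S := by
  induction h with
  | start => exact linked_univ hG
  | @delete S v h hv hdeg ih =>
    obtain ⟨w, hw⟩ := Set.ncard_eq_one.1 hdeg
    have hwS : w ∈ S ∧ G.Adj v w := by
      have : w ∈ {w ∈ S | G.Adj v w} := hw ▸ rfl
      exact this
    have huniq : ∀ y ∈ S, G.Adj v y → y = w := fun y hy hvy => by
      have : y ∈ {w ∈ S | G.Adj v w} := ⟨hy, hvy⟩
      rw [hw] at this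
      exact this
    refine ⟨⟨w, hwS.1, fun h => G.ne_of_adj hwS.2 (Set.mem_singleton_iff.1 h).symm⟩, ?_⟩
    rintro X ⟨x, hxS, hxX⟩ hX y hy
    have := ih.2 {z | z ∈ X ∧ z ≠ v ∨ z = v ∧ w ∈ X} ⟨x, hxS.1, Or.inl ⟨hxX, hxS.2⟩⟩ (by
      rintro a ha b hb (⟨haX, hav⟩ | ⟨rfl, hwX⟩) hab
      · by_cases hbv : b = v
        · subst hbv
          exact Or.inr ⟨rfl, huniq a ha hab.symm ▸ haX⟩
        · exact Or.inl ⟨hX a ⟨ha, hav⟩ b ⟨hb, hbv⟩ haX hab, hbv⟩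
      · exact Or.inl ⟨huniq b hb hab ▸ hwX, (G.ne_of_adj hab).symm⟩) hy.1
    rcases this with h | h
    · exact h.1
    · exact absurd h.1 hy.2

/-- Every vertex of `S` has at least two neighbours in `S`. -/
def MinDegTwo (G : SimpleGraph V) (S : Set V) : Prop :=
  ∀ v ∈ S, ∀ w, ∃ z ∈ S, G.Adj v z ∧ z ≠ w

/-- In a connected set a vertex without neighbours is alone, and a vertex with just one neighbour
could still be deleted. -/
theorem IsCore.minDegTwo [Finite V] {S : Set V} (h : IsCore G S) (hG : G.Connected) :
    (∃ v, S = {v}) ∨ MinDegTwo G S := by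
  by_cases hS : ∃ v, S = {v}
  · exact Or.inl hS
  refine Or.inr fun v hv w => ?_
  by_contra! hcon
  have hsub : {z ∈ S | G.Adj v z} ⊆ {w} := fun z hz => hcon z hz.1 hz.2
  rcases Set.subset_singleton_iff_eq.1 hsub with h0 | h1
  · refine hS ⟨v, Set.Subset.antisymm ((h.1.linked hG).2 {v} ⟨v, hv, rfl⟩ ?_) (by simpa using hv)⟩
    rintro x - y hy rfl hxy
    have : y ∈ {z ∈ S | G.Adj x z} := ⟨hy, hxy⟩
    rw [h0] at this
    exact this.elim
  · exact h.2 v hv (by rw [h1, Set.ncard_singleton])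

/-- The edges of the walk with vertices `l`. -/
def ledges : List V → List (Sym2 V)
  | a :: b :: t => s(a, b) :: ledges (b :: t)
  | _ => []

theorem mem_of_mem_ledges {x y : V} : ∀ {l : List V}, s(x, y) ∈ ledges l → x ∈ l ∧ y ∈ l
  | a :: b :: t, h => by
    rw [ledges, List.mem_cons] at h
    rcases h with h | h
    · rcases Sym2.eq_iff.1 h with ⟨rfl, rfl⟩ | ⟨rfl, rfl⟩ <;> simp
    · have := mem_of_mem_ledges h
      exact ⟨List.mem_cons_of_mem _ this.1, List.mem_cons_of_mem _ this.2⟩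
  | [a], h => by simp [ledges] at h
  | [], h => by simp [ledges] at h

theorem ledges_append (l : List V) (x : V) (l' : List V) :
    ledges (l ++ x :: l') = ledges (l ++ [x]) ++ ledges (x :: l') := by
  induction l with
  | nil => simp [ledges]
  | cons a l ih =>
    cases l with
    | nil => simp [ledges]
    | cons b l => simpa [ledges] using ih

theorem mem_ledges_reverse {e : Sym2 V} (l : List V) : e ∈ ledges l.reverse ↔ e ∈ ledges l := by
  induction l with
  | nil => simp
  | cons a l ih =>
    cases l with
    | nil => simp
    | cons b l =>
      rw [List.reverse_cons, List.reverse_cons, List.append_assoc, List.singleton_append,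
        ledges_append, List.mem_append, ← List.reverse_cons, ih]
      simp [ledges, Sym2.eq_swap, or_comm]

theorem adj_of_mem_ledges {x y : V} : ∀ {l : List V}, List.IsChain G.Adj l → s(x, y) ∈ ledges l →
    G.Adj x y
  | a :: b :: t, hl, h => by
    rw [ledges, List.mem_cons] at h
    rw [List.isChain_cons_cons] at hl
    rcases h with h | h
    · rcases Sym2.eq_iff.1 h with ⟨rfl, rfl⟩ | ⟨rfl, rfl⟩
      exacts [hl.1, hl.1.symm]
    · exact adj_of_mem_ledges hl.2 h
  | [a], _, h => by simp [ledges] at h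
  | [], _, h => by simp [ledges] at h

/-- The edges of a link. -/
def linkEdges (u : V) (l : List V) (v : V) : List (Sym2 V) := ledges (u :: (l ++ [v]))

@[simp] theorem linkEdges_nil {u v : V} : linkEdges u [] v = [s(u, v)] := rfl

theorem linkEdges_append {u x v : V} {l l' : List V} :
    linkEdges u (l ++ x :: l') v = linkEdges u l x ++ linkEdges x l' v := by
  have := ledges_append (u :: l) x (l' ++ [v])
  simpa [linkEdges] using this

theorem mem_linkEdges_reverse {e : Sym2 V} {u v : V} {l : List V} :
    e ∈ linkEdges v l.reverse u ↔ e ∈ linkEdges u l v := by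
  rw [linkEdges, linkEdges, ← mem_ledges_reverse (u :: (l ++ [v]))]
  simp

theorem mem_of_mem_linkEdges {u v x y : V} {l : List V} (h : s(x, y) ∈ linkEdges u l v) :
    x ∈ u :: v :: l ∧ y ∈ u :: v :: l := by
  have := mem_of_mem_ledges h
  simp at this ⊢
  tauto

/-- A graph `S` of minimum degree two that properly contains a subgraph has an ear or a lollipop
attached to it. -/
theorem exists_ear [Finite V] {S : Set V} (hS : Linked G S) (hdeg : MinDegTwo G S) {X : List V}
    (hXnd : X.Nodup) (hXS : ∀ x ∈ X, x ∈ S) (hX : X ≠ []) {D : List (Sym2 V)}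
    (hDX : ∀ x y, s(x, y) ∈ D → x ∈ X ∧ y ∈ X)
    (hD : ¬ ∀ x ∈ S, ∀ y ∈ S, G.Adj x y → s(x, y) ∈ D) :
    (∃ x ∈ X, ∃ y ∈ X, ∃ l, x ≠ y ∧ Link G x l y ∧ (X ++ l).Nodup ∧ (∀ z ∈ l, z ∈ S) ∧
      (l = [] → s(x, y) ∉ D)) ∨
    ∃ x ∈ X, ∃ q, Lolli G x q ∧ (X ++ q).Nodup ∧ ∀ z ∈ q, z ∈ S := by
  classical
  have : Fintype V := Fintype.ofFinite V
  obtain ⟨x, hxX, y, hyS, hxy, hxyD⟩ : ∃ x ∈ X, ∃ y ∈ S, G.Adj x y ∧ s(x, y) ∉ D := by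
    by_contra! hcon
    obtain ⟨x₀, hx₀⟩ := List.exists_mem_of_ne_nil _ hX
    have hsub := hS.2 {v | v ∈ X} ⟨x₀, hXS _ hx₀, hx₀⟩ fun x _ y hy hx hxy =>
      (hDX x y (hcon x hx y hy hxy)).2
    exact hD fun x hx y hy hxy => hcon x (hsub hx) y hy hxy
  by_cases hyX : y ∈ X
  · exact Or.inl ⟨x, hxX, y, hyX, [], G.ne_of_adj hxy, link_nil.2 hxy, by simpa using hXnd,
      by simp, fun _ => hxyD⟩
  -- The path that leaves `X` is prolonged until it returns to `X`, giving an ear or a cycle through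
  -- `x`, or meets itself, giving a lollipop. The counter `n` ends the process, as the path cannot
  -- have more members than there are vertices.
  have grow : ∀ n : ℕ, ∀ q p, n + q.length = Fintype.card V → Link G x q p →
      (X ++ (q ++ [p])).Nodup → (∀ z ∈ q ++ [p], z ∈ S) →
      (∃ x ∈ X, ∃ y ∈ X, ∃ l, x ≠ y ∧ Link G x l y ∧ (X ++ l).Nodup ∧ (∀ z ∈ l, z ∈ S) ∧
        (l = [] → s(x, y) ∉ D)) ∨
      ∃ x ∈ X, ∃ q, Lolli G x q ∧ (X ++ q).Nodup ∧ ∀ z ∈ q, z ∈ S := by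
    intro n
    induction n with
    | zero =>
      intro q p hn _ hnd _
      have h1 : (q ++ [p]).Nodup := hnd.sublist (List.sublist_append_right _ _)
      have := h1.length_le_card
      simp at this hn
      omega
    | succ n ih =>
      intro q p hn hl hnd hqS
      -- The last member of `x :: q` is the vertex from which `p` was reached, so the path never
      -- turns back.
      obtain ⟨z, hzS, hpz, hzne⟩ := hdeg p (hqS p (by simp)) ((x :: q).getLast (by simp))
      have hzp : z ≠ p := (G.ne_of_adj hpz).symm
      by_cases hzX : z ∈ X
      · by_cases hzx : z = x
        · subst hzx
          refine Or.inr ⟨z, hxX, q ++ [p], ⟨[], z, q ++ [p], rfl, ?_, ?_⟩, hnd, hqS⟩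
          · have : Link G z (q ++ [p]) z := link_append.2 ⟨hl, link_nil.2 hpz⟩
            exact this
          · have : q ≠ [] := by
              rintro rfl
              exact hzne rfl
            have := List.length_pos_iff.2 this
            simp
            omega
        · exact Or.inl ⟨x, hxX, z, hzX, q ++ [p], Ne.symm hzx,
            link_append.2 ⟨hl, link_nil.2 hpz⟩, hnd, hqS, by simp⟩
      · by_cases hzq : z ∈ q
        · obtain ⟨a, b, rfl⟩ := List.append_of_mem hzq
          refine Or.inr ⟨x, hxX, a ++ z :: b ++ [p], ⟨x :: a, z, b ++ [p], by simp, ?_, ?_⟩, hnd,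
            hqS⟩
          · have : Link G x (a ++ z :: (b ++ [p])) z := by
              rw [link_append] at hl ⊢
              exact ⟨hl.1, link_append.2 ⟨hl.2, link_nil.2 hpz⟩⟩
            simpa [Link] using this
          · have : b ≠ [] := by
              rintro rfl
              exact hzne (by simp)
            have := List.length_pos_iff.2 this
            simp
            omega
        · refine ih (q ++ [p]) z (by simp; omega) (link_append.2 ⟨hl, link_nil.2 hpz⟩) ?_ ?_
          · rw [← List.append_assoc]
            rw [List.nodup_append']
            refine ⟨hnd, by simp, ?_⟩
            intro w hw hw'
            rw [List.mem_singleton] at hw'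
            subst hw'
            simp at hw
            tauto
          · intro w hw
            rcases List.mem_append.1 hw with hw | hw
            · exact hqS w hw
            · rw [List.mem_singleton.1 hw]
              exact hzS
  refine grow (Fintype.card V) [] y (by simp) (link_nil.2 hxy) ?_ (by simpa using hyS)
  rw [List.nil_append, List.nodup_append']
  exact ⟨hXnd, by simp, fun w hw hw' => hyX (List.mem_singleton.1 hw' ▸ hw)⟩


/-! ### Ears of theta graphs -/

/-- The edges of a theta graph. -/
def thetaEdges (u v : V) (l₁ l₂ l₃ : List V) : List (Sym2 V) :=
  linkEdges u l₁ v ++ linkEdges u l₂ v ++ linkEdges u l₃ v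

/-- A theta graph together with a further path between two of its vertices. -/
structure ThetaEar (G : SimpleGraph V) (u v : V) (l₁ l₂ l₃ : List V) (x y : V) (l : List V) :
    Prop where
  th : Theta G u v l₁ l₂ l₃
  link : Link G x l y
  nd : (u :: v :: (l₁ ++ l₂ ++ l₃ ++ l)).Nodup
  new : l = [] → s(x, y) ∉ thetaEdges u v l₁ l₂ l₃

section ThetaEar

variable {u v x y : V} {l₁ l₂ l₃ l : List V} {c : V → Bool}

theorem ThetaEar.rotate (h : ThetaEar G u v l₁ l₂ l₃ x y l) : ThetaEar G u v l₂ l₃ l₁ x y l := by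
  classical
  refine ⟨h.th.rotate, h.link, nodup_of_count h.nd fun a => by simp [List.count_cons] <;> omega,
    fun hl => ?_⟩
  have := h.new hl
  simp only [thetaEdges, List.mem_append] at this ⊢
  tauto

theorem ThetaEar.swap (h : ThetaEar G u v l₁ l₂ l₃ x y l) : ThetaEar G u v l₂ l₁ l₃ x y l := by
  classical
  refine ⟨h.th.swap, h.link, nodup_of_count h.nd fun a => by simp [List.count_cons] <;> omega,
    fun hl => ?_⟩
  have := h.new hl
  simp only [thetaEdges, List.mem_append] at this ⊢
  tauto

theorem ThetaEar.flip (h : ThetaEar G u v l₁ l₂ l₃ x y l) :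
    ThetaEar G v u l₁.reverse l₂.reverse l₃.reverse x y l := by
  classical
  refine ⟨h.th.flip, h.link, nodup_of_count h.nd fun a => by simp [List.count_cons] <;> omega,
    fun hl => ?_⟩
  have := h.new hl
  simpa only [thetaEdges, List.mem_append, mem_linkEdges_reverse] using this

theorem ThetaEar.rev (h : ThetaEar G u v l₁ l₂ l₃ x y l) :
    ThetaEar G u v l₁ l₂ l₃ y x l.reverse := by
  classical
  refine ⟨h.th, h.link.symm, nodup_of_count h.nd fun a => by simp [List.count_cons] <;> omega,
    fun hl => ?_⟩
  rw [Sym2.eq_swap]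
  exact h.new (by simpa using hl)

/-- An ear from the end `u` to an interior vertex would create two double links at `u`. If the ear
is an edge, its being new ensures that the doubled segment is longer than an edge. -/
theorem ThetaEar.not_mem_of_end (h : ThetaEar G u v l₁ l₂ l₃ u y l) (hc : IsBicoloring G c)
    (hch : Choosable G 4 2) : y ∉ l₁ ++ l₂ ++ l₃ := by
  have key : ∀ {l₁ l₂ l₃ : List V}, ThetaEar G u v l₁ l₂ l₃ u y l → y ∉ l₁ := by
    intro l₁ l₂ l₃ h hy
    obtain ⟨s, t, rfl⟩ := List.append_of_mem hy
    refine h.th.not_choosable_of_ear_end hc h.link h.nd ?_ hch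
    rintro hl rfl
    exact h.new hl (by simp [thetaEdges, linkEdges, ledges])
  simp only [List.mem_append, not_or]
  exact ⟨⟨key h, key h.rotate⟩, key h.rotate.rotate⟩

/-- Two ends of an ear inside the same path would create two disjoint double links. -/
theorem ThetaEar.not_mem_of_mem (h : ThetaEar G u v l₁ l₂ l₃ x y l) (hc : IsBicoloring G c)
    (hch : Choosable G 4 2) (hxy : x ≠ y) (hx : x ∈ l₁) : y ∉ l₁ := by
  have key : ∀ {x y : V} {l s m t : List V},
      ThetaEar G u v (s ++ x :: (m ++ y :: t)) l₂ l₃ x y l → False := by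
    intro x y l s m t h
    refine h.th.not_choosable_of_ear_same hc h.link h.nd ?_ hch
    rintro hl rfl
    refine h.new hl ?_
    simp only [thetaEdges, linkEdges_append, List.nil_append, List.mem_append]
    exact Or.inl (Or.inl (Or.inr (by simp [linkEdges, ledges])))
  intro hy
  obtain ⟨s, t, rfl⟩ := List.append_of_mem hx
  rw [List.mem_append, List.mem_cons] at hy
  rcases hy with hy | rfl | hy
  · obtain ⟨s', t', rfl⟩ := List.append_of_mem hy
    have h := h.rev
    rw [List.append_assoc, List.cons_append] at h
    exact key h
  · exact hxy rfl
  · obtain ⟨s', t', rfl⟩ := List.append_of_mem hy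
    exact key h

/-- In a choosable graph, an ear of a theta graph joins its two ends, and all four paths have
length two, or the ear joins interior vertices of two of its paths. -/
theorem ThetaEar.cases (h : ThetaEar G u v l₁ l₂ l₃ x y l) (hc : IsBicoloring G c)
    (hch : Choosable G 4 2) (hxy : x ≠ y) (hx : x ∈ u :: v :: (l₁ ++ l₂ ++ l₃))
    (hy : y ∈ u :: v :: (l₁ ++ l₂ ++ l₃)) :
    (l₁.length = 1 ∧ l₂.length = 1 ∧ l₃.length = 1 ∧ l.length = 1 ∧ Link G u l v) ∨
    ∃ m₁ m₂ m₃ x' y' l', ThetaEar G u v m₁ m₂ m₃ x' y' l' ∧ [m₁, m₂, m₃].Perm [l₁, l₂, l₃] ∧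
      (x' = x ∧ y' = y ∧ l' = l ∨ x' = y ∧ y' = x ∧ l' = l.reverse) ∧ x' ∈ m₁ ∧ y' ∈ m₂ := by
  have hends : ∀ {l₁ l₂ l₃ l : List V} {u v : V}, ThetaEar G u v l₁ l₂ l₃ u v l →
      l₁.length = 1 ∧ l₂.length = 1 ∧ l₃.length = 1 ∧ l.length = 1 ∧ Link G u l v := by
    intro l₁ l₂ l₃ l u v h
    have := h.th.length_of_fourth_link hc hch h.link h.nd fun hl => by
      have := h.new hl
      refine ⟨?_, ?_, ?_⟩ <;> rintro rfl <;> simp [thetaEdges] at this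
    exact ⟨this.2.1, this.2.2.1, this.2.2.2.1, this.2.2.2.2, h.link⟩
  have hinner : ∀ {m₁ m₂ m₃ : List V}, ThetaEar G u v m₁ m₂ m₃ x y l →
      [m₁, m₂, m₃].Perm [l₁, l₂, l₃] → x ∈ m₁ → y ∈ m₂ ∨ y ∈ m₃ → ∃ m₁ m₂ m₃ x' y' l',
      ThetaEar G u v m₁ m₂ m₃ x' y' l' ∧ [m₁, m₂, m₃].Perm [l₁, l₂, l₃] ∧
      (x' = x ∧ y' = y ∧ l' = l ∨ x' = y ∧ y' = x ∧ l' = l.reverse) ∧ x' ∈ m₁ ∧ y' ∈ m₂ := by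
    rintro m₁ m₂ m₃ h hp hx (hy | hy)
    · exact ⟨m₁, m₂, m₃, x, y, l, h, hp, Or.inl ⟨rfl, rfl, rfl⟩, hx, hy⟩
    · exact ⟨m₁, m₃, m₂, x, y, l, h.swap.rotate, ((List.Perm.swap m₂ m₃ []).cons m₁).trans hp,
        Or.inl ⟨rfl, rfl, rfl⟩, hx, hy⟩
  have hr : [l₂, l₃, l₁].Perm [l₁, l₂, l₃] := List.perm_append_comm (l₁ := [l₂, l₃]) (l₂ := [l₁])
  have hr' : [l₃, l₁, l₂].Perm [l₁, l₂, l₃] := List.perm_append_comm (l₁ := [l₃]) (l₂ := [l₁, l₂])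
  have hy₀ := hy
  have hx₀ := hx
  simp only [List.mem_cons] at hx hy
  rcases hx with rfl | rfl | hx
  · rcases hy with rfl | rfl | hy
    · exact absurd rfl hxy
    · exact Or.inl (hends h)
    · exact absurd hy (h.not_mem_of_end hc hch)
  · rcases hy with rfl | rfl | hy
    · have := hends h.rev
      obtain ⟨e, rfl⟩ := List.length_eq_one_iff.1 (by simpa using this.2.2.2.1)
      exact Or.inl this
    · exact absurd rfl hxy
    · exact absurd hy (by simpa using h.flip.not_mem_of_end hc hch)
  · rcases hy with rfl | rfl | hy
    · exact absurd hx (h.rev.not_mem_of_end hc hch)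
    · exact absurd hx (by simpa using h.rev.flip.not_mem_of_end hc hch)
    · right
      simp only [List.mem_append] at hx hy
      rcases hx with (hx | hx) | hx
      · have := h.not_mem_of_mem hc hch hxy hx
        exact hinner h (List.Perm.refl _) hx (by tauto)
      · have := h.rotate.not_mem_of_mem hc hch hxy hx
        exact hinner h.rotate hr hx (by tauto)
      · have := h.rotate.rotate.not_mem_of_mem hc hch hxy hx
        exact hinner h.rotate.rotate hr' hx (by tauto)

/-- `K_{3,3}` minus an edge, where one path of length two is replaced by a path with interior
`d`. -/
structure K33eLayout (G : SimpleGraph V) (a₁ a₂ b₁ b₂ b₀ : V) (d : List V) : Prop where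
  h₁₁ : G.Adj a₁ b₁
  h₁₂ : G.Adj a₁ b₂
  h₂₁ : G.Adj a₂ b₁
  h₂₂ : G.Adj a₂ b₂
  h₁₀ : G.Adj a₁ b₀
  h₂₀ : G.Adj a₂ b₀
  link : Link G b₁ d b₂
  nd : (a₁ :: a₂ :: b₁ :: b₂ :: b₀ :: d).Nodup

/-- The unsubdivided four-cycle and the diagonal of length two form K_{2,3}; the other diagonal is
the path with interior `d`. -/
theorem K4Layout.exists_K33eLayout {l₄ l₅ l₆ : List V}
    (h : K4Layout G u v x y l₁ l₂ l₃ l₄ l₅ l₆) (hc : IsBicoloring G c) (hch : Choosable G 4 2) :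
    ∃ a₁ a₂ b₁ b₂ b₀ d, K33eLayout G a₁ a₂ b₁ b₂ b₀ d ∧ a₁ :: a₂ :: b₁ :: b₂ :: b₀ :: d ⊆
      u :: v :: x :: y :: (l₁ ++ l₂ ++ l₃ ++ l₄ ++ l₅ ++ l₆) := by
  classical
  have key : ∀ {u v x y : V} {l₁ l₆ : List V}, K4Layout G u v x y l₁ [] [] [] [] l₆ →
      l₁.length = 1 ∨ l₆.length = 1 → ∃ a₁ a₂ b₁ b₂ b₀ d, K33eLayout G a₁ a₂ b₁ b₂ b₀ d ∧
      a₁ :: a₂ :: b₁ :: b₂ :: b₀ :: d ⊆ u :: v :: x :: y :: (l₁ ++ l₆) := by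
    intro u v x y l₁ l₆ h hl
    have h₂ := link_nil.1 h.h₂
    have h₃ := link_nil.1 h.h₃
    have h₄ := link_nil.1 h.h₄
    have h₅ := link_nil.1 h.h₅
    rcases hl with hl | hl
    · obtain ⟨b₀, rfl⟩ := List.length_eq_one_iff.1 hl
      have h₁ := link_cons.1 h.h₁
      exact ⟨u, v, x, y, b₀, l₆, ⟨h₂, h₃, h₄, h₅, h₁.1, (link_nil.1 h₁.2).symm, h.h₆,
        nodup_of_count h.nd fun a => by simp [List.count_cons] <;> omega⟩,
        by intro a; simp⟩
    · obtain ⟨b₀, rfl⟩ := List.length_eq_one_iff.1 hl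
      have h₁ := link_cons.1 h.h₆
      exact ⟨x, y, u, v, b₀, l₁, ⟨h₂.symm, h₄.symm, h₃.symm, h₅.symm, h₁.1,
        (link_nil.1 h₁.2).symm, h.h₁,
        nodup_of_count h.nd fun a => by simp [List.count_cons] <;> omega⟩,
        by intro a; simp; tauto⟩
  rcases h.classify hc hch with ⟨rfl, rfl, rfl, rfl, hl⟩ | ⟨rfl, rfl, rfl, rfl, hl⟩ |
    ⟨rfl, rfl, rfl, rfl, hl⟩
  · obtain ⟨a₁, a₂, b₁, b₂, b₀, d, h1, h2⟩ := key h hl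
    exact ⟨a₁, a₂, b₁, b₂, b₀, d, h1, List.Subset.trans h2 (by intro a; simp)⟩
  · obtain ⟨a₁, a₂, b₁, b₂, b₀, d, h1, h2⟩ := key h.swap₂ hl
    exact ⟨a₁, a₂, b₁, b₂, b₀, d, h1, List.Subset.trans h2 (by intro a; simp; tauto)⟩
  · obtain ⟨a₁, a₂, b₁, b₂, b₀, d, h1, h2⟩ := key h.swap₃.swap₂ (by simpa using hl)
    exact ⟨a₁, a₂, b₁, b₂, b₀, d, h1, List.Subset.trans h2 (by intro a; simp; tauto)⟩

/-- `K_{2,4}`. -/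
structure K24Layout (G : SimpleGraph V) (u v a b d e : V) : Prop where
  th : Theta G u v [a] [b] [d]
  link : Link G u [e] v
  nd : [u, v, a, b, d, e].Nodup

/-- In a choosable graph, a theta graph with an ear is `K_{2,4}`, or contains a subdivision of
`K_{3,3}` minus an edge. -/
theorem ThetaEar.exists_layout (h : ThetaEar G u v l₁ l₂ l₃ x y l) (hc : IsBicoloring G c)
    (hch : Choosable G 4 2) (hxy : x ≠ y) (hx : x ∈ u :: v :: (l₁ ++ l₂ ++ l₃))
    (hy : y ∈ u :: v :: (l₁ ++ l₂ ++ l₃)) :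
    (∃ u' v' a b d e, K24Layout G u' v' a b d e ∧
      [u', v', a, b, d, e] ⊆ u :: v :: (l₁ ++ l₂ ++ l₃ ++ l)) ∨
    ∃ a₁ a₂ b₁ b₂ b₀ d, K33eLayout G a₁ a₂ b₁ b₂ b₀ d ∧
      a₁ :: a₂ :: b₁ :: b₂ :: b₀ :: d ⊆ u :: v :: (l₁ ++ l₂ ++ l₃ ++ l) := by
  rcases h.cases hc hch hxy hx hy with ⟨h1, h2, h3, h4, h5⟩ |
    ⟨m₁, m₂, m₃, x', y', l', h', hp, hxy', hx', hy'⟩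
  · obtain ⟨a, rfl⟩ := List.length_eq_one_iff.1 h1
    obtain ⟨b, rfl⟩ := List.length_eq_one_iff.1 h2
    obtain ⟨d, rfl⟩ := List.length_eq_one_iff.1 h3
    obtain ⟨e, rfl⟩ := List.length_eq_one_iff.1 h4
    exact Or.inl ⟨u, v, a, b, d, e, ⟨h.th, h5, h.nd⟩, List.Subset.refl _⟩
  · right
    obtain ⟨s, t, rfl⟩ := List.append_of_mem hx'
    obtain ⟨s', t', rfl⟩ := List.append_of_mem hy'
    obtain ⟨a₁, a₂, b₁, b₂, b₀, d, h6, h7⟩ :=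
      (h'.th.K4Layout_of_ear h'.link h'.nd).exists_K33eLayout hc hch
    refine ⟨a₁, a₂, b₁, b₂, b₀, d, h6, List.Subset.trans h7 fun z hz => ?_⟩
    have hm : ∀ m ∈ [s ++ x' :: t, s' ++ y' :: t', m₃], ∀ z ∈ m,
        z ∈ u :: v :: (l₁ ++ l₂ ++ l₃ ++ l) := by
      intro m hm z hz
      have := hp.mem_iff.1 hm
      simp only [List.mem_cons, List.not_mem_nil, or_false] at this
      simp only [List.mem_cons, List.mem_append]
      rcases this with rfl | rfl | rfl <;> tauto
    have hl : ∀ z ∈ l', z ∈ l := by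
      rcases hxy' with ⟨-, -, rfl⟩ | ⟨-, -, rfl⟩ <;> simp
    simp only [List.forall_mem_cons, List.not_mem_nil, false_imp_iff, implies_true, and_true,
      List.mem_append] at hm
    simp only [List.mem_cons, List.mem_append, List.mem_reverse] at hz hm ⊢
    obtain ⟨hm1, hm2, hm3⟩ := hm
    rcases hz with rfl | rfl | rfl | rfl | ((((hz | hz) | hz) | hz) | hz) | hz
    · simp
    · simp
    · exact hm1 _ (by simp)
    · exact hm2 _ (by simp)
    · exact hm3 _ hz
    · exact hm1 _ (by simp [hz])
    · exact hm2 _ (by simp [hz])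
    · exact hm1 _ (by simp [hz])
    · exact hm2 _ (by simp [hz])
    · have := hl z hz
      tauto

end ThetaEar

/-! ### `K_{2,4}` and subdivisions of `K_{3,3}` minus an edge -/

section Spanning

variable {c : V → Bool}

theorem K24Layout.adj {u v a b d e : V} (h : K24Layout G u v a b d e) :
    ∀ z ∈ [a, b, d, e], G.Adj u z ∧ G.Adj z v := by
  have h₁ := link_cons.1 h.th.h₁
  have h₂ := link_cons.1 h.th.h₂
  have h₃ := link_cons.1 h.th.h₃
  have h₄ := link_cons.1 h.link
  simp only [link_nil] at h₁ h₂ h₃ h₄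
  simp [h₁, h₂, h₃, h₄]

theorem K24Layout.of_adj {u v a b d e : V} (h : ∀ z ∈ [a, b, d, e], G.Adj u z ∧ G.Adj z v)
    (nd : [u, v, a, b, d, e].Nodup) : K24Layout G u v a b d e := by
  have hl : ∀ z ∈ [a, b, d, e], Link G u [z] v := fun z hz =>
    link_cons.2 ⟨(h z hz).1, link_nil.2 (h z hz).2⟩
  exact ⟨⟨hl _ (by simp), hl _ (by simp), hl _ (by simp), nd.sublist (by simp), by simp, by simp,
    by simp⟩, hl _ (by simp), nd⟩

theorem K24Layout.perm {u v a b d e a' b' d' e' : V} (h : K24Layout G u v a b d e)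
    (hp : [a', b', d', e'].Perm [a, b, d, e]) : K24Layout G u v a' b' d' e' :=
  .of_adj (fun z hz => h.adj z (hp.mem_iff.1 hz)) (((hp.cons v).cons u).nodup_iff.2 h.nd)

theorem K24Layout.flip {u v a b d e : V} (h : K24Layout G u v a b d e) :
    K24Layout G v u a b d e :=
  .of_adj (fun z hz => ⟨(h.adj z hz).2.symm, (h.adj z hz).1.symm⟩)
    ((List.Perm.swap _ _ _).nodup_iff.1 h.nd)

theorem exists_perm_of_mem {a b d e x : V} (hx : x ∈ [a, b, d, e]) :
    ∃ b' d' e', [x, b', d', e'].Perm [a, b, d, e] := by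
  classical
  have h3 : ([a, b, d, e].erase x).length = 3 := by rw [List.length_erase_of_mem hx]; simp
  obtain ⟨p, q, r, h⟩ := List.length_eq_three.1 h3
  exact ⟨p, q, r, h ▸ (List.perm_cons_erase hx).symm⟩

theorem exists_perm_of_mem_of_mem {a b d e x y : V} (hx : x ∈ [a, b, d, e]) (hy : y ∈ [a, b, d, e])
    (hxy : x ≠ y) : ∃ d' e', [x, y, d', e'].Perm [a, b, d, e] := by
  classical
  obtain ⟨b', d', e', hp⟩ := exists_perm_of_mem hx
  have hy' : y ∈ [b', d', e'] := by
    have := hp.mem_iff.2 hy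
    rw [List.mem_cons] at this
    exact this.resolve_left (Ne.symm hxy)
  simp only [List.mem_cons, List.not_mem_nil, or_false] at hy'
  rcases hy' with rfl | rfl | rfl
  · exact ⟨d', e', hp⟩
  · exact ⟨b', e', ((List.Perm.swap _ _ _).cons _).trans hp⟩
  · exact ⟨b', d', (List.Perm.cons _ (List.perm_append_comm (l₁ := [y]) (l₂ := [b', d']))).trans hp⟩

/-- The edges of `K_{2,4}`. -/
def K24Edges (u v a b d e : V) : List (Sym2 V) := thetaEdges u v [a] [b] [d] ++ linkEdges u [e] v

theorem mem_K24Edges {u v a b d e : V} {x y : V} : s(x, y) ∈ K24Edges u v a b d e ↔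
    ∃ z ∈ [a, b, d, e], s(x, y) = s(u, z) ∨ s(x, y) = s(z, v) := by
  simp only [K24Edges, thetaEdges, linkEdges, ledges, List.mem_cons,
    List.not_mem_nil, or_false, List.nil_append, List.cons_append, exists_eq_or_imp,
    exists_eq_left, or_assoc]

/-- Every attachment is excluded. An ear between the vertices of degree four is a fifth link; one
from such a vertex to a middle vertex is an ear at the end of a theta graph; one between middle
vertices gives two double links; a lollipop meets a `Gad4`. -/
theorem K24Layout.spanning [Finite V] {S : Set V} (hS : Linked G S) (hdeg : MinDegTwo G S)
    (hc : IsBicoloring G c) (hch : Choosable G 4 2) {u v a b d e : V}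
    (h : K24Layout G u v a b d e) (hsub : ∀ x ∈ [u, v, a, b, d, e], x ∈ S) :
    ∀ x ∈ S, ∀ y ∈ S, G.Adj x y → s(x, y) ∈ K24Edges u v a b d e := by
  classical
  by_contra hcon
  have hsplit : ∀ {z : V}, z ∈ [u, v, a, b, d, e] → z = u ∨ z = v ∨ z ∈ [a, b, d, e] := by
    intro z; simp
  rcases exists_ear hS hdeg h.nd hsub (by simp) (D := K24Edges u v a b d e) (fun x y hxy => by
      obtain ⟨z, hz, h1 | h1⟩ := mem_K24Edges.1 hxy <;>
      rcases Sym2.eq_iff.1 h1 with ⟨rfl, rfl⟩ | ⟨rfl, rfl⟩ <;>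
      simp only [List.mem_cons] at hz ⊢ <;> tauto) hcon with
    ⟨x, hx, y, hy, l, hxy, hl, hnd, -, hnew⟩ | ⟨x, hx, q, hq, hnd, -⟩
  · have hend : ∀ {u v : V} {x y : V} {l : List V}, K24Layout G u v a b d e → Link G x l y →
        ([u, v, a, b, d, e] ++ l).Nodup → (l = [] → s(x, y) ∉ K24Edges u v a b d e) → x = u →
        y ∈ [a, b, d, e] → False := by
      rintro u v x y l h hl hnd hnew rfl hy
      obtain ⟨b', d', e', hp⟩ := exists_perm_of_mem hy
      have h' := h.perm hp
      have hE : ThetaEar G x v [y] [b'] [d'] x y l := by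
        refine ⟨h'.th, hl, ?_, fun hl => ?_⟩
        · have := (((hp.cons v).cons x).append_right l).nodup_iff.2 hnd
          exact nodup_of_count this fun a => by simp [List.count_cons] <;> omega
        · exact absurd (mem_K24Edges.2 ⟨y, hy, Or.inl rfl⟩) (hnew hl)
      exact hE.not_mem_of_end hc hch (by simp)
    have hflip : ∀ {u v x y : V}, s(x, y) ∈ K24Edges v u a b d e → s(x, y) ∈ K24Edges u v a b d e := by
      intro u v x y hxy
      rw [mem_K24Edges] at hxy ⊢
      obtain ⟨z, hz, h1 | h1⟩ := hxy
      · exact ⟨z, hz, Or.inr (h1.trans Sym2.eq_swap)⟩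
      · exact ⟨z, hz, Or.inl (h1.trans Sym2.eq_swap)⟩
    have hends : ∀ {l : List V}, Link G u l v → ([u, v, a, b, d, e] ++ l).Nodup → False := by
      intro l hl hnd
      have hu := (h.th.h₁.parity hc).2 (by simp)
      exact not_choosable_five_links (h.th.h₁.long_one hc hu) (h.th.h₂.long_one hc hu)
        (h.th.h₃.long_one hc hu) (h.link.long_one hc hu) (hl.long_one hc hu)
        (nodup_of_count hnd fun a => by simp [List.count_cons] <;> omega) hch
    have hndf : ([v, u, a, b, d, e] ++ l).Nodup :=
      nodup_of_count hnd fun a => by simp [List.count_cons] <;> omega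
    have hndr : ([u, v, a, b, d, e] ++ l.reverse).Nodup :=
      nodup_of_count hnd fun a => by simp [List.count_cons] <;> omega
    have hndfr : ([v, u, a, b, d, e] ++ l.reverse).Nodup :=
      nodup_of_count hnd fun a => by simp [List.count_cons] <;> omega
    have hnewr : l.reverse = [] → s(y, x) ∉ K24Edges u v a b d e := fun hl => by
      rw [Sym2.eq_swap]; exact hnew (by simpa using hl)
    rcases hsplit hx with rfl | rfl | hx'
    · rcases hsplit hy with rfl | rfl | hy'
      · exact hxy rfl
      · exact hends hl hnd
      · exact hend h hl hnd hnew rfl hy'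
    · rcases hsplit hy with rfl | rfl | hy'
      · exact hends hl.symm hndr
      · exact hxy rfl
      · exact hend h.flip hl hndf (fun h h' => hnew h (hflip h')) rfl hy'
    · rcases hsplit hy with rfl | rfl | hy'
      · exact hend h hl.symm hndr hnewr rfl hx'
      · exact hend h.flip hl.symm hndfr (fun h h' => hnewr h (hflip h')) rfl hx'
      · obtain ⟨d', e', hp⟩ := exists_perm_of_mem_of_mem hx' hy' hxy
        have h' := h.perm hp
        have hadj := h'.adj
        have hnd' := (((hp.cons v).cons u).append_right l).nodup_iff.2 hnd
        -- The vertex `v` is linked to `y` directly and by way of `x` and the ear, and to `u` by way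
        -- of `d'` and `e'`; the edge from `y` to `u` closes the triangle.
        refine not_choosable_two_double_links hc (u := v) (v := y) (x := u) (l₁ := [])
          (l₂ := x :: l) (l₃ := [d']) (l₄ := [e']) (l₅ := []) (link_nil.2 (hadj y (by simp)).2.symm)
          (link_cons.2 ⟨(hadj x (by simp)).2.symm, hl⟩) (link_cons.2 ⟨(hadj d' (by simp)).2.symm,
            link_nil.2 (hadj d' (by simp)).1.symm⟩) (link_cons.2 ⟨(hadj e' (by simp)).2.symm,
            link_nil.2 (hadj e' (by simp)).1.symm⟩) (link_nil.2 (hadj y (by simp)).1.symm)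
          (nodup_of_count hnd' fun a => by simp [List.count_cons] <;> omega) (by simp) (by simp) hch
  · rcases hsplit hx with rfl | rfl | hx
    · exact not_choosable_of_gad4_lolli hc (gad4_K24_end h.th h.link hc) hq hnd hch
    · exact not_choosable_of_gad4_lolli hc (gad4_K24_end h.flip.th h.flip.link hc) hq
        (nodup_of_count hnd fun a => by simp [List.count_cons] <;> omega) hch
    · obtain ⟨b', d', e', hp⟩ := exists_perm_of_mem hx
      have hp' : [b', d', e', x].Perm [a, b, d, e] :=
        (List.perm_append_comm (l₁ := [b', d', e']) (l₂ := [x])).trans hp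
      have h' := h.perm hp'
      have hnd' := (((hp'.cons v).cons u).append_right q).nodup_iff.2 hnd
      exact not_choosable_of_gad4_lolli hc (gad4_K24_mid h'.th h'.link hc) hq
        (nodup_of_count hnd' fun a => by simp [List.count_cons] <;> omega) hch

variable {a₁ a₂ b₁ b₂ b₀ : V} {d : List V}

/-- The edges of `K33eLayout`. -/
def K33eEdges (a₁ a₂ b₁ b₂ b₀ : V) (d : List V) : List (Sym2 V) :=
  [s(a₁, b₁), s(a₁, b₂), s(a₂, b₁), s(a₂, b₂), s(a₁, b₀), s(a₂, b₀)] ++ linkEdges b₁ d b₂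

theorem K33eLayout.flip (h : K33eLayout G a₁ a₂ b₁ b₂ b₀ d) :
    K33eLayout G a₁ a₂ b₂ b₁ b₀ d.reverse := by
  classical
  exact ⟨h.h₁₂, h.h₁₁, h.h₂₂, h.h₂₁, h.h₁₀, h.h₂₀, h.link.symm,
    nodup_of_count h.nd fun a => by simp [List.count_cons] <;> omega⟩

theorem mem_K33eEdges_flip {e : Sym2 V} :
    e ∈ K33eEdges a₁ a₂ b₂ b₁ b₀ d.reverse ↔ e ∈ K33eEdges a₁ a₂ b₁ b₂ b₀ d := by
  simp only [K33eEdges, List.mem_append, mem_linkEdges_reverse, List.mem_cons, List.not_mem_nil,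
    or_false]
  tauto

/-- Deleting the edge `a₁b₁` leaves a theta graph. -/
theorem K33eLayout.theta (h : K33eLayout G a₁ a₂ b₁ b₂ b₀ d) :
    Theta G a₂ b₂ [] [b₀, a₁] (b₁ :: d) := by
  classical
  exact ⟨link_nil.2 h.h₂₂, link_cons.2 ⟨h.h₂₀, link_cons.2 ⟨h.h₁₀.symm, link_nil.2 h.h₁₂⟩⟩,
    link_cons.2 ⟨h.h₂₁, h.link⟩, nodup_of_count h.nd fun a => by
      simp [List.count_cons] <;> omega, by simp, by simp, by simp⟩

/-- Without the edge `a₁b₁` the layout is a theta graph, whose ears are known. An ear turns out to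
be a single edge: either `a₁b₁`, which is not new, or the edge from `b₀` to the last vertex of `d`.
-/
theorem K33eLayout.exists_of_ear (h : K33eLayout G a₁ a₂ b₁ b₂ b₀ d) (hc : IsBicoloring G c)
    (hch : Choosable G 4 2) {x y : V} {l : List V} (hxy : x ≠ y) (hl : Link G x l y)
    (hx : x ∈ a₁ :: a₂ :: b₁ :: b₂ :: b₀ :: d) (hy : y ∈ a₁ :: a₂ :: b₁ :: b₂ :: b₀ :: d)
    (hnd : (a₁ :: a₂ :: b₁ :: b₂ :: b₀ :: d ++ l).Nodup)
    (hnew : l = [] → s(x, y) ∉ K33eEdges a₁ a₂ b₁ b₂ b₀ d) :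
    ∃ d' w, d = d' ++ [w] ∧ G.Adj b₀ w ∧ s(x, y) = s(b₀, w) := by
  classical
  have hd : d ≠ [] := by
    have hb : c b₁ = c b₂ := by
      have h1 := hc _ _ h.h₁₁
      have h2 := hc _ _ h.h₁₂
      revert h1 h2
      cases c a₁ <;> cases c b₁ <;> cases c b₂ <;> simp
    have := (h.link.parity hc).1 hb
    rintro rfl
    simp at this
  have hE : ThetaEar G a₂ b₂ [] [b₀, a₁] (b₁ :: d) x y l := by
    refine ⟨h.theta, hl, nodup_of_count hnd fun a => by simp [List.count_cons] <;> omega, ?_⟩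
    intro hl hmem
    refine hnew hl ?_
    simp only [thetaEdges, linkEdges, ledges, K33eEdges, List.mem_cons, List.nil_append, List.cons_append,
      Sym2.eq_swap (a := b₀) (b := a₁)] at hmem ⊢
    tauto
  rcases hE.cases hc hch hxy (by simp at hx ⊢; tauto) (by simp at hy ⊢; tauto) with
    ⟨h1, -⟩ | ⟨m₁, m₂, m₃, x', y', l', h', hp, hxy', hx', hy'⟩
  · simp at h1
  have key : ∀ {x' y' : V} {l' : List V}, ThetaEar G a₂ b₂ [b₀, a₁] (b₁ :: d) [] x' y' l' →
      x' ∈ [b₀, a₁] → y' ∈ b₁ :: d →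
      (l' = [] ∧ x' = a₁ ∧ y' = b₁) ∨ ∃ d' w, d = d' ++ [w] ∧ G.Adj b₀ w ∧ x' = b₀ ∧ y' = w := by
    intro x' y' l' h' hx' hy'
    obtain ⟨s, t, hst⟩ := List.append_of_mem hx'
    obtain ⟨s', t', hst'⟩ := List.append_of_mem hy'
    have h0 := h'
    rw [hst, hst'] at h0
    -- One of the three four-cycles of this subdivided K₄ is not subdivided. The first would leave a
    -- single vertex inside the path through `b₀` and `a₁`; the second makes the ear the edge
    -- `a₁b₁`, the third an edge from `b₀` to the end of `d`.
    rcases (h0.th.K4Layout_of_ear h0.link h0.nd).classify hc hch with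
      ⟨rfl, -, ht, -⟩ | ⟨-, rfl, ht, rfl, -⟩ | ⟨-, rfl, ht', rfl, -⟩
    · rw [List.reverse_eq_nil_iff.1 ht] at hst
      simp at hst
    · left
      rw [List.reverse_eq_nil_iff.1 ht] at hst
      have h1 : x' = a₁ := by
        have := congrArg List.getLast? hst
        simpa [eq_comm] using this
      simp only [List.nil_append, List.cons.injEq] at hst'
      exact ⟨rfl, h1, hst'.1.symm⟩
    · right
      rw [List.reverse_eq_nil_iff.1 ht'] at hst'
      simp only [List.nil_append, List.cons.injEq] at hst
      obtain ⟨rfl, -⟩ := hst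
      have hlast := congrArg List.getLast? hst'
      refine ⟨d.dropLast, d.getLast hd, (List.dropLast_append_getLast hd).symm, ?_, rfl, ?_⟩
      · have : y' = d.getLast hd := by
          rw [List.getLast?_concat, List.getLast?_eq_getLast_of_ne_nil (by simp)] at hlast
          rw [List.getLast_cons hd] at hlast
          exact (Option.some.inj hlast).symm
        rw [← this]
        exact link_nil.1 h'.link
      · rw [List.getLast?_concat, List.getLast?_eq_getLast_of_ne_nil (by simp)] at hlast
        rw [List.getLast_cons hd] at hlast
        exact (Option.some.inj hlast).symm
  have hm : (m₁ = [b₀, a₁] ∧ m₂ = b₁ :: d ∧ m₃ = []) ∨ (m₁ = b₁ :: d ∧ m₂ = [b₀, a₁] ∧ m₃ = []) := by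
    have h1 : m₁ ≠ [] := List.ne_nil_of_mem hx'
    have h2 : m₂ ≠ [] := List.ne_nil_of_mem hy'
    have h3 : m₃ = [] := by
      have : [] ∈ [m₁, m₂, m₃] := hp.mem_iff.2 (by simp)
      simp only [List.mem_cons, List.not_mem_nil, or_false] at this
      rcases this with h | h | h
      exacts [absurd h.symm h1, absurd h.symm h2, h.symm]
    subst h3
    have hp' : [m₁, m₂].Perm [[b₀, a₁], b₁ :: d] := by
      have : ([] :: [m₁, m₂]).Perm ([] :: [[b₀, a₁], b₁ :: d]) :=
        (List.perm_append_comm (l₁ := [[]]) (l₂ := [m₁, m₂])).trans hp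
      exact this.cons_inv
    have h5 := hp'.mem_iff (a := m₁)
    simp only [List.mem_cons, List.not_mem_nil, or_false, true_or, true_iff] at h5
    rcases h5 with rfl | rfl
    · exact Or.inl ⟨rfl, by simpa using hp'.cons_inv, rfl⟩
    · have : [b₁ :: d, m₂].Perm [b₁ :: d, [b₀, a₁]] := hp'.trans (List.Perm.swap _ _ _)
      exact Or.inr ⟨rfl, by simpa using this.cons_inv, rfl⟩
  have hab : l = [] → s(x, y) ≠ s(a₁, b₁) := fun hl h => hnew hl (h ▸ by simp [K33eEdges])
  rcases hm with ⟨rfl, rfl, rfl⟩ | ⟨rfl, rfl, rfl⟩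
  · rcases key h' hx' hy' with ⟨hl', rfl, rfl⟩ | ⟨d', w, h1, h2, rfl, rfl⟩
    · rcases hxy' with ⟨rfl, rfl, rfl⟩ | ⟨rfl, rfl, rfl⟩
      · exact absurd rfl (hab hl')
      · exact absurd Sym2.eq_swap (hab (by simpa using hl'))
    · refine ⟨d', y', h1, h2, ?_⟩
      rcases hxy' with ⟨rfl, rfl, rfl⟩ | ⟨rfl, rfl, rfl⟩
      exacts [rfl, Sym2.eq_swap]
  · rcases key h'.rev.swap hy' hx' with ⟨hl', rfl, rfl⟩ | ⟨d', w, h1, h2, rfl, rfl⟩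
    · rcases hxy' with ⟨rfl, rfl, rfl⟩ | ⟨rfl, rfl, rfl⟩
      · exact absurd Sym2.eq_swap (hab (by simpa using hl'))
      · exact absurd rfl (hab (by simpa using hl'))
    · refine ⟨d', x', h1, h2, ?_⟩
      rcases hxy' with ⟨rfl, rfl, rfl⟩ | ⟨rfl, rfl, rfl⟩
      exacts [Sym2.eq_swap, rfl]

/-- An ear is an edge from `b₀` to the last vertex of `d`, and by the symmetry interchanging `b₁`
and `b₂` also to the first. So `d` has one vertex, and K_{3,3} appears. A lollipop is impossible
because the theta graph inside the layout is not K_{2,3} and hence gives a `Gad4`. -/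
theorem K33eLayout.spanning [Finite V] {S : Set V} (hS : Linked G S) (hdeg : MinDegTwo G S)
    (hc : IsBicoloring G c) (hch : Choosable G 4 2) (h : K33eLayout G a₁ a₂ b₁ b₂ b₀ d)
    (hsub : ∀ x ∈ a₁ :: a₂ :: b₁ :: b₂ :: b₀ :: d, x ∈ S) :
    ∀ x ∈ S, ∀ y ∈ S, G.Adj x y → s(x, y) ∈ K33eEdges a₁ a₂ b₁ b₂ b₀ d := by
  classical
  by_contra hcon
  rcases exists_ear hS hdeg h.nd hsub (by simp) (D := K33eEdges a₁ a₂ b₁ b₂ b₀ d)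
    (fun x y hxy => by
      rw [K33eEdges, List.mem_append] at hxy
      rcases hxy with hxy | hxy
      · simp only [List.mem_cons, List.not_mem_nil, or_false, Sym2.eq_iff] at hxy ⊢
        tauto
      · have := mem_of_mem_linkEdges hxy
        simp only [List.mem_cons] at this ⊢
        tauto) hcon with
    ⟨x, hx, y, hy, l, hxy, hl, hnd, -, hnew⟩ | ⟨x, hx, q, hq, hnd, -⟩
  · obtain ⟨d', w, h1, h2, h3⟩ := h.exists_of_ear hc hch hxy hl hx hy hnd hnew
    obtain ⟨d'', w', h1', h2', h3'⟩ := h.flip.exists_of_ear hc hch hxy hl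
      (by simp at hx ⊢; tauto) (by simp at hy ⊢; tauto)
      (nodup_of_count hnd fun a => by simp [List.count_cons] <;> omega)
      (fun h => by rw [mem_K33eEdges_flip]; exact hnew h)
    have hww : w = w' := Sym2.congr_right.1 (h3.symm.trans h3')
    have hd : d = [w] := by
      have h4 : d = w' :: d''.reverse := by
        rw [← List.reverse_inj, h1']; simp
      have hndd : d.Nodup := h.nd.sublist (List.sublist_append_right [a₁, a₂, b₁, b₂, b₀] d)
      cases d' with
      | nil => simpa using h1
      | cons z d' =>
        rw [h1] at h4 hndd
        simp only [List.cons_append, List.cons.injEq] at h4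
        simp [h4.1, hww] at hndd
    subst hd
    have hlk := link_cons.1 h.link
    refine not_choosable_of_K33 (a₁ := a₁) (a₂ := a₂) (a₃ := w) (b₁ := b₁) (b₂ := b₂) (b₃ := b₀)
      (nodup_of_count h.nd fun a => by simp [List.count_cons] <;> omega) ?_ hch
    simp only [List.forall_mem_cons, List.not_mem_nil, false_imp_iff, implies_true, and_true]
    exact ⟨⟨h.h₁₁, h.h₁₂, h.h₁₀⟩, ⟨h.h₂₁, h.h₂₂, h.h₂₀⟩, hlk.1.symm, link_nil.1 hlk.2, h2.symm⟩
  · have hx' : x ∈ a₂ :: b₂ :: ([] ++ [b₀, a₁] ++ (b₁ :: d)) := by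
      simp only [List.mem_cons, List.nil_append, List.cons_append] at hx ⊢
      tauto
    obtain ⟨l, hp, hg | hg⟩ := h.theta.gad hc hx'
    · refine not_choosable_of_gad4_lolli hc hg hq ?_ hch
      rw [← List.cons_append]
      refine ((hp.append_right q).nodup_iff).2 ?_
      exact nodup_of_count hnd fun a => by simp [List.count_cons] <;> omega
    · simp at hg

end Spanning

/-! ### Ears of lollipops -/

section Lollipops

variable {x y z p r x₀ : V} {l m q t t' c : List V} {col : V → Bool}

theorem mem_of_count [DecidableEq V] {l l' : List V} (h : ∀ a, l.count a ≤ l'.count a) :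
    ∀ a ∈ l, a ∈ l' :=
  fun a ha => List.count_pos_iff.1 ((List.count_pos_iff.2 ha).trans_le (h a))

theorem Arm.append (h : Arm G x t y) (h' : Arm G y t' z) : Arm G x (t ++ t') z := by
  induction t generalizing x with
  | nil => exact (show x = y from h) ▸ h'
  | cons w t ih => exact ⟨h.1, ih h.2⟩

theorem Link.arm (h : Link G x l y) : Arm G x (l ++ [y]) y := by
  induction l generalizing x with
  | nil => exact ⟨link_nil.1 h, rfl⟩
  | cons w l ih => exact ⟨(link_cons.1 h).1, ih (link_cons.1 h).2⟩

theorem Arm.exists_link (h : Arm G x t y) (ht : t ≠ []) : ∃ l, t = l ++ [y] ∧ Link G x l y := by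
  induction t generalizing x with
  | nil => exact absurd rfl ht
  | cons w t ih =>
    cases t with
    | nil =>
      obtain ⟨h1, rfl⟩ : G.Adj x w ∧ w = y := h
      exact ⟨[], rfl, link_nil.2 h1⟩
    | cons w' t =>
      obtain ⟨l, hl, hl'⟩ := ih h.2 (by simp)
      exact ⟨w :: l, by rw [hl]; rfl, link_cons.2 ⟨h.1, hl'⟩⟩

theorem Arm.exists_link_of_ne (h : Arm G x t y) (hxy : x ≠ y) :
    ∃ l, t = l ++ [y] ∧ Link G x l y := by
  refine h.exists_link ?_
  rintro rfl
  exact hxy h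

theorem Arm.isChain (h : Arm G x t y) : List.IsChain G.Adj (x :: t) := by
  induction t generalizing x with
  | nil => simp
  | cons w t ih => exact List.isChain_cons_cons.2 ⟨h.1, ih h.2⟩

theorem Arm.split (h : Arm G x t z) (hy : y ∈ x :: t) :
    ∃ t₁ t₂, t = t₁ ++ t₂ ∧ Arm G x t₁ y ∧ Arm G y t₂ z := by
  induction t generalizing x with
  | nil =>
    rw [List.mem_singleton] at hy
    exact ⟨[], [], rfl, hy.symm, hy ▸ h⟩
  | cons w t ih =>
    rcases List.mem_cons.1 hy with rfl | hy
    · exact ⟨[], w :: t, rfl, rfl, h⟩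
    · obtain ⟨t₁, t₂, rfl, h₁, h₂⟩ := ih h.2 hy
      exact ⟨w :: t₁, t₂, rfl, ⟨h.1, h₁⟩, h₂⟩

theorem Arm.end_mem (h : Arm G x t y) : y ∈ x :: t := by
  induction t generalizing x with
  | nil => exact List.mem_singleton.2 (Eq.symm h)
  | cons w t ih => exact List.mem_cons_of_mem _ (ih h.2)

theorem Arm.exists_reverse (h : Arm G x t y) : ∃ t', Arm G y t' x ∧ (y :: t').Perm (x :: t) ∧
    ∀ e, e ∈ ledges (y :: t') ↔ e ∈ ledges (x :: t) := by
  by_cases ht : t = []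
  · subst ht
    obtain rfl : x = y := h
    exact ⟨[], rfl, List.Perm.refl _, fun _ => Iff.rfl⟩
  · obtain ⟨l, rfl, hl⟩ := h.exists_link ht
    have h1 : y :: (l.reverse ++ [x]) = (x :: (l ++ [y])).reverse := by simp
    refine ⟨l.reverse ++ [x], hl.symm.arm, ?_, fun e => ?_⟩
    · rw [h1]
      exact List.reverse_perm _
    · rw [h1, mem_ledges_reverse]

/-- A path from `x` to `z` (with vertices `t` after `x`) and a cycle through `z` with further
vertices `c`. -/
structure IsLolli (G : SimpleGraph V) (x : V) (t : List V) (z : V) (c : List V) : Prop where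
  arm : Arm G x t z
  link : Link G z c z
  two : 2 ≤ c.length

theorem IsLolli.lolli (h : IsLolli G x t z c) : Lolli G x (t ++ c) := by
  by_cases ht : t = []
  · subst ht
    obtain rfl : x = z := h.arm
    exact ⟨[], x, c, rfl, h.link, h.two⟩
  · obtain ⟨l, rfl, hl⟩ := h.arm.exists_link ht
    refine ⟨x :: l, z, c, by simp, ?_, h.two⟩
    have : Link G x (l ++ z :: c) z := link_append.2 ⟨hl, h.link⟩
    simpa [Link] using this

theorem Lolli.exists_isLolli (h : Lolli G x q) : ∃ t z c, q = t ++ c ∧ IsLolli G x t z c := by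
  obtain ⟨q₁, z, q₂, h1, h2, h3⟩ := h
  cases q₁ with
  | nil =>
    simp only [List.nil_append, List.cons.injEq] at h1
    obtain ⟨rfl, rfl⟩ := h1
    exact ⟨[], x, q, rfl, rfl, h2, h3⟩
  | cons w l =>
    simp only [List.cons_append, List.cons.injEq] at h1
    obtain ⟨rfl, rfl⟩ := h1
    have : Link G x (l ++ z :: q₂) z := by simpa [Link] using h2
    rw [link_append] at this
    exact ⟨l ++ [z], z, q₂, by simp, this.1.arm, this.2, h3⟩

theorem IsLolli.isChain (h : IsLolli G x t z c) : List.IsChain G.Adj (x :: (t ++ c)) := by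
  have hc : Arm G z (c ++ [z]) z := h.link.arm
  have := (h.arm.append hc).isChain
  rw [← List.append_assoc, ← List.cons_append] at this
  exact this.left_of_append

/-- The path in a lollipop from its root to another vertex. -/
theorem IsLolli.exists_arm (h : IsLolli G x t z c) (hy : y ∈ x :: (t ++ c)) :
    ∃ s, Arm G x s y ∧ s.Sublist (t ++ c) := by
  have hc : Arm G z (c ++ [z]) z := h.link.arm
  have ha := h.arm.append hc
  rw [← List.cons_append, List.mem_append] at hy
  rcases hy with hy | hy
  · obtain ⟨t₁, t₂, rfl, h₁, -⟩ := h.arm.split hy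
    exact ⟨t₁, h₁, by simp⟩
  · obtain ⟨a, b, rfl⟩ := List.append_of_mem hy
    have h1 := (link_append.1 h.link).1.arm
    refine ⟨t ++ (a ++ [y]), h.arm.append h1, ?_⟩
    simp

/-- The edges of a lollipop. -/
def lolliEdges (x : V) (t : List V) (z : V) (c : List V) : List (Sym2 V) :=
  ledges (x :: t) ++ linkEdges z c z

theorem IsLolli.mem_of_mem_lolliEdges (h : IsLolli G x₀ t z c) (hxy : s(x, y) ∈ lolliEdges x₀ t z c) :
    x ∈ x₀ :: (t ++ c) ∧ y ∈ x₀ :: (t ++ c) := by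
  rw [lolliEdges, List.mem_append] at hxy
  have hz := h.arm.end_mem
  rcases hxy with hxy | hxy
  · have := mem_of_mem_ledges hxy
    simp only [List.mem_cons, List.mem_append] at this ⊢
    tauto
  · have := mem_of_mem_linkEdges hxy
    simp only [List.mem_cons, List.mem_append] at this hz ⊢
    constructor
    · rcases this.1 with h | h | h
      all_goals first | (subst h; tauto) | tauto
    · rcases this.2 with h | h | h
      all_goals first | (subst h; tauto) | tauto

/-- A path from `x` to a vertex of a theta graph. -/
def ThetaArm (G : SimpleGraph V) (x : V) (Z : List V) : Prop :=
  ∃ s r u v l₁ l₂ l₃, Arm G x s r ∧ Theta G u v l₁ l₂ l₃ ∧ r ∈ u :: v :: (l₁ ++ l₂ ++ l₃) ∧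
    (x :: s).Nodup ∧ (∀ w ∈ x :: s, w ∈ u :: v :: (l₁ ++ l₂ ++ l₃) → w = r) ∧
    (∀ w ∈ s, w ∈ Z) ∧ ∀ w ∈ u :: v :: (l₁ ++ l₂ ++ l₃), w ∈ x :: Z

/-- A path from `x` to a vertex of a cycle that has a lollipop at another vertex. -/
def CycleArm (G : SimpleGraph V) (x : V) (Z : List V) : Prop :=
  ∃ s p p' m m' q, Arm G x s p ∧ Link G p m p' ∧ Link G p m' p' ∧ (m ≠ [] ∨ m' ≠ []) ∧
    Lolli G p' q ∧ (x :: (s ++ p' :: (m ++ m' ++ q))).Nodup ∧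
    ∀ w ∈ s ++ p' :: (m ++ m' ++ q), w ∈ Z

theorem ThetaArm.gad3 {Z : List V} (h : ThetaArm G x Z) (hc : IsBicoloring G col) :
    Gad3 G x Z := by
  obtain ⟨s, r, u, v, l₁, l₂, l₃, ha, hth, hr, hnd, hdis, hs, hZ⟩ := h
  obtain ⟨l, hp, hg⟩ := hth.gad hc hr
  have hg3 : Gad3 G r l := hg.elim Gad4.gad3 And.right
  have hnd' := hp.nodup_iff.2 hth.nd
  rw [List.nodup_cons] at hnd hnd'
  refine (hg3.arm ha).subset ?_ ?_
  · rw [List.nodup_append']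
    refine ⟨hnd.2, hnd'.2, fun w hw hw' => ?_⟩
    have := hdis w (List.mem_cons_of_mem _ hw) (hp.mem_iff.1 (List.mem_cons_of_mem _ hw'))
    exact hnd'.1 (this ▸ hw')
  · intro w hw
    rcases List.mem_append.1 hw with hw | hw
    · exact hs w hw
    · have hwv := hp.mem_iff.1 (List.mem_cons_of_mem _ hw)
      rcases List.mem_cons.1 (hZ w hwv) with rfl | h
      · have := hdis w (by simp) hwv
        exact absurd (this ▸ hw) hnd'.1
      · exact h

theorem CycleArm.gad3 {Z : List V} (h : CycleArm G x Z) (hc : IsBicoloring G col) :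
    Gad3 G x Z := by
  classical
  obtain ⟨s, p, p', m, m', q, ha, h1, h2, hne, hq, hnd, hZ⟩ := h
  have hnd' : (p :: p' :: (m ++ m' ++ q)).Nodup := by
    by_cases hs : s = []
    · subst hs
      obtain rfl : x = p := ha
      exact hnd
    · obtain ⟨l, rfl, -⟩ := ha.exists_link hs
      exact nodup_of_count hnd fun a => by simp [List.count_cons] <;> omega
  have hg : Gad3 G p (p' :: (m ++ m' ++ q)) :=
    (gad_cycle_lolli hc h1 h2 hne hq hnd').elim Gad4.gad3 And.right
  exact (hg.arm ha).subset (List.nodup_cons.1 hnd).2 hZ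

-- If both ends of the ear lie on the arm, the ear and a stretch of the arm form a cycle, with the
-- rest of the lollipop hanging at the far end of that stretch. Otherwise the cycle and the ear,
-- together with a stretch of the arm if the ear starts before `z`, form a theta graph, and the
-- remaining arm leads to it.
set_option maxHeartbeats 800000 in
theorem IsLolli.arm_of_ear (h : IsLolli G x₀ t z c) (hxy : x ≠ y) (hl : Link G x l y)
    (hx : x ∈ x₀ :: (t ++ c)) (hy : y ∈ x₀ :: (t ++ c)) (hnd : (x₀ :: (t ++ c) ++ l).Nodup)
    (hnew : l = [] → s(x, y) ∉ lolliEdges x₀ t z c) :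
    ThetaArm G x₀ (t ++ c ++ l) ∨ CycleArm G x₀ (t ++ c ++ l) := by
  classical
  -- Up to reversing the ear, `x` comes before `y`.
  wlog hord : (x ∈ x₀ :: t ∧ y ∈ x₀ :: t ∧ ∃ t₁ t₂ t₃, t = t₁ ++ (t₂ ++ t₃) ∧ Arm G x₀ t₁ x ∧
      Arm G x t₂ y ∧ Arm G y t₃ z) ∨ (x ∈ x₀ :: t ∧ y ∈ c) ∨
      ∃ a m b, c = a ++ x :: (m ++ y :: b) with hw
  · have hndr : (x₀ :: (t ++ c) ++ l.reverse).Nodup :=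
      nodup_of_count hnd fun a => by simp [List.count_cons] <;> omega
    have key := hw (x := y) (y := x) (l := l.reverse) h hxy.symm hl.symm hy hx hndr
      (fun h => by rw [Sym2.eq_swap]; exact hnew (by simpa using h))
    have hres : ThetaArm G x₀ (t ++ c ++ l.reverse) ∨ CycleArm G x₀ (t ++ c ++ l.reverse) := by
      apply key
      rw [← List.cons_append, List.mem_append] at hx hy
      have h2 : ∀ {x y : V}, x ∈ c → y ∈ c → x ≠ y → (∃ a m b, c = a ++ x :: (m ++ y :: b)) ∨
          ∃ a m b, c = a ++ y :: (m ++ x :: b) := by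
        intro x y hx hy hxy
        obtain ⟨a, b, rfl⟩ := List.append_of_mem hx
        rw [List.mem_append, List.mem_cons] at hy
        rcases hy with hy | rfl | hy
        · obtain ⟨a, b', rfl⟩ := List.append_of_mem hy
          exact Or.inr ⟨a, b', b, by simp⟩
        · exact absurd rfl hxy
        · obtain ⟨m, b', rfl⟩ := List.append_of_mem hy
          exact Or.inl ⟨a, m, b', rfl⟩
      rcases hx with hx | hx <;> rcases hy with hy | hy
      · left
        refine ⟨hy, hx, ?_⟩
        obtain ⟨t₁, t₂, ht, h₁, h₂⟩ := h.arm.split hx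
        have hy' : y ∈ x :: t₂ ∨ y ∈ x₀ :: t₁ := by
          rw [ht] at hy
          simp only [List.mem_cons, List.mem_append] at hy ⊢
          tauto
        rcases hy' with hy' | hy'
        · obtain ⟨t₃, t₄, rfl, h₃, h₄⟩ := h₂.split hy'
          exact absurd (Or.inl ⟨hx, hy, t₁, t₃, t₄, ht, h₁, h₃, h₄⟩) hord
        · obtain ⟨t₃, t₄, rfl, h₃, h₄⟩ := h₁.split hy'
          exact ⟨t₃, t₄, t₂, by rw [ht, List.append_assoc], h₃, h₄, h₂⟩
      · exact absurd (Or.inr (Or.inl ⟨hx, hy⟩)) hord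
      · exact Or.inr (Or.inl ⟨hy, hx⟩)
      · rcases h2 hx hy hxy with h | h
        · exact absurd (Or.inr (Or.inr h)) hord
        · exact Or.inr (Or.inr h)
    have hmem : ∀ w, w ∈ t ++ c ++ l.reverse ↔ w ∈ t ++ c ++ l := by simp
    unfold ThetaArm CycleArm at hres ⊢
    simpa only [List.mem_cons, hmem] using hres
  rcases hord with ⟨-, -, t₁, t₂, t₃, rfl, h₁, h₂, h₃⟩ | ⟨hx', hy'⟩ | ⟨a, m, b, rfl⟩
  · right
    obtain ⟨m, rfl, hm⟩ := h₂.exists_link_of_ne hxy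
    refine ⟨t₁, x, y, m, l, t₃ ++ c, h₁, hm, hl, ?_, (IsLolli.mk h₃ h.link h.two).lolli,
      nodup_of_count hnd fun a => by simp [List.count_cons] <;> omega, mem_of_count fun a => by simp [List.count_cons] <;> omega⟩
    by_contra! hcon
    obtain ⟨rfl, rfl⟩ := hcon
    refine hnew rfl (List.mem_append_left _ ?_)
    by_cases ht : t₁ = []
    · subst ht
      obtain rfl : x₀ = x := h₁
      simp [ledges]
    · obtain ⟨l', rfl, -⟩ := h₁.exists_link ht
      have := ledges_append (x₀ :: l') x (y :: t₃)
      simp only [List.cons_append] at this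
      simp [this, ledges]
  · left
    clear hx hy
    obtain ⟨a, b, rfl⟩ := List.append_of_mem hy'
    obtain ⟨ha, hb⟩ := link_append.1 h.link
    obtain ⟨t₁, t₂, rfl, h₁, h₂⟩ := h.arm.split hx'
    have hab : a ≠ [] ∨ b ≠ [] := by
      by_contra! hcon
      obtain ⟨rfl, rfl⟩ := hcon
      have := h.two
      simp at this
    by_cases hxz : x = z
    · subst hxz
      have ht₂ : t₂ = [] := by
        by_contra ht
        obtain ⟨l', rfl, -⟩ := h₂.exists_link ht
        have hx := h₁.end_mem
        have : (x₀ :: t₁ ++ [x]).Nodup :=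
          nodup_of_count hnd fun a => by simp [List.count_cons] <;> omega
        exact List.disjoint_of_nodup_append this hx (by simp)
      subst ht₂
      refine ⟨t₁, x, x, y, a, b.reverse, l, h₁, ⟨ha, hb.symm, hl, ?_, by simpa using hab, ?_, ?_⟩,
        by simp, nodup_of_count hnd fun a => by simp [List.count_cons] <;> omega, ?_, mem_of_count fun a => by simp [List.count_cons] <;> omega, ?_⟩
      · have hx := h₁.end_mem
        refine List.nodup_cons.2 ⟨fun hx' => ?_,
          nodup_of_count hnd fun a => by simp [List.count_cons] <;> omega⟩
        have : (x₀ :: t₁ ++ (y :: (a ++ b.reverse ++ l))).Nodup :=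
          nodup_of_count hnd fun a => by simp [List.count_cons] <;> omega
        exact List.disjoint_of_nodup_append this hx hx'
      · by_contra! hcon
        obtain ⟨rfl, rfl⟩ := hcon
        exact hnew rfl (List.mem_append_right _ (by simp [linkEdges, ledges]))
      · by_contra! hcon
        obtain ⟨hb, rfl⟩ := hcon
        rw [List.reverse_eq_nil_iff] at hb
        subst hb
        refine hnew rfl (List.mem_append_right _ ?_)
        rw [linkEdges_append, List.mem_append]
        exact Or.inr (by simp [Sym2.eq_swap])
      · intro w hw hw'
        rcases List.mem_cons.1 hw' with rfl | hw'
        · rfl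
        have : (x₀ :: t₁ ++ (y :: (a ++ b.reverse ++ l))).Nodup :=
          nodup_of_count hnd fun a => by simp [List.count_cons] <;> omega
        exact absurd hw' (List.disjoint_of_nodup_append this hw)
      · have hx := h₁.end_mem
        intro w hw
        simp only [List.mem_cons, List.mem_append, List.mem_reverse] at hx hw ⊢
        rcases hw with rfl | hw <;> tauto
    · obtain ⟨m, rfl, hm⟩ := h₂.exists_link_of_ne hxz
      have hx := h₁.end_mem
      have hnd' : (x₀ :: t₁ ++ (z :: y :: (a ++ b.reverse ++ (m.reverse ++ l)))).Nodup :=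
        nodup_of_count hnd fun a => by simp [List.count_cons] <;> omega
      -- The branch vertices are `z` and `y`; the arm arrives at `x`, inside the third path, which
      -- runs back along the arm and then along the ear.
      refine ⟨t₁, x, z, y, a, b.reverse, m.reverse ++ x :: l, h₁, ⟨ha, hb.symm,
        link_append.2 ⟨hm.symm, hl⟩, ?_, by simpa using hab, by simp, by simp⟩,
        by simp, nodup_of_count hnd fun a => by simp [List.count_cons] <;> omega, ?_, mem_of_count fun a => by simp [List.count_cons] <;> omega, ?_⟩
      · have : (x :: (z :: y :: (a ++ b.reverse ++ (m.reverse ++ l)))).Nodup :=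
          List.nodup_cons.2 ⟨List.disjoint_of_nodup_append hnd' hx, hnd'.of_append_right⟩
        exact nodup_of_count this fun a => by simp [List.count_cons] <;> omega
      · intro w hw hw'
        by_contra hne
        refine List.disjoint_of_nodup_append hnd' hw ?_
        simp only [List.mem_cons, List.mem_append] at hw' ⊢
        tauto
      · intro w hw
        simp only [List.mem_cons, List.mem_append, List.mem_reverse, List.not_mem_nil] at hx hw ⊢
        rcases hw with rfl | rfl | hw | hw | rfl | hw <;> tauto
  · left
    obtain ⟨ha, hb⟩ := link_append.1 h.link
    obtain ⟨hm, hb⟩ := link_append.1 hb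
    have hz := h.arm.end_mem
    have hnd' : (x₀ :: t ++ (x :: y :: (m ++ l ++ (a.reverse ++ b.reverse)))).Nodup :=
      nodup_of_count hnd fun a => by simp [List.count_cons] <;> omega
    refine ⟨t, z, x, y, m, l, a.reverse ++ z :: b.reverse, h.arm,
      ⟨hm, hl, link_append.2 ⟨ha.symm, hb.symm⟩, ?_, ?_, by simp, by simp⟩, by simp,
      nodup_of_count hnd fun a => by simp [List.count_cons] <;> omega, ?_, mem_of_count fun a => by simp [List.count_cons] <;> omega, ?_⟩
    · have : (z :: (x :: y :: (m ++ l ++ (a.reverse ++ b.reverse)))).Nodup :=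
        List.nodup_cons.2 ⟨List.disjoint_of_nodup_append hnd' hz, hnd'.of_append_right⟩
      exact nodup_of_count this fun a => by simp [List.count_cons] <;> omega
    · by_contra! hcon
      obtain ⟨rfl, rfl⟩ := hcon
      refine hnew rfl (List.mem_append_right _ ?_)
      rw [linkEdges_append, List.nil_append, List.mem_append]
      exact Or.inr (by simp [linkEdges, ledges])
    · intro w hw hw'
      by_contra hne
      refine List.disjoint_of_nodup_append hnd' hw ?_
      simp only [List.mem_cons, List.mem_append] at hw' ⊢
      tauto
    · intro w hw
      simp only [List.mem_cons, List.mem_append, List.mem_reverse] at hz hw ⊢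
      rcases hw with rfl | rfl | (hw | hw) | hw | rfl | hw <;> tauto

/-- On the arm the new lollipop merely splits the arm at `y`. On the cycle away from `z` it turns
the cycle into one through `z` and `y` with a lollipop at `y`. -/
theorem IsLolli.arm_of_lolli {q : List V} (h : IsLolli G x₀ t z c) (hy : y ∈ x₀ :: (t ++ c))
    (hq : Lolli G y q) (hnd : (x₀ :: (t ++ c) ++ q).Nodup) :
    (∃ t₁ t₂, t = t₁ ++ t₂ ∧ Arm G x₀ t₁ y ∧ IsLolli G y t₂ z c) ∨ CycleArm G x₀ (t ++ c ++ q) := by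
  classical
  rw [← List.cons_append, List.mem_append] at hy
  rcases hy with hy | hy
  · obtain ⟨t₁, t₂, rfl, h₁, h₂⟩ := h.arm.split hy
    exact Or.inl ⟨t₁, t₂, rfl, h₁, h₂, h.link, h.two⟩
  · obtain ⟨a, b, rfl⟩ := List.append_of_mem hy
    obtain ⟨ha, hb⟩ := link_append.1 h.link
    refine Or.inr ⟨t, z, y, a, b.reverse, q, h.arm, ha, hb.symm, ?_, hq,
      nodup_of_count hnd fun a => by simp [List.count_cons] <;> omega, mem_of_count fun a => by simp [List.count_cons] <;> omega⟩
    by_contra! hcon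
    obtain ⟨rfl, hb⟩ := hcon
    have := h.two
    simp [List.reverse_eq_nil_iff.1 hb] at this

theorem IsLolli.gad3_of_ear (hc : IsBicoloring G col) (h : IsLolli G x₀ t z c) (hxy : x ≠ y)
    (hl : Link G x l y) (hx : x ∈ x₀ :: (t ++ c)) (hy : y ∈ x₀ :: (t ++ c))
    (hnd : (x₀ :: (t ++ c) ++ l).Nodup) (hnew : l = [] → s(x, y) ∉ lolliEdges x₀ t z c) :
    Gad3 G x₀ (t ++ c ++ l) :=
  (h.arm_of_ear hxy hl hx hy hnd hnew).elim (fun h => h.gad3 hc) fun h => h.gad3 hc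

/-- If `y` lies on the arm, two lollipops hang at `y`, and their common gadget is moved along the
arm to the root. -/
theorem IsLolli.gad3_of_lolli {q : List V} (hc : IsBicoloring G col) (h : IsLolli G x₀ t z c)
    (hy : y ∈ x₀ :: (t ++ c)) (hq : Lolli G y q) (hnd : (x₀ :: (t ++ c) ++ q).Nodup) :
    Gad3 G x₀ (t ++ c ++ q) := by
  rcases h.arm_of_lolli hy hq hnd with ⟨t₁, t₂, rfl, h₁, h₂⟩ | h'
  · have := (gad3_two_lollis hc h₂.lolli hq).arm h₁
    simpa using this
  · exact h'.gad3 hc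

end Lollipops

/-! ### The structure of cores -/

/-- `S` contains the vertices `X`, and all edges of `S` belong to `D`. -/
structure Spans (G : SimpleGraph V) (S : Set V) (X : List V) (D : List (Sym2 V)) : Prop where
  sub : ∀ x ∈ X, x ∈ S
  edges : ∀ x ∈ S, ∀ y ∈ S, G.Adj x y → s(x, y) ∈ D

section Structure

variable {S : Set V} {col : V → Bool} {x y z p p' r u v x₀ : V}
  {l l₁ l₂ l₃ m m' q q' t t' c c₀ : List V}

theorem exists_rotate (h : Link G z c z) (hx : x ∈ z :: c) : ∃ c', Link G x c' x ∧
    (x :: c').Perm (z :: c) ∧ ∀ e, e ∈ linkEdges x c' x ↔ e ∈ linkEdges z c z := by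
  rcases List.mem_cons.1 hx with rfl | hx
  · exact ⟨c, h, List.Perm.refl _, fun _ => Iff.rfl⟩
  · obtain ⟨a, b, rfl⟩ := List.append_of_mem hx
    obtain ⟨ha, hb⟩ := link_append.1 h
    refine ⟨b ++ z :: a, link_append.2 ⟨hb, ha⟩, ?_, fun e => ?_⟩
    · exact List.perm_append_comm (l₁ := x :: b) (l₂ := z :: a)
    · rw [linkEdges_append, linkEdges_append, List.mem_append, List.mem_append, or_comm]

theorem exists_link_pair (h : Link G z c z) (hx : x ∈ z :: c) (hy : y ∈ z :: c) (hxy : x ≠ y) :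
    ∃ m m', Link G x m y ∧ Link G x m' y ∧ (x :: y :: (m ++ m')).Perm (z :: c) ∧
      ∀ e, e ∈ linkEdges x m y ∨ e ∈ linkEdges x m' y ↔ e ∈ linkEdges z c z := by
  obtain ⟨c', hc', hp, he⟩ := exists_rotate h hx
  obtain ⟨a, b, rfl⟩ := List.append_of_mem
    ((List.mem_cons.1 (hp.mem_iff.2 hy)).resolve_left hxy.symm)
  obtain ⟨ha, hb⟩ := link_append.1 hc'
  refine ⟨a, b.reverse, ha, hb.symm, List.Perm.trans (List.Perm.cons x ?_) hp, fun e => ?_⟩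
  · exact (((List.reverse_perm b).append_left a).cons y).trans List.perm_middle.symm
  · rw [mem_linkEdges_reverse, ← he, linkEdges_append, List.mem_append]

/-- A cycle with a further path between two of its vertices is a theta graph. -/
theorem exists_theta_of_ear (h : Link G z c z) (h2 : 2 ≤ c.length) (hx : x ∈ z :: c)
    (hy : y ∈ z :: c) (hxy : x ≠ y) (hl : Link G x l y) (hnd : (z :: c ++ l).Nodup)
    (hnew : l = [] → s(x, y) ∉ linkEdges z c z) :
    ∃ l₁ l₂, Theta G x y l₁ l₂ l ∧ ∀ w ∈ x :: y :: (l₁ ++ l₂ ++ l), w ∈ z :: c ++ l := by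
  obtain ⟨m, m', hm, hm', hp, he⟩ := exists_link_pair h hx hy hxy
  have hp' := hp.append_right l
  refine ⟨m, m', ⟨hm, hm', hl, hp'.nodup_iff.2 hnd, ?_, ?_, ?_⟩, fun w hw => hp'.mem_iff.1 hw⟩
  · by_contra! hcon
    obtain ⟨rfl, rfl⟩ := hcon
    have := hp.length_eq
    simp at this
    omega
  · by_contra! hcon
    obtain ⟨rfl, rfl⟩ := hcon
    exact hnew rfl ((he _).1 (Or.inl (by simp)))
  · by_contra! hcon
    obtain ⟨rfl, rfl⟩ := hcon
    exact hnew rfl ((he _).1 (Or.inr (by simp)))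

/-- A path starting in a lollipop can be extended back to the root. -/
theorem IsLolli.exists_link (h : IsLolli G r t z c) (hx : x ∈ r :: (t ++ c)) (hl : Link G x l y)
    (hnd : (r :: (t ++ c)).Nodup) :
    ∃ l', Link G r l' y ∧ (l' = [] → l = [] ∧ x = r) ∧ l'.Sublist (t ++ c ++ l) := by
  by_cases hxr : x = r
  · subst hxr
    exact ⟨l, hl, fun h => ⟨h, rfl⟩, by simp⟩
  · obtain ⟨s, hs, hsub⟩ := h.exists_arm hx
    obtain ⟨m, rfl, hm⟩ := hs.exists_link_of_ne (Ne.symm hxr)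
    refine ⟨m ++ x :: l, link_append.2 ⟨hm, hl⟩, by simp, ?_⟩
    have := hsub.append_right l
    simpa using this

/-- There is no theta graph with an ear in `S`. -/
def NoThetaEar (G : SimpleGraph V) (S : Set V) : Prop :=
  ∀ u v l₁ l₂ l₃ x y l, ThetaEar G u v l₁ l₂ l₃ x y l → x ≠ y → x ∈ u :: v :: (l₁ ++ l₂ ++ l₃) →
    y ∈ u :: v :: (l₁ ++ l₂ ++ l₃) → ¬ ∀ w ∈ u :: v :: (l₁ ++ l₂ ++ l₃ ++ l), w ∈ S

/-- There is no theta graph in `S`. -/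
def NoTheta (G : SimpleGraph V) (S : Set V) : Prop :=
  ∀ u v l₁ l₂ l₃, Theta G u v l₁ l₂ l₃ → ¬ ∀ w ∈ u :: v :: (l₁ ++ l₂ ++ l₃), w ∈ S

/-- Ears being excluded, only a lollipop can be attached, and then the gadgets force K_{2,3}.
Nothing else fits: an ear or a lollipop attached to the lollipop yields a second `Gad3` at its root,
an ear that reaches another vertex of K_{2,3} yields an ear of the theta graph, and lollipops at two
vertices of K_{2,3} are not colourable. -/
theorem Theta.spans_or [Finite V] (hS : Linked G S) (hdeg : MinDegTwo G S)
    (hc : IsBicoloring G col) (hch : Choosable G 4 2) (hno : NoThetaEar G S)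
    (h : Theta G u v l₁ l₂ l₃) (hsub : ∀ w ∈ u :: v :: (l₁ ++ l₂ ++ l₃), w ∈ S) :
    Spans G S (u :: v :: (l₁ ++ l₂ ++ l₃)) (thetaEdges u v l₁ l₂ l₃) ∨
    ∃ a b d x t z c, Theta G u v [a] [b] [d] ∧ x ∈ [u, v, a, b, d] ∧ IsLolli G x t z c ∧
      ([u, v, a, b, d] ++ (t ++ c)).Nodup ∧
      Spans G S ([u, v, a, b, d] ++ (t ++ c)) (thetaEdges u v [a] [b] [d] ++ lolliEdges x t z c) := by
  classical
  by_cases hsp : ∀ x ∈ S, ∀ y ∈ S, G.Adj x y → s(x, y) ∈ thetaEdges u v l₁ l₂ l₃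
  · exact Or.inl ⟨hsub, hsp⟩
  right
  have hmem : ∀ {l₁ l₂ l₃ : List V} {x y : V}, s(x, y) ∈ thetaEdges u v l₁ l₂ l₃ →
      x ∈ u :: v :: (l₁ ++ l₂ ++ l₃) ∧ y ∈ u :: v :: (l₁ ++ l₂ ++ l₃) := by
    intro l₁ l₂ l₃ x y hxy
    simp only [thetaEdges, List.mem_append] at hxy
    simp only [List.mem_cons, List.mem_append]
    rcases hxy with (hxy | hxy) | hxy <;>
    · have := mem_of_mem_linkEdges hxy
      simp only [List.mem_cons] at this
      tauto
  rcases exists_ear hS hdeg h.nd hsub (by simp) (fun _ _ => hmem) hsp with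
    ⟨x, hx, y, hy, l, hxy, hl, hnd, hlS, hnew⟩ | ⟨x, hx, q, hqL, hnd, hqS⟩
  · refine absurd ?_ (hno u v l₁ l₂ l₃ x y l ⟨h, hl, by simpa using hnd, hnew⟩ hxy hx hy)
    intro w hw
    rw [← List.cons_append, ← List.cons_append, List.mem_append] at hw
    exact hw.elim (hsub w) (hlS w)
  obtain ⟨l, hp, hg⟩ := h.gad hc hx
  have hndx : (x :: (l ++ q)).Nodup := (hp.append_right q).nodup_iff.2 hnd
  rcases hg with hg | ⟨⟨h1, h2, h3⟩, hg⟩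
  · exact absurd hch (not_choosable_of_gad4_lolli hc hg hqL hndx)
  obtain ⟨a, rfl⟩ := List.length_eq_one_iff.1 h1
  obtain ⟨b, rfl⟩ := List.length_eq_one_iff.1 h2
  obtain ⟨d, rfl⟩ := List.length_eq_one_iff.1 h3
  obtain ⟨t, z, c, rfl, hq⟩ := hqL.exists_isLolli
  change (x :: l).Perm [u, v, a, b, d] at hp
  change x ∈ [u, v, a, b, d] at hx
  change ([u, v, a, b, d] ++ (t ++ c)).Nodup at hnd
  have hsub' : ∀ w ∈ [u, v, a, b, d] ++ (t ++ c), w ∈ S := fun w hw =>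
    (List.mem_append.1 hw).elim (hsub w) (hqS w)
  refine ⟨a, b, d, x, t, z, c, h, hx, hq, hnd, hsub', ?_⟩
  have hndq : (x :: (t ++ c)).Nodup := nodup_of_count hndx fun a => by
    simp [List.count_cons] <;> omega
  by_contra hsp'
  rcases exists_ear hS hdeg hnd hsub' (by simp) (fun x' y' hxy => by
      rw [List.mem_append] at hxy
      rcases hxy with hxy | hxy
      · have := hmem hxy
        exact ⟨List.mem_append_left _ this.1, List.mem_append_left _ this.2⟩
      · have key : ∀ w ∈ x :: (t ++ c), w ∈ [u, v, a, b, d] ++ (t ++ c) := by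
          intro w hw
          rcases List.mem_cons.1 hw with rfl | hw
          · exact List.mem_append_left _ hx
          · exact List.mem_append_right _ hw
        have := hq.mem_of_mem_lolliEdges hxy
        exact ⟨key _ this.1, key _ this.2⟩) hsp' with
    ⟨x', hx', y', hy', l', hxy, hl', hnd', hlS', hnew'⟩ | ⟨y', hy', q', hq', hnd', hqS'⟩
  · have hndl : (x :: (l ++ (t ++ c ++ l'))).Nodup := by
      have := ((hp.append_right (t ++ c)).append_right l').nodup_iff.2 hnd'
      simpa using this
    -- An ear from the lollipop to K_{2,3} is prolonged inside the lollipop back to `x`.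
    have mixed : ∀ {x' y' : V} {l' : List V}, x' ∈ x :: (t ++ c) → y' ∈ [u, v, a, b, d] →
        Link G x' l' y' → ([u, v, a, b, d] ++ (t ++ c) ++ l').Nodup → y' ≠ x →
        (∀ w ∈ l', w ∈ S) → (l' = [] → s(x', y') ∉ thetaEdges u v [a] [b] [d]) → False := by
      intro x' y' l' hx' hy' hl' hnd' hne hlS' hnewm
      obtain ⟨l'', h1, h2, h3⟩ := hq.exists_link hx' hl' hndq
      refine hno u v [a] [b] [d] x y' l'' ⟨h, h1, ?_, ?_⟩ hne.symm hx hy' ?_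
      · rw [List.append_assoc] at hnd'
        exact hnd'.sublist (h3.append_left [u, v, a, b, d])
      · intro hl''
        obtain ⟨h4, rfl⟩ := h2 hl''
        exact hnewm h4
      · intro w hw
        change w ∈ [u, v, a, b, d] ++ l'' at hw
        rcases List.mem_append.1 hw with hw | hw
        · exact hsub w hw
        · rcases List.mem_append.1 (h3.subset hw) with hw | hw
          exacts [hqS w hw, hlS' w hw]
    have hnewt : l' = [] → s(x', y') ∉ thetaEdges u v [a] [b] [d] := fun h1 h2 =>
      hnew' h1 (List.mem_append_left _ h2)
    have hndr : ([u, v, a, b, d] ++ (t ++ c) ++ l'.reverse).Nodup :=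
      (((List.reverse_perm l').append_left _).nodup_iff).2 hnd'
    have hzone : ∀ {x' : V}, x' ∈ [u, v, a, b, d] ++ (t ++ c) →
        x' ∈ [u, v, a, b, d] ∧ x' ≠ x ∨ x' ∈ x :: (t ++ c) := by
      intro x' hx'
      rcases List.mem_append.1 hx' with hx' | hx'
      · by_cases h : x' = x
        · exact Or.inr (h ▸ by simp)
        · exact Or.inl ⟨hx', h⟩
      · exact Or.inr (List.mem_cons_of_mem _ hx')
    rcases hzone hx' with ⟨hx', hne⟩ | hx' <;> rcases hzone hy' with ⟨hy', hne'⟩ | hy'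
    · refine hno u v [a] [b] [d] x' y' l' ⟨h, hl', ?_, hnewt⟩ hxy hx' hy' ?_
      · exact nodup_of_count hnd' fun a => by simp [List.count_cons] <;> omega
      · intro w hw
        change w ∈ [u, v, a, b, d] ++ l' at hw
        exact (List.mem_append.1 hw).elim (hsub w) (hlS' w)
    · exact mixed hy' hx' hl'.symm hndr hne (by simpa using hlS')
        (fun h => by rw [Sym2.eq_swap]; exact hnewt (by simpa using h))
    · exact mixed hx' hy' hl' hnd' hne' hlS' hnewt
    · have := hq.gad3_of_ear hc hxy hl' hx' hy'
        (nodup_of_count hndl fun a => by simp [List.count_cons] <;> omega)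
        (fun h1 h2 => hnew' h1 (List.mem_append_right _ h2))
      exact not_choosable_of_gad3 hg this hndl hch
  · have hndl : (x :: (l ++ (t ++ c ++ q'))).Nodup := by
      have := ((hp.append_right (t ++ c)).append_right q').nodup_iff.2 hnd'
      simpa using this
    by_cases hy'x : y' ∈ x :: (t ++ c)
    · have := hq.gad3_of_lolli hc hy'x hq'
        (nodup_of_count hndl fun a => by simp [List.count_cons] <;> omega)
      exact not_choosable_of_gad3 hg this hndl hch
    · simp only [List.mem_cons, not_or] at hy'x
      exact h.not_choosable_of_two_lollis hc hx ((List.mem_append.1 hy').resolve_right hy'x.2)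
        (Ne.symm hy'x.1) hq.lolli hq' (by simpa using hnd') hch

/-- A cycle with lollipops at two of its vertices. -/
structure Middle (G : SimpleGraph V) (S : Set V) (p p' : V) (m m' q q' : List V) : Prop where
  h : Link G p m p'
  h' : Link G p m' p'
  ne : m ≠ [] ∨ m' ≠ []
  hq : Lolli G p q
  hq' : Lolli G p' q'
  nd : (p :: p' :: (m ++ m' ++ (q ++ q'))).Nodup
  sub : ∀ w ∈ p :: p' :: (m ++ m' ++ (q ++ q')), w ∈ S

/-- A cycle of length four with lollipops at two opposite vertices. -/
structure MiddleLayout (G : SimpleGraph V) (p p' a b : V) (t : List V) (z : V)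
    (c t' : List V) (z' : V) (c' : List V) : Prop where
  ha : Link G p [a] p'
  hb : Link G p [b] p'
  hq : IsLolli G p t z c
  hq' : IsLolli G p' t' z' c'
  nd : ([p, p', a, b] ++ ((t ++ c) ++ (t' ++ c'))).Nodup

/-- The edges of a `MiddleLayout`. -/
def middleEdges (p p' a b : V) (t : List V) (z : V) (c t' : List V) (z' : V) (c' : List V) :
    List (Sym2 V) :=
  linkEdges p [a] p' ++ linkEdges p [b] p' ++ (lolliEdges p t z c ++ lolliEdges p' t' z' c')

/-- The lollipops (or nothing) attached to the vertices of the middle cycle. -/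
def MiddleRoot (p p' a b : V) (q q' : List V) (r : V) (q₀ : List V) : Prop :=
  r = p ∧ q₀ = q ∨ r = p' ∧ q₀ = q' ∨ r = a ∧ q₀ = [] ∨ r = b ∧ q₀ = []

/-! ### A four-cycle with lollipops at opposite vertices -/

section Middle

variable {a b z' r' : V} {c' q₀ q₀' : List V}

theorem exists_middleRoot (hx : x ∈ [p, p', a, b] ++ (q ++ q')) :
    ∃ r q₀, x ∈ r :: q₀ ∧ MiddleRoot p p' a b q q' r q₀ := by
  unfold MiddleRoot
  by_cases h1 : x ∈ p :: q
  · exact ⟨p, q, h1, by simp⟩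
  by_cases h2 : x ∈ p' :: q'
  · exact ⟨p', q', h2, by simp⟩
  by_cases h3 : x = a
  · exact ⟨a, [], by simp [h3], by simp⟩
  by_cases h4 : x = b
  · exact ⟨b, [], by simp [h4], by simp⟩
  simp only [List.mem_cons, List.mem_append, List.not_mem_nil] at hx h1 h2
  tauto

theorem MiddleRoot.mem (h : MiddleRoot p p' a b q q' r q₀) : r ∈ [p, a, p', b] := by
  rcases h with ⟨rfl, -⟩ | ⟨rfl, -⟩ | ⟨rfl, -⟩ | ⟨rfl, -⟩ <;> simp

theorem MiddleRoot.subset (h : MiddleRoot p p' a b q q' r q₀) : ∀ w ∈ q₀, w ∈ q ++ q' := by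
  rcases h with ⟨-, rfl⟩ | ⟨-, rfl⟩ | ⟨-, rfl⟩ | ⟨-, rfl⟩ <;> simp +contextual

theorem MiddleRoot.unique (h : MiddleRoot p p' a b q q' r q₀)
    (h' : MiddleRoot p p' a b q q' r q₀') (hnd : [p, p', a, b].Nodup) : q₀ = q₀' := by
  simp only [List.nodup_cons, List.mem_cons, List.not_mem_nil, not_or, or_false] at hnd
  rcases h with ⟨rfl, rfl⟩ | ⟨rfl, rfl⟩ | ⟨rfl, rfl⟩ | ⟨rfl, rfl⟩ <;>
  rcases h' with ⟨h', rfl⟩ | ⟨h', rfl⟩ | ⟨h', rfl⟩ | ⟨h', rfl⟩ <;>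
  first
  | rfl
  | exact absurd h' (by tauto)
  | exact absurd h'.symm (by tauto)

theorem MiddleRoot.nodup (h : MiddleRoot p p' a b q q' r q₀)
    (h' : MiddleRoot p p' a b q q' r' q₀') (hrr : r ≠ r')
    (hnd : ([p, p', a, b] ++ (q ++ q') ++ l).Nodup) :
    ([p, a, p', b] ++ (q₀' ++ (q₀ ++ l))).Nodup := by
  classical
  rcases h with ⟨rfl, rfl⟩ | ⟨rfl, rfl⟩ | ⟨rfl, rfl⟩ | ⟨rfl, rfl⟩ <;>
  rcases h' with ⟨rfl, rfl⟩ | ⟨rfl, rfl⟩ | ⟨rfl, rfl⟩ | ⟨rfl, rfl⟩ <;>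
  first
  | exact absurd rfl hrr
  | exact nodup_of_count hnd fun a => by simp [List.count_cons] <;> omega

theorem MiddleLayout.cycle (h : MiddleLayout G p p' a b t z c t' z' c') :
    Link G p [a, p', b] p := by
  have h1 := link_cons.1 h.ha
  exact link_cons.2 ⟨h1.1, link_cons.2 ⟨link_nil.1 h1.2, h.hb.symm⟩⟩

theorem mem_cycle_edges {e : Sym2 V} (h : e ∈ linkEdges p [a, p', b] p) :
    e ∈ linkEdges p [a] p' ++ linkEdges p [b] p' := by
  have h4 : e ∈ linkEdges p ([a] ++ p' :: [b]) p := h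
  rw [linkEdges_append, List.mem_append, ← mem_linkEdges_reverse (u := p') (v := p)] at h4
  exact List.mem_append.2 h4

theorem MiddleLayout.exists_link (h : MiddleLayout G p p' a b t z c t' z' c')
    (hr : MiddleRoot p p' a b (t ++ c) (t' ++ c') r q₀) (hx : x ∈ r :: q₀) (hl : Link G x l y) :
    ∃ l', Link G r l' y ∧ (l' = [] → l = [] ∧ x = r) ∧ l'.Sublist (q₀ ++ l) := by
  classical
  have hnd := h.nd
  rcases hr with ⟨rfl, rfl⟩ | ⟨rfl, rfl⟩ | ⟨rfl, rfl⟩ | ⟨rfl, rfl⟩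
  · exact h.hq.exists_link hx hl
      (nodup_of_count hnd fun a => by simp [List.count_cons] <;> omega)
  · exact h.hq'.exists_link hx hl
      (nodup_of_count hnd fun a => by simp [List.count_cons] <;> omega)
  · have hx' := List.mem_singleton.1 hx
    exact ⟨l, hx' ▸ hl, fun h => ⟨h, hx'⟩, by simp⟩
  · have hx' := List.mem_singleton.1 hx
    exact ⟨l, hx' ▸ hl, fun h => ⟨h, hx'⟩, by simp⟩

/-- Otherwise the ear, prolonged to the roots at both of its ends, is an ear of the middle cycle,
which produces a theta graph. -/
theorem MiddleLayout.root_eq (h : MiddleLayout G p p' a b t z c t' z' c') (hno : NoTheta G S)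
    (hr : MiddleRoot p p' a b (t ++ c) (t' ++ c') r q₀)
    (hr' : MiddleRoot p p' a b (t ++ c) (t' ++ c') r' q₀') (hx : x ∈ r :: q₀) (hy : y ∈ r' :: q₀')
    (hl : Link G x l y) (hnd : ([p, p', a, b] ++ ((t ++ c) ++ (t' ++ c')) ++ l).Nodup)
    (hsub : ∀ w ∈ [p, p', a, b] ++ ((t ++ c) ++ (t' ++ c')) ++ l, w ∈ S)
    (hnew : l = [] → s(x, y) ∉ middleEdges p p' a b t z c t' z' c') : r = r' := by
  by_contra hrr
  obtain ⟨l', hl', he', hs'⟩ := h.exists_link hr hx hl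
  obtain ⟨l'', hl'', he'', hs''⟩ := h.exists_link hr' hy hl'.symm
  have hndq := hr.nodup hr' hrr hnd
  have hndq' : ([p, a, p', b] ++ (q₀' ++ l'.reverse)).Nodup := by
    have : (q₀' ++ l'.reverse).Perm (q₀' ++ l') := (List.reverse_perm l').append_left q₀'
    refine ((this.append_left [p, a, p', b]).nodup_iff).2 ?_
    exact hndq.sublist ((hs'.append_left q₀').append_left _)
  obtain ⟨l₁, l₂, hth, hsub'⟩ := exists_theta_of_ear h.cycle (by simp) hr'.mem hr.mem
    (Ne.symm hrr) hl'' (hndq'.sublist (hs''.append_left [p, a, p', b])) (by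
      intro h1 h2
      obtain ⟨h3, rfl⟩ := he'' h1
      obtain ⟨rfl, rfl⟩ := he' (by simpa using h3)
      rw [Sym2.eq_swap] at h2
      exact hnew rfl (List.mem_append_left _ (mem_cycle_edges h2)))
  refine hno _ _ _ _ _ hth fun w hw => ?_
  rcases List.mem_append.1 (hsub' w hw) with hw | hw
  · apply hsub
    simp only [List.mem_cons, List.mem_append] at hw ⊢
    tauto
  rcases List.mem_append.1 (hs''.subset hw) with hw | hw
  · exact hsub w (List.mem_append_left _ (List.mem_append_right _ (hr'.subset w hw)))
  · rw [List.mem_reverse] at hw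
    rcases List.mem_append.1 (hs'.subset hw) with hw | hw
    · exact hsub w (List.mem_append_left _ (List.mem_append_right _ (hr.subset w hw)))
    · exact hsub w (List.mem_append_right _ hw)

theorem MiddleLayout.flip (h : MiddleLayout G p p' a b t z c t' z' c') :
    MiddleLayout G p' p a b t' z' c' t z c := by
  classical
  exact ⟨h.ha.symm, h.hb.symm, h.hq', h.hq,
    nodup_of_count h.nd fun a => by simp [List.count_cons] <;> omega⟩

theorem MiddleLayout.swap (h : MiddleLayout G p p' a b t z c t' z' c') :
    MiddleLayout G p p' b a t z c t' z' c' := by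
  classical
  exact ⟨h.hb, h.ha, h.hq, h.hq',
    nodup_of_count h.nd fun a => by simp [List.count_cons] <;> omega⟩

theorem MiddleLayout.gad3 (h : MiddleLayout G p p' a b t z c t' z' c') (hc : IsBicoloring G col) :
    Gad3 G p (p' :: ([a] ++ [b] ++ (t' ++ c'))) := by
  classical
  exact (gad_cycle_lolli hc h.ha h.hb (by simp) h.hq'.lolli
    (nodup_of_count h.nd fun a => by simp [List.count_cons] <;> omega)).elim Gad4.gad3 And.right

/-- The middle cycle with the far lollipop is a `Gad3` at `p`, and so is the near lollipop with its
ear. -/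
theorem MiddleLayout.not_choosable_of_ear (h : MiddleLayout G p p' a b t z c t' z' c')
    (hc : IsBicoloring G col) (hxy : x ≠ y) (hx : x ∈ p :: (t ++ c)) (hy : y ∈ p :: (t ++ c))
    (hl : Link G x l y) (hnd : ([p, p', a, b] ++ ((t ++ c) ++ (t' ++ c')) ++ l).Nodup)
    (hnew : l = [] → s(x, y) ∉ lolliEdges p t z c) : ¬ Choosable G 4 2 := by
  classical
  have := h.hq.gad3_of_ear hc hxy hl hx hy
    (nodup_of_count hnd fun a => by simp [List.count_cons] <;> omega) hnew
  exact not_choosable_of_gad3 (h.gad3 hc) this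
    (nodup_of_count hnd fun a => by simp [List.count_cons] <;> omega)

theorem MiddleLayout.not_choosable_of_lolli {q : List V}
    (h : MiddleLayout G p p' a b t z c t' z' c') (hc : IsBicoloring G col)
    (hy : y ∈ p :: (t ++ c)) (hq : Lolli G y q)
    (hnd : ([p, p', a, b] ++ ((t ++ c) ++ (t' ++ c')) ++ q).Nodup) : ¬ Choosable G 4 2 := by
  classical
  have := h.hq.gad3_of_lolli hc hy hq
    (nodup_of_count hnd fun a => by simp [List.count_cons] <;> omega)
  exact not_choosable_of_gad3 (h.gad3 hc) this
    (nodup_of_count hnd fun a => by simp [List.count_cons] <;> omega)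

/-- Seen from `a`, the root `p` is not opposite but adjacent on the four-cycle, so the cycle with
the lollipop at `p` is even a `Gad4`. -/
theorem MiddleLayout.not_choosable_of_lolli_mid {q : List V}
    (h : MiddleLayout G p p' a b t z c t' z' c') (hc : IsBicoloring G col) (hq : Lolli G a q)
    (hnd : ([p, p', a, b] ++ ((t ++ c) ++ (t' ++ c')) ++ q).Nodup) : ¬ Choosable G 4 2 := by
  classical
  have h1 := link_cons.1 h.ha
  have h2 : Link G a [p', b] p := link_cons.2 ⟨link_nil.1 h1.2, h.hb.symm⟩
  rcases gad_cycle_lolli hc (link_nil.2 h1.1.symm) h2 (by simp) h.hq.lolli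
    (nodup_of_count hnd fun a => by simp [List.count_cons] <;> omega) with hg | ⟨h0, -⟩
  · exact not_choosable_of_gad4_lolli hc hg hq
      (nodup_of_count hnd fun a => by simp [List.count_cons] <;> omega)
  · simp at h0

theorem MiddleLayout.mem_of_mem_edges (h : MiddleLayout G p p' a b t z c t' z' c')
    (hxy : s(x, y) ∈ middleEdges p p' a b t z c t' z' c') :
    x ∈ [p, p', a, b] ++ ((t ++ c) ++ (t' ++ c')) ∧
    y ∈ [p, p', a, b] ++ ((t ++ c) ++ (t' ++ c')) := by
  simp only [middleEdges, List.mem_append] at hxy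
  have key : ∀ w, w ∈ [p, p', a, b] ∨ w ∈ p :: (t ++ c) ∨ w ∈ p' :: (t' ++ c') →
      w ∈ [p, p', a, b] ++ ((t ++ c) ++ (t' ++ c')) := by
    intro w hw
    simp only [List.mem_cons, List.mem_append] at hw ⊢
    tauto
  rcases hxy with (hxy | hxy) | hxy | hxy
  · have := mem_of_mem_linkEdges hxy
    simp only [List.mem_cons] at this
    constructor <;> apply key <;> simp only [List.mem_cons] <;> tauto
  · have := mem_of_mem_linkEdges hxy
    simp only [List.mem_cons] at this
    constructor <;> apply key <;> simp only [List.mem_cons] <;> tauto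
  · have := h.hq.mem_of_mem_lolliEdges hxy
    exact ⟨key _ (Or.inr (Or.inl this.1)), key _ (Or.inr (Or.inl this.2))⟩
  · have := h.hq'.mem_of_mem_lolliEdges hxy
    exact ⟨key _ (Or.inr (Or.inr this.1)), key _ (Or.inr (Or.inr this.2))⟩

theorem MiddleLayout.spans [Finite V] (hS : Linked G S) (hdeg : MinDegTwo G S)
    (hc : IsBicoloring G col) (hch : Choosable G 4 2) (hno : NoTheta G S)
    (h : MiddleLayout G p p' a b t z c t' z' c')
    (hsub : ∀ w ∈ [p, p', a, b] ++ ((t ++ c) ++ (t' ++ c')), w ∈ S) :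
    Spans G S ([p, p', a, b] ++ ((t ++ c) ++ (t' ++ c')))
      (middleEdges p p' a b t z c t' z' c') := by
  classical
  refine ⟨hsub, ?_⟩
  by_contra hsp
  have hflip : ∀ {l : List V}, ([p, p', a, b] ++ ((t ++ c) ++ (t' ++ c')) ++ l).Nodup →
      ([p', p, a, b] ++ ((t' ++ c') ++ (t ++ c)) ++ l).Nodup := fun hnd =>
    nodup_of_count hnd fun a => by simp [List.count_cons] <;> omega
  have hcyc : [p, p', a, b].Nodup := h.nd.of_append_left
  rcases exists_ear hS hdeg h.nd hsub (by simp) (fun x y hxy => h.mem_of_mem_edges hxy) hsp with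
    ⟨x, hx, y, hy, l, hxy, hl, hndl, hlS, hnew⟩ | ⟨y, hy, q, hq, hndl, hqS⟩
  · obtain ⟨r, q, hxq, hr⟩ := exists_middleRoot hx
    obtain ⟨r', q', hyq, hr'⟩ := exists_middleRoot hy
    obtain rfl := h.root_eq hno hr hr' hxq hyq hl hndl
      (fun w hw => (List.mem_append.1 hw).elim (hsub w) (hlS w)) hnew
    obtain rfl := hr.unique hr' hcyc
    have hnew' : ∀ e, e ∈ lolliEdges p t z c ∨ e ∈ lolliEdges p' t' z' c' →
        e ∈ middleEdges p p' a b t z c t' z' c' := by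
      intro e he
      simp only [middleEdges, List.mem_append]
      tauto
    rcases hr with ⟨rfl, rfl⟩ | ⟨rfl, rfl⟩ | ⟨rfl, rfl⟩ | ⟨rfl, rfl⟩
    · exact h.not_choosable_of_ear hc hxy hxq hyq hl hndl
        (fun h1 h2 => hnew h1 (hnew' _ (Or.inl h2))) hch
    · exact h.flip.not_choosable_of_ear hc hxy hxq hyq hl (hflip hndl)
        (fun h1 h2 => hnew h1 (hnew' _ (Or.inr h2))) hch
    · exact hxy ((List.mem_singleton.1 hxq).trans (List.mem_singleton.1 hyq).symm)
    · exact hxy ((List.mem_singleton.1 hxq).trans (List.mem_singleton.1 hyq).symm)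
  · obtain ⟨r, q₀, hyq, hr⟩ := exists_middleRoot hy
    rcases hr with ⟨rfl, rfl⟩ | ⟨rfl, rfl⟩ | ⟨rfl, rfl⟩ | ⟨rfl, rfl⟩
    · exact h.not_choosable_of_lolli hc hyq hq hndl hch
    · exact h.flip.not_choosable_of_lolli hc hyq hq (hflip hndl) hch
    · obtain rfl := List.mem_singleton.1 hyq
      exact h.not_choosable_of_lolli_mid hc hq hndl hch
    · obtain rfl := List.mem_singleton.1 hyq
      exact h.swap.not_choosable_of_lolli_mid hc hq
        (nodup_of_count hndl fun a => by simp [List.count_cons] <;> omega) hch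

end Middle

/-- Unless the cycle has length four and its roots are opposite, the cycle with the lollipop at `p'`
is a `Gad4` for the lollipop at `p`. -/
theorem Middle.exists_layout [Finite V] (hS : Linked G S) (hdeg : MinDegTwo G S)
    (hc : IsBicoloring G col) (hch : Choosable G 4 2) (hno : NoTheta G S)
    (h : Middle G S p p' m m' q q') :
    ∃ a b t z c t' z' c', MiddleLayout G p p' a b t z c t' z' c' ∧
      Spans G S ([p, p', a, b] ++ ((t ++ c) ++ (t' ++ c')))
        (middleEdges p p' a b t z c t' z' c') := by
  classical
  have hnd := h.nd
  rcases gad_cycle_lolli hc h.h h.h' h.ne h.hq'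
    (nodup_of_count hnd fun a => by simp [List.count_cons] <;> omega) with hg | ⟨⟨hm, hm'⟩, -⟩
  · exact absurd hch (not_choosable_of_gad4_lolli hc hg h.hq
      (nodup_of_count hnd fun a => by simp [List.count_cons] <;> omega))
  obtain ⟨a, rfl⟩ := List.length_eq_one_iff.1 hm
  obtain ⟨b, rfl⟩ := List.length_eq_one_iff.1 hm'
  obtain ⟨t, z, c, rfl, hq⟩ := h.hq.exists_isLolli
  obtain ⟨t', z', c', rfl, hq'⟩ := h.hq'.exists_isLolli
  have hL : MiddleLayout G p p' a b t z c t' z' c' := ⟨h.h, h.h', hq, hq', hnd⟩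
  exact ⟨a, b, t, z, c, t', z', c', hL, hL.spans hS hdeg hc hch hno h.sub⟩

-- In the absence of theta graphs, an ear has both ends on the lollipop and closes a cycle with a
-- stretch of its arm, which becomes the middle cycle. A further lollipop on the arm would give
-- three lollipops at one vertex; on either cycle, away from its point of attachment, it makes that
-- cycle a middle one.
set_option maxHeartbeats 1000000 in
theorem spans_cycles_or_middle [Finite V] (hS : Linked G S) (hdeg : MinDegTwo G S)
    (hc : IsBicoloring G col) (hch : Choosable G 4 2) (hno : NoTheta G S) (h₀ : Link G x₀ c₀ x₀)
    (h2 : 2 ≤ c₀.length) (hq : IsLolli G x₀ t z c) (hnd : (x₀ :: (c₀ ++ (t ++ c))).Nodup)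
    (hsub : ∀ w ∈ x₀ :: (c₀ ++ (t ++ c)), w ∈ S) :
    Spans G S (x₀ :: (c₀ ++ (t ++ c))) (linkEdges x₀ c₀ x₀ ++ lolliEdges x₀ t z c) ∨
    ∃ p p' m m' q q', Middle G S p p' m m' q q' := by
  classical
  by_cases hsp : ∀ x ∈ S, ∀ y ∈ S, G.Adj x y → s(x, y) ∈ linkEdges x₀ c₀ x₀ ++ lolliEdges x₀ t z c
  · exact Or.inl ⟨hsub, hsp⟩
  right
  -- Running back along an arm from `p` and then around `c₀` is a lollipop at `p`.
  have hback : ∀ {s : List V} {p : V}, Arm G x₀ s p → ∃ q, Lolli G p q ∧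
      (p :: q).Perm (x₀ :: (s ++ c₀)) := by
    intro s p hs
    obtain ⟨s', hs', hp, -⟩ := hs.exists_reverse
    exact ⟨s' ++ c₀, (IsLolli.mk hs' h₀ h2).lolli, hp.append_right c₀⟩
  have hzone : ∀ x, x ∈ x₀ :: (c₀ ++ (t ++ c)) → x ∈ x₀ :: (t ++ c) ∨ x ∈ c₀ ∧ x ≠ x₀ := by
    intro x hx
    by_cases h : x = x₀
    · exact Or.inl (by simp [h])
    · simp only [List.mem_cons, List.mem_append] at hx ⊢
      tauto
  have hcycle : ∀ {Z : List V}, CycleArm G x₀ (t ++ c ++ Z) → (x₀ :: (c₀ ++ (t ++ c ++ Z))).Nodup →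
      (∀ w ∈ Z, w ∈ S) → ∃ p p' m m' q q', Middle G S p p' m m' q q' := by
    rintro Z ⟨s, p, p', m, m', q, hs, hm, hm', hne, hq, hnd1, hZ⟩ hndZ hZS
    obtain ⟨q', hq', hp⟩ := hback hs
    have hdis : (x₀ :: (s ++ c₀) ++ p' :: (m ++ m' ++ q)).Nodup := by
      have h1 : (c₀ ++ (x₀ :: (s ++ p' :: (m ++ m' ++ q)))).Nodup := by
        rw [List.nodup_append']
        refine ⟨nodup_of_count hnd fun a => by simp [List.count_cons] <;> omega, hnd1, ?_⟩
        intro w hw hw'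
        have h2 : (c₀ ++ (x₀ :: (t ++ c ++ Z))).Nodup :=
          nodup_of_count hndZ fun a => by simp [List.count_cons] <;> omega
        refine List.disjoint_of_nodup_append h2 hw ?_
        rcases List.mem_cons.1 hw' with rfl | hw'
        · simp
        · exact List.mem_cons_of_mem _ (hZ w hw')
      exact nodup_of_count h1 fun a => by simp [List.count_cons] <;> omega
    have hall : ∀ w ∈ x₀ :: (s ++ c₀) ++ p' :: (m ++ m' ++ q), w ∈ S := by
      intro w hw
      have h1 : w ∈ x₀ :: (c₀ ++ (t ++ c)) ∨ w ∈ s ++ p' :: (m ++ m' ++ q) := by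
        simp only [List.mem_cons, List.mem_append] at hw ⊢
        tauto
      rcases h1 with h1 | h1
      · exact hsub w h1
      · rcases List.mem_append.1 (hZ w h1) with h1 | h1
        · exact hsub w (by simp only [List.mem_cons, List.mem_append] at h1 ⊢; tauto)
        · exact hZS w h1
    have hp' := hp.append_right (p' :: (m ++ m' ++ q))
    have hfin : (p :: p' :: (m ++ m' ++ (q' ++ q))).Perm (p :: q' ++ p' :: (m ++ m' ++ q)) :=
      List.perm_iff_count.2 fun a => by simp [List.count_cons] <;> omega
    exact ⟨p, p', m, m', q', q, hm, hm', hne, hq', hq, ((hfin.trans hp').nodup_iff).2 hdis,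
      fun w hw => hall w ((hfin.trans hp').mem_iff.1 hw)⟩
  rcases exists_ear hS hdeg hnd hsub (by simp) (fun x y hxy => by
      rw [List.mem_append] at hxy
      rcases hxy with hxy | hxy
      · have := mem_of_mem_linkEdges hxy
        simp only [List.mem_cons, List.mem_append] at this ⊢
        tauto
      · have := hq.mem_of_mem_lolliEdges hxy
        simp only [List.mem_cons, List.mem_append] at this ⊢
        tauto) hsp with
    ⟨x, hx, y, hy, l, hxy, hl, hndl, hlS, hnew⟩ | ⟨y, hy, q, hq', hndl, hqS⟩
  · have hthS : ∀ {x y : V} {l : List V}, x ∈ x₀ :: c₀ → y ∈ x₀ :: c₀ → x ≠ y → Link G x l y →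
        (x₀ :: c₀ ++ l).Nodup → (l = [] → s(x, y) ∉ linkEdges x₀ c₀ x₀) → (∀ w ∈ l, w ∈ S) →
        False := by
      intro x y l hx hy hxy hl hndl hnew hlS
      obtain ⟨l₁, l₂, hth, hsub'⟩ := exists_theta_of_ear h₀ h2 hx hy hxy hl hndl hnew
      refine hno _ _ _ _ _ hth fun w hw => ?_
      rcases List.mem_append.1 (hsub' w hw) with hw | hw
      · exact hsub w (by simp only [List.mem_cons, List.mem_append] at hw ⊢; tauto)
      · exact hlS w hw
    have hmixed : ∀ {x y : V} {l : List V}, x ∈ x₀ :: (t ++ c) → y ∈ c₀ → y ≠ x₀ → Link G x l y →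
        (x₀ :: (c₀ ++ (t ++ c)) ++ l).Nodup → (l = [] → s(x, y) ∉ linkEdges x₀ c₀ x₀) →
        (∀ w ∈ l, w ∈ S) → False := by
      intro x y l hx hy hyx hl hndl hnew hlS
      obtain ⟨l', hl', he, hs⟩ := hq.exists_link hx hl
        (nodup_of_count hnd fun a => by simp [List.count_cons] <;> omega)
      have hndl' : (x₀ :: c₀ ++ (t ++ c ++ l)).Nodup :=
        nodup_of_count hndl fun a => by simp [List.count_cons] <;> omega
      refine hthS (x := x₀) (by simp) (List.mem_cons_of_mem _ hy) hyx.symm hl'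
        (hndl'.sublist (hs.append_left _)) (fun h => ?_) fun w hw => ?_
      · obtain ⟨h, rfl⟩ := he h
        exact hnew h
      · rcases List.mem_append.1 (hs.subset hw) with hw | hw
        · exact hsub w (by simp only [List.mem_cons, List.mem_append] at hw ⊢; tauto)
        · exact hlS w hw
    have hnew₀ : l = [] → s(x, y) ∉ linkEdges x₀ c₀ x₀ := fun h h' =>
      hnew h (List.mem_append_left _ h')
    rcases hzone x hx with hx | ⟨hx, hxx⟩ <;> rcases hzone y hy with hy | ⟨hy, hyx⟩
    · rcases hq.arm_of_ear hxy hl hx hy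
        (nodup_of_count hndl fun a => by simp [List.count_cons] <;> omega)
        (fun h1 h2 => hnew h1 (List.mem_append_right _ h2)) with h | h
      · obtain ⟨s, r, u, v, l₁, l₂, l₃, -, hth, -, -, -, -, hZ⟩ := h
        refine absurd (fun w hw => ?_) (hno _ _ _ _ _ hth)
        have := hZ w hw
        rw [← List.cons_append, List.mem_append] at this
        rcases this with hw | hw
        · exact hsub w (by simp only [List.mem_cons, List.mem_append] at hw ⊢; tauto)
        · exact hlS w hw
      · exact hcycle h (by simpa using hndl) hlS
    · exact (hmixed hx hy hyx hl hndl hnew₀ hlS).elim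
    · exact (hmixed hy hx hxx hl.symm (((List.reverse_perm l).append_left _).nodup_iff.2 hndl)
        (fun h => by rw [Sym2.eq_swap]; exact hnew₀ (by simpa using h)) (by simpa using hlS)).elim
    · exact (hthS (List.mem_cons_of_mem _ hx) (List.mem_cons_of_mem _ hy) hxy hl
        (nodup_of_count hndl fun a => by simp [List.count_cons] <;> omega) hnew₀ hlS).elim
  · rcases hzone y hy with hy | ⟨hy, hyx⟩
    · rcases hq.arm_of_lolli hy hq'
        (nodup_of_count hndl fun a => by simp [List.count_cons] <;> omega) with
        ⟨t₁, t₂, rfl, h₁, h₂⟩ | h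
      · obtain ⟨q₁, hq₁, hp⟩ := hback h₁
        refine absurd hch (not_choosable_of_three_lollis hc hq₁ h₂.lolli hq' ?_)
        have : (y :: (q₁ ++ (t₂ ++ c) ++ q)).Perm (x₀ :: (t₁ ++ c₀) ++ (t₂ ++ c ++ q)) := by
          have := hp.append_right (t₂ ++ c ++ q)
          simpa using this
        refine this.nodup_iff.2 ?_
        exact nodup_of_count hndl fun a => by simp [List.count_cons] <;> omega
      · exact hcycle h (by simpa using hndl) hqS
    · obtain ⟨m, m', hm, hm', hp, -⟩ := exists_link_pair h₀ (x := x₀) (y := y) (by simp)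
        (List.mem_cons_of_mem _ hy) hyx.symm
      have hfin : (x₀ :: y :: (m ++ m' ++ (t ++ c ++ q))).Perm
          (x₀ :: (c₀ ++ (t ++ c)) ++ q) := by
        have := hp.append_right (t ++ c ++ q)
        simpa using this
      refine ⟨x₀, y, m, m', t ++ c, q, hm, hm', ?_, hq.lolli, hq', hfin.nodup_iff.2 hndl,
        fun w hw => ?_⟩
      · by_contra! hcon
        obtain ⟨rfl, rfl⟩ := hcon
        have := hp.length_eq
        simp at this
        omega
      · exact (List.mem_append.1 (hfin.mem_iff.1 hw)).elim (hsub w) (hqS w)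

/-- The possible shapes of the core of a choosable graph, apart from a single vertex. -/
inductive Shape (G : SimpleGraph V) (S : Set V) : Prop
  | cycle (x : V) (c : List V) (h : Link G x c x) (h2 : 2 ≤ c.length) (nd : (x :: c).Nodup)
      (sp : Spans G S (x :: c) (linkEdges x c x))
  | theta (u v : V) (l₁ l₂ l₃ : List V) (h : Theta G u v l₁ l₂ l₃)
      (sp : Spans G S (u :: v :: (l₁ ++ l₂ ++ l₃)) (thetaEdges u v l₁ l₂ l₃))
  | K24 (u v a b d e : V) (h : K24Layout G u v a b d e)
      (sp : Spans G S [u, v, a, b, d, e] (K24Edges u v a b d e))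
  | K33e (a₁ a₂ b₁ b₂ b₀ : V) (d : List V) (h : K33eLayout G a₁ a₂ b₁ b₂ b₀ d)
      (sp : Spans G S (a₁ :: a₂ :: b₁ :: b₂ :: b₀ :: d) (K33eEdges a₁ a₂ b₁ b₂ b₀ d))
  | two_cycles (x : V) (c₀ t : List V) (z : V) (c : List V) (h : Link G x c₀ x)
      (h2 : 2 ≤ c₀.length) (hq : IsLolli G x t z c) (nd : (x :: (c₀ ++ (t ++ c))).Nodup)
      (sp : Spans G S (x :: (c₀ ++ (t ++ c))) (linkEdges x c₀ x ++ lolliEdges x t z c))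
  | theta_cycle (u v a b d x : V) (t : List V) (z : V) (c : List V)
      (h : Theta G u v [a] [b] [d]) (hx : x ∈ [u, v, a, b, d]) (hq : IsLolli G x t z c)
      (nd : ([u, v, a, b, d] ++ (t ++ c)).Nodup)
      (sp : Spans G S ([u, v, a, b, d] ++ (t ++ c))
        (thetaEdges u v [a] [b] [d] ++ lolliEdges x t z c))
  | three_cycles (p p' a b : V) (t : List V) (z : V) (c t' : List V) (z' : V) (c' : List V)
      (h : MiddleLayout G p p' a b t z c t' z' c')
      (sp : Spans G S ([p, p', a, b] ++ ((t ++ c) ++ (t' ++ c')))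
        (middleEdges p p' a b t z c t' z' c'))

/-- The richest structure present is used: a theta graph with an ear, else a theta graph, else a
cycle. In each case a suitable structure is shown to have no further attachment, hence to be all of
`S`. -/
theorem exists_shape [Finite V] (hS : Linked G S) (hdeg : MinDegTwo G S)
    (hc : IsBicoloring G col) (hch : Choosable G 4 2) : Shape G S := by
  classical
  by_cases hno : NoThetaEar G S
  · by_cases hno' : NoTheta G S
    · obtain ⟨v₀, hv₀⟩ := hS.1
      obtain ⟨w, hw, hvw, -⟩ := hdeg v₀ hv₀ v₀
      -- A single vertex admits no ear, so a lollipop is found, and with it a cycle.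
      rcases exists_ear hS hdeg (X := [v₀]) (D := []) (by simp) (by simpa using hv₀) (by simp)
        (by simp) (fun h => by simpa using h v₀ hv₀ w hw hvw) with
        ⟨x, hx, y, hy, l, hxy, -⟩ | ⟨x, hx, q, hqL, hnd, hqS⟩
      · rw [List.mem_singleton] at hx hy
        exact absurd (hx.trans hy.symm) hxy
      obtain rfl := List.mem_singleton.1 hx
      obtain ⟨t, z, c, rfl, hq⟩ := hqL.exists_isLolli
      have hz := hq.arm.end_mem
      have hzS : z ∈ S := by
        rcases List.mem_cons.1 hz with rfl | hz
        exacts [hv₀, hqS z (List.mem_append_left _ hz)]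
      have hndc : (z :: c).Nodup := by
        have : (x :: t ++ c).Nodup := hnd
        exact List.nodup_cons.2 ⟨List.disjoint_of_nodup_append this hz, this.of_append_right⟩
      have hsubc : ∀ w ∈ z :: c, w ∈ S := by
        intro w hw
        rcases List.mem_cons.1 hw with rfl | hw
        exacts [hzS, hqS w (List.mem_append_right _ hw)]
      by_cases hsp : ∀ x ∈ S, ∀ y ∈ S, G.Adj x y → s(x, y) ∈ linkEdges z c z
      · exact .cycle z c hq.link hq.two hndc ⟨hsubc, hsp⟩
      rcases exists_ear hS hdeg hndc hsubc (by simp) (fun x y hxy => by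
          have := mem_of_mem_linkEdges hxy
          simp only [List.mem_cons] at this ⊢
          tauto) hsp with
        ⟨x, hx, y, hy, l, hxy, hl, hndl, hlS, hnew⟩ | ⟨y, hy, q, hqL', hndl, hqS⟩
      · obtain ⟨l₁, l₂, hth, hsub⟩ := exists_theta_of_ear hq.link hq.two hx hy hxy hl hndl hnew
        exact absurd (fun w hw => (List.mem_append.1 (hsub w hw)).elim (hsubc w) (hlS w))
          (hno' _ _ _ _ _ hth)
      · obtain ⟨c₀, h₀, hp, -⟩ := exists_rotate hq.link hy
        obtain ⟨t', z', c', rfl, hq'⟩ := hqL'.exists_isLolli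
        have h2 : 2 ≤ c₀.length := by
          have := hp.length_eq
          have := hq.two
          simp at *
          omega
        have hp' : (y :: (c₀ ++ (t' ++ c'))).Perm (z :: c ++ (t' ++ c')) :=
          hp.append_right (t' ++ c')
        have hnd' := hp'.nodup_iff.2 hndl
        rcases spans_cycles_or_middle hS hdeg hc hch hno' h₀ h2 hq' hnd' (fun w hw =>
          (List.mem_append.1 (hp'.mem_iff.1 hw)).elim (hsubc w) (hqS w)) with
          h | ⟨p, p', m, m', q, q', h⟩
        · exact .two_cycles y c₀ t' z' c' h₀ h2 hq' hnd' h
        · obtain ⟨a, b, t, z, c, t', z', c', h, sp⟩ := h.exists_layout hS hdeg hc hch hno'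
          exact .three_cycles p p' a b t z c t' z' c' h sp
    · unfold NoTheta at hno'
      push Not at hno'
      obtain ⟨u, v, l₁, l₂, l₃, h, hsub⟩ := hno'
      rcases h.spans_or hS hdeg hc hch hno (fun w hw => hsub w hw) with
        h' | ⟨a, b, d, x, t, z, c, h1, h2, h3, h4, h5⟩
      · exact .theta u v l₁ l₂ l₃ h h'
      · exact .theta_cycle u v a b d x t z c h1 h2 h3 h4 h5
  · unfold NoThetaEar at hno
    push Not at hno
    obtain ⟨u, v, l₁, l₂, l₃, x, y, l, h, hxy, hx, hy, hsub⟩ := hno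
    rcases h.exists_layout hc hch hxy hx hy with
      ⟨u', v', a, b, d, e, h', hsub'⟩ | ⟨a₁, a₂, b₁, b₂, b₀, d, h', hsub'⟩
    · have hsub'' : ∀ x ∈ [u', v', a, b, d, e], x ∈ S := fun x hx => hsub x (hsub' hx)
      exact .K24 u' v' a b d e h' ⟨hsub'', h'.spanning hS hdeg hc hch hsub''⟩
    · have hsub'' : ∀ x ∈ a₁ :: a₂ :: b₁ :: b₂ :: b₀ :: d, x ∈ S := fun x hx => hsub x (hsub' hx)
      exact .K33e a₁ a₂ b₁ b₂ b₀ d h' ⟨hsub'', h'.spanning hS hdeg hc hch hsub''⟩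

end Structure

/-! ### Models of graphs given by lists of edges -/

/-- The edges `D` are edges of `G` between vertices in `X`. -/
structure Frame (G : SimpleGraph V) (X : List V) (D : List (Sym2 V)) : Prop where
  mem : ∀ x y, s(x, y) ∈ D → x ∈ X ∧ y ∈ X
  adj : ∀ x y, s(x, y) ∈ D → G.Adj x y

/-- The graph with vertices `X` and edges `D` is isomorphic to `H` by way of `f`. -/
structure Models {W : Type*} (H : SimpleGraph W) (X : List V) (D : List (Sym2 V)) (f : W → V) :
    Prop where
  inj : Function.Injective f
  mem : ∀ v, v ∈ X ↔ ∃ w, f w = v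
  adj : ∀ a b, H.Adj a b ↔ s(f a, f b) ∈ D

/-- The subgraph with vertices `X` and edges `D`. -/
def Frame.subgraph {X : List V} {D : List (Sym2 V)} (h : Frame G X D) : G.Subgraph where
  verts := {x | x ∈ X}
  Adj x y := s(x, y) ∈ D
  adj_sub h' := h.adj _ _ h'
  edge_vert h' := (h.mem _ _ h').1
  symm := ⟨fun x y h' => by rwa [Sym2.eq_swap]⟩

section Models

variable {S : Set V} {X : List V} {D : List (Sym2 V)} {W : Type*} {H : SimpleGraph W} {f : W → V}

theorem Spans.mem_iff (h : Spans G S X D) (hS : Linked G S) (hD : Frame G X D) (hX : X ≠ [])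
    (x : V) : x ∈ S ↔ x ∈ X := by
  refine ⟨fun hx => ?_, h.sub x⟩
  obtain ⟨x₀, hx₀⟩ := List.exists_mem_of_ne_nil _ hX
  exact hS.2 {v | v ∈ X} ⟨x₀, h.sub _ hx₀, hx₀⟩
    (fun x hx y hy _ hxy => (hD.mem x y (h.edges x hx y hy hxy)).2) hx

/-- The relation `R` describes each edge in one direction only, as in `fromRel`; injectivity of `f`
recovers it from unordered pairs. -/
theorem Models.mk_of_rel (R : W → W → Prop) (hH : ∀ a b, a ≠ b → (H.Adj a b ↔ R a b ∨ R b a))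
    (inj : Function.Injective f) (mem : ∀ v, v ∈ X ↔ ∃ w, f w = v)
    (hD : ∀ e, e ∈ D ↔ ∃ a b, R a b ∧ e = s(f a, f b)) (hF : Frame G X D) : Models H X D f := by
  refine ⟨inj, mem, fun a b => ?_⟩
  by_cases hab : a = b
  · subst hab
    exact ⟨fun h => absurd h (H.irrefl), fun h => absurd (hF.adj _ _ h) (G.irrefl)⟩
  rw [hH a b hab, hD]
  constructor
  · rintro (h | h)
    · exact ⟨a, b, h, rfl⟩
    · exact ⟨b, a, h, Sym2.eq_swap⟩
  · rintro ⟨a', b', h, he⟩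
    rcases Sym2.eq_iff.1 he with ⟨h1, h2⟩ | ⟨h1, h2⟩
    · exact Or.inl (inj h1 ▸ inj h2 ▸ h)
    · exact Or.inr (inj h1 ▸ inj h2 ▸ h)

theorem Spans.nonempty_iso (h : Spans G S X D) (hS : Linked G S) (hD : Frame G X D) (hX : X ≠ [])
    (hf : Models H X D f) : Nonempty (G.induce S ≃g H) := by
  have hm := h.mem_iff hS hD hX
  refine ⟨RelIso.symm ⟨Equiv.ofBijective
    (fun w => (⟨f w, (hm _).2 ((hf.mem _).2 ⟨w, rfl⟩)⟩ : S)) ⟨?_, ?_⟩, ?_⟩⟩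
  · intro a b hab
    exact hf.inj (congrArg Subtype.val hab)
  · rintro ⟨v, hv⟩
    obtain ⟨w, rfl⟩ := (hf.mem v).1 ((hm v).1 hv)
    exact ⟨w, rfl⟩
  · intro a b
    rw [hf.adj]
    exact ⟨fun h' => h.edges _ ((hm _).2 ((hf.mem _).2 ⟨a, rfl⟩)) _
      ((hm _).2 ((hf.mem _).2 ⟨b, rfl⟩)) h', fun h' => hD.adj _ _ h'⟩

theorem Frame.nonempty_iso (hD : Frame G X D) (hf : Models H X D f) :
    Nonempty (hD.subgraph.coe ≃g H) := by
  refine ⟨RelIso.symm ⟨Equiv.ofBijective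
    (fun w => (⟨f w, (hf.mem _).2 ⟨w, rfl⟩⟩ : hD.subgraph.verts)) ⟨?_, ?_⟩, ?_⟩⟩
  · intro a b hab
    exact hf.inj (congrArg Subtype.val hab)
  · rintro ⟨v, hv⟩
    obtain ⟨w, rfl⟩ := (hf.mem v).1 hv
    exact ⟨w, rfl⟩
  · intro a b
    rw [hf.adj]
    rfl

theorem mem_ledges_iff {e : Sym2 V} : ∀ {l : List V}, e ∈ ledges l ↔
    ∃ i, ∃ h : i + 1 < l.length, e = s(l[i], l[i + 1])
  | [] => by simp [ledges]
  | [a] => by simp [ledges]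
  | a :: b :: l => by
    rw [ledges, List.mem_cons, mem_ledges_iff]
    constructor
    · rintro (rfl | ⟨i, h, rfl⟩)
      · exact ⟨0, by simp, rfl⟩
      · exact ⟨i + 1, by simpa using h, rfl⟩
    · rintro ⟨i, h, rfl⟩
      cases i with
      | zero => exact Or.inl rfl
      | succ i => exact Or.inr ⟨i, by simpa using h, rfl⟩

theorem Link.frame {x y : V} {l : List V} (h : Link G x l y) :
    Frame G (x :: y :: l) (linkEdges x l y) :=
  ⟨fun _ _ h => mem_of_mem_linkEdges h, fun _ _ h' => adj_of_mem_ledges h h'⟩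

theorem Frame.append {X' : List V} {D' : List (Sym2 V)} (h : Frame G X D) (h' : Frame G X' D') :
    Frame G (X ++ X') (D ++ D') := by
  refine ⟨fun x y hxy => ?_, fun x y hxy => ?_⟩
  · simp only [List.mem_append]
    rcases List.mem_append.1 hxy with hxy | hxy
    · have := h.mem x y hxy
      tauto
    · have := h'.mem x y hxy
      tauto
  · exact (List.mem_append.1 hxy).elim (h.adj x y) (h'.adj x y)

theorem Frame.subset {X' : List V} (h : Frame G X D) (hX : X ⊆ X') : Frame G X' D :=
  ⟨fun x y hxy => ⟨hX (h.mem x y hxy).1, hX (h.mem x y hxy).2⟩, h.adj⟩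

theorem frame_cycle {z : V} {c : List V} (h : Link G z c z) :
    Frame G (z :: c) (linkEdges z c z) :=
  h.frame.subset fun _ => by simp

theorem Theta.frame {u v : V} {l₁ l₂ l₃ : List V} (h : Theta G u v l₁ l₂ l₃) :
    Frame G (u :: v :: (l₁ ++ l₂ ++ l₃)) (thetaEdges u v l₁ l₂ l₃) :=
  ((h.h₁.frame.append h.h₂.frame).append h.h₃.frame).subset fun x hx => by
    simp only [List.mem_cons, List.mem_append] at hx ⊢
    tauto

theorem IsLolli.frame {x z : V} {t c : List V} (h : IsLolli G x t z c) :
    Frame G (x :: (t ++ c)) (lolliEdges x t z c) := by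
  refine ⟨fun _ _ hxy => h.mem_of_mem_lolliEdges hxy, fun a b hab => ?_⟩
  exact (List.mem_append.1 hab).elim (adj_of_mem_ledges h.arm.isChain) (h.link.frame.adj _ _)

theorem models_cycle {z : V} {c : List V} (h : Link G z c z) (h2 : 2 ≤ c.length)
    (hnd : (z :: c).Nodup) {n : ℕ} (hn : n = (z :: c).length) :
    Models (cycleGraph n) (z :: c) (linkEdges z c z) fun i : Fin n => (z :: c)[i.1]'(hn ▸ i.2) := by
  subst hn
  have h3 : 3 ≤ (z :: c).length := by simpa using h2
  refine Models.mk_of_rel (fun i j => j.1 = if i.1 + 1 = (z :: c).length then 0 else i.1 + 1)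
    (fun a b _ => ?_) (fun a b hab => ?_) (fun v => ?_) (fun e => ?_) (frame_cycle h)
  -- In `Fin n` the difference is 1 exactly if `b` is the cyclic successor of `a`.
  · have key : ∀ a b : Fin (z :: c).length, (b - a).val = 1 ↔
        b.1 = if a.1 + 1 = (z :: c).length then 0 else a.1 + 1 := by
      intro a b
      have ha := a.2
      have hb := b.2
      rw [Fin.val_sub]
      generalize (z :: c).length = n at *
      by_cases hab : a.1 ≤ b.1
      · have : n - a.1 + b.1 = (b.1 - a.1) + n := by omega
        rw [this, Nat.add_mod_right, Nat.mod_eq_of_lt (by omega)]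
        split_ifs <;> omega
      · rw [Nat.mod_eq_of_lt (by omega)]
        split_ifs <;> omega
    rw [cycleGraph_adj', key, key, or_comm]
  · exact Fin.ext ((List.Nodup.getElem_inj_iff hnd).1 hab)
  · rw [List.mem_iff_getElem]
    exact ⟨fun ⟨i, hi, h⟩ => ⟨⟨i, hi⟩, h⟩, fun ⟨i, h⟩ => ⟨i.1, i.2, h⟩⟩
  · rw [linkEdges, mem_ledges_iff, ← List.cons_append]
    constructor
    · rintro ⟨i, hi, rfl⟩
      have hi' : i < (z :: c).length := by simpa using hi
      by_cases hl : i + 1 = (z :: c).length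
      · refine ⟨⟨i, hi'⟩, ⟨0, by omega⟩, by simp only [if_pos hl], ?_⟩
        rw [List.getElem_append_left hi', List.getElem_append_right (by omega)]
        simp
      · refine ⟨⟨i, hi'⟩, ⟨i + 1, by omega⟩, by simp only [if_neg hl], ?_⟩
        rw [List.getElem_append_left hi', List.getElem_append_left (by omega)]
    · rintro ⟨i, j, hij, rfl⟩
      have hi' := i.2
      refine ⟨i.1, by simp at hi' ⊢; omega, ?_⟩
      rw [List.getElem_append_left hi']
      by_cases hl : i.1 + 1 = (z :: c).length
      · rw [if_pos hl] at hij
        rw [List.getElem_append_right (by omega)]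
        simp [hij]
      · rw [if_neg hl] at hij
        rw [List.getElem_append_left (by omega)]
        simp only [hij]

theorem models_theta {u v : V} {ls : Fin 3 → List V} {ℓ : Fin 3 → ℕ}
    (h : Theta G u v (ls 0) (ls 1) (ls 2)) (hℓ : ∀ i, ℓ i = (ls i).length + 1) :
    Models (theta ℓ) (u :: v :: (ls 0 ++ ls 1 ++ ls 2)) (thetaEdges u v (ls 0) (ls 1) (ls 2))
      (Sum.elim (fun b => if b then v else u)
        fun p => (ls p.1)[p.2.1]'(by have := p.2.2; have := hℓ p.1; omega)) := by
  have hnd := h.nd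
  have hu : ∀ i, u ∉ ls i := by
    simp [Fin.forall_fin_succ] at hnd ⊢
    tauto
  have hv : ∀ i, v ∉ ls i := by
    simp [Fin.forall_fin_succ] at hnd ⊢
    tauto
  have hne : u ≠ v := by
    simp at hnd
    tauto
  have hndi : ∀ i, (ls i).Nodup := by
    simp [Fin.forall_fin_succ, List.nodup_append] at hnd ⊢
    tauto
  have hdis : ∀ i j x, x ∈ ls i → x ∈ ls j → i = j := by
    have h01 : List.Disjoint (ls 0) (ls 1) := by
      have : (ls 0 ++ ls 1).Nodup := hnd.of_cons.of_cons.of_append_left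
      exact List.disjoint_of_nodup_append this
    have h012 : List.Disjoint (ls 0 ++ ls 1) (ls 2) := by
      have : (ls 0 ++ ls 1 ++ ls 2).Nodup := hnd.of_cons.of_cons
      exact List.disjoint_of_nodup_append this
    rw [List.disjoint_append_left] at h012
    intro i j x hi hj
    fin_cases i <;> fin_cases j <;>
    first
    | rfl
    | exact (h01 hi hj).elim
    | exact (h01 hj hi).elim
    | exact (h012.1 hi hj).elim
    | exact (h012.1 hj hi).elim
    | exact (h012.2 hi hj).elim
    | exact (h012.2 hj hi).elim
  -- The indices of `thetaVertex` count the ends too, so they agree with positions in `u :: (ls i ++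
  -- [v])`.
  have hfv : ∀ i j (hj : j < (u :: (ls i ++ [v])).length),
      (Sum.elim (fun b => if b then v else u)
        fun p : (Σ i, Fin (ℓ i - 1)) => (ls p.1)[p.2.1]'(by have := p.2.2; have := hℓ p.1; omega) :
        Bool ⊕ (Σ i, Fin (ℓ i - 1)) → V) (thetaVertex ℓ i j) = (u :: (ls i ++ [v]))[j] := by
    intro i j hj
    have := hℓ i
    unfold thetaVertex
    cases j with
    | zero => simp
    | succ j =>
      simp only [Nat.add_eq_zero_iff, one_ne_zero, and_false, if_false, Nat.add_sub_cancel,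
        List.getElem_cons_succ]
      by_cases hj' : j < ℓ i - 1
      · rw [dif_pos hj']
        simp only [Sum.elim_inr]
        rw [List.getElem_append_left]
      · rw [dif_neg hj', List.getElem_append_right (by omega)]
        simp
  refine Models.mk_of_rel (fun x y => ∃ i, ∃ j < ℓ i, x = thetaVertex ℓ i j ∧
    y = thetaVertex ℓ i (j + 1)) (fun a b hab => ?_) ?_ (fun w => ?_) (fun e => ?_) h.frame
  · rw [theta, fromRel_adj]
    exact ⟨fun h => h.2, fun h => ⟨hab, h⟩⟩
  · rintro (x | ⟨i, j⟩) (y | ⟨i', j'⟩) hxy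
    · cases x <;> cases y <;> simp at hxy ⊢
      · exact hne hxy
      · exact hne hxy.symm
    · cases x <;> simp at hxy
      · exact (hu i' (hxy ▸ List.getElem_mem _)).elim
      · exact (hv i' (hxy ▸ List.getElem_mem _)).elim
    · cases y <;> simp at hxy
      · exact (hu i (hxy ▸ List.getElem_mem _)).elim
      · exact (hv i (hxy ▸ List.getElem_mem _)).elim
    · simp only [Sum.elim_inr] at hxy
      have hm : (ls i)[j.1]'(by have := hℓ i; omega) ∈ ls i' := by
        rw [hxy]
        exact List.getElem_mem _
      obtain rfl := hdis i i' _ (List.getElem_mem _) hm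
      rw [(hndi i).getElem_inj_iff] at hxy
      rw [Fin.ext hxy]
  · have hmem : w ∈ u :: v :: (ls 0 ++ ls 1 ++ ls 2) ↔ w = u ∨ w = v ∨ ∃ i, w ∈ ls i := by
      simp [Fin.exists_fin_succ]
    rw [hmem]
    constructor
    · rintro (rfl | rfl | ⟨i, hi⟩)
      · exact ⟨Sum.inl false, rfl⟩
      · exact ⟨Sum.inl true, rfl⟩
      · obtain ⟨j, hj, rfl⟩ := List.mem_iff_getElem.1 hi
        exact ⟨Sum.inr ⟨i, ⟨j, by have := hℓ i; omega⟩⟩, rfl⟩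
    · rintro ⟨(x | ⟨i, j⟩), rfl⟩
      · cases x <;> simp
      · exact Or.inr (Or.inr ⟨i, List.getElem_mem _⟩)
  · have hmem : e ∈ thetaEdges u v (ls 0) (ls 1) (ls 2) ↔ ∃ i, e ∈ linkEdges u (ls i) v := by
      simp [thetaEdges, Fin.exists_fin_succ]
    rw [hmem]
    constructor
    · rintro ⟨i, hi⟩
      obtain ⟨j, hj, rfl⟩ := mem_ledges_iff.1 hi
      refine ⟨_, _, ⟨i, j, by have := hℓ i; simp at hj; omega, rfl, rfl⟩, ?_⟩
      rw [hfv i j (by omega), hfv i (j + 1) hj]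
    · rintro ⟨_, _, ⟨i, j, hj, rfl, rfl⟩, rfl⟩
      have hj' : j + 1 < (u :: (ls i ++ [v])).length := by have := hℓ i; simp; omega
      rw [hfv i j (by omega), hfv i (j + 1) hj']
      exact ⟨i, mem_ledges_iff.2 ⟨j, hj', rfl⟩⟩

theorem K24Layout.frame {u v a b d e : V} (h : K24Layout G u v a b d e) :
    Frame G [u, v, a, b, d, e] (K24Edges u v a b d e) :=
  (h.th.frame.append h.link.frame).subset fun x hx => by
    simp only [List.mem_cons, List.mem_append, List.not_mem_nil] at hx ⊢
    tauto

theorem K24Layout.models {u v a b d e : V} (h : K24Layout G u v a b d e) :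
    Models (completeBipartiteGraph (Fin 2) (Fin 4)) [u, v, a, b, d, e] (K24Edges u v a b d e)
      (Sum.elim ![u, v] ![a, b, d, e]) := by
  have hnd := h.nd
  refine Models.mk_of_rel (fun x y => x.isLeft ∧ y.isRight) (fun a b _ => ?_) ?_ (fun w => ?_)
    (fun e => ?_) h.frame
  · simp [completeBipartiteGraph, and_comm]
  · simp only [List.nodup_cons, List.mem_cons, List.not_mem_nil, not_or, or_false] at hnd
    have e1 : Function.Injective ![u, v] := by
      simp [Function.Injective, Fin.forall_fin_succ, Ne.symm hnd.1.1]
      tauto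
    have e2 : Function.Injective ![a, b, d, e] := by
      simp [Function.Injective, Fin.forall_fin_succ, eq_comm (a := b) (b := a),
        eq_comm (a := d) (b := a), eq_comm (a := d) (b := b), eq_comm (a := e) (b := a),
        eq_comm (a := e) (b := b), eq_comm (a := e) (b := d)]
      tauto
    refine e1.sumElim e2 ?_
    simp [Fin.forall_fin_succ]
    tauto
  · simp [Fin.exists_fin_succ, eq_comm, or_assoc]
  · induction e with | _ x y
    rw [mem_K24Edges]
    constructor
    · rintro ⟨z, hz, hz'⟩
      have : ∃ j, ![a, b, d, e] j = z := by
        simp [Fin.exists_fin_succ, eq_comm] at hz ⊢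
        tauto
      obtain ⟨j, rfl⟩ := this
      rcases hz' with hz' | hz'
      · exact ⟨Sum.inl 0, Sum.inr j, by simp, hz'⟩
      · exact ⟨Sum.inl 1, Sum.inr j, by simp, hz'.trans Sym2.eq_swap⟩
    · rintro ⟨(i | i), (j | j), hij, he⟩
      · simp at hij
      · refine ⟨![a, b, d, e] j, ?_, ?_⟩
        · fin_cases j <;> simp
        · rw [he]
          fin_cases i
          · exact Or.inl rfl
          · exact Or.inr Sym2.eq_swap
      · simp at hij
      · simp at hij

theorem K33eLayout.frame {a₁ a₂ b₁ b₂ b₀ : V} {d : List V} (h : K33eLayout G a₁ a₂ b₁ b₂ b₀ d) :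
    Frame G (a₁ :: a₂ :: b₁ :: b₂ :: b₀ :: d) (K33eEdges a₁ a₂ b₁ b₂ b₀ d) := by
  have h0 : Frame G [a₁, a₂, b₁, b₂, b₀]
      [s(a₁, b₁), s(a₁, b₂), s(a₂, b₁), s(a₂, b₂), s(a₁, b₀), s(a₂, b₀)] := by
    constructor
    · intro x y hxy
      simp only [List.mem_cons, List.not_mem_nil, or_false, Sym2.eq_iff] at hxy ⊢
      tauto
    · intro x y hxy
      simp only [List.mem_cons, List.not_mem_nil, or_false] at hxy
      rcases hxy with h' | h' | h' | h' | h' | h' <;> rw [← mem_edgeSet, h', mem_edgeSet]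
      exacts [h.h₁₁, h.h₁₂, h.h₂₁, h.h₂₂, h.h₁₀, h.h₂₀]
  exact (h0.append h.link.frame).subset fun x hx => by
    simp only [List.mem_cons, List.mem_append, List.not_mem_nil] at hx ⊢
    tauto

theorem K33e_adj_iff {x y : Fin 3 ⊕ Fin 3} : K33e.Adj x y ↔
    (completeBipartiteGraph (Fin 3) (Fin 3)).Adj x y ∧ s(x, y) ≠ s(Sum.inl 0, Sum.inr 0) := by
  simp [K33e, deleteEdges_adj]

theorem K33e_neighborSet : (K33e.neighborSet (Sum.inl 0)).ncard = 2 := by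
  have : K33e.neighborSet (Sum.inl 0) = {Sum.inr 1, Sum.inr 2} := by
    ext x
    rw [mem_neighborSet, K33e_adj_iff]
    rcases x with x | x
    · simp
    · fin_cases x <;> simp
  rw [this, Set.ncard_pair (by simp)]

theorem K33e_edges {x y : Fin 3 ⊕ Fin 3} : K33e.Adj x y ∧ s(x, y) ≠ s(Sum.inl 0, Sum.inr 2) ↔
    s(x, y) ∈ [s(Sum.inl 1, Sum.inr 1), s(Sum.inl 1, Sum.inr 2), s(Sum.inl 2, Sum.inr 1),
      s(Sum.inl 2, Sum.inr 2), s(Sum.inl 1, Sum.inr 0), s(Sum.inl 2, Sum.inr 0),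
      s(Sum.inl 0, Sum.inr 1)] := by
  rw [K33e_adj_iff]
  rcases x with x | x <;> rcases y with y | y <;> fin_cases x <;> fin_cases y <;> simp

/-- The first vertex `w` on the path from `b₁` to `b₂` becomes `inl 0`, a vertex of degree two, with
`b₀` as the other end of the missing edge. The rest of the path subdivides the edge from `w` to
`b₂`. -/
theorem K33eLayout.models {a₁ a₂ b₁ b₂ b₀ w : V} {d : List V}
    (h : K33eLayout G a₁ a₂ b₁ b₂ b₀ (w :: d)) {k : ℕ} (hk : k = d.length) :
    Models (subdivideEdge K33e (Sum.inl 0) (Sum.inr 2) k) (a₁ :: a₂ :: b₁ :: b₂ :: b₀ :: w :: d)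
      (K33eEdges a₁ a₂ b₁ b₂ b₀ (w :: d))
      (Sum.elim (Sum.elim ![w, a₁, a₂] ![b₀, b₁, b₂]) fun i : Fin k => d[i.1]'(hk ▸ i.2)) := by
  subst hk
  have hnd := h.nd
  set f : (Fin 3 ⊕ Fin 3) ⊕ Fin d.length → V :=
    Sum.elim (Sum.elim ![w, a₁, a₂] ![b₀, b₁, b₂]) fun i : Fin d.length => d[i.1] with hf
  have hfv : ∀ j (hj : j < (w :: (d ++ [b₂])).length),
      f (subdivVertex (Sum.inl 0) (Sum.inr 2) d.length j) = (w :: (d ++ [b₂]))[j] := by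
    intro j hj
    unfold subdivVertex
    cases j with
    | zero => simp [hf]
    | succ j =>
      simp only [Nat.add_eq_zero_iff, one_ne_zero, and_false, if_false, Nat.add_sub_cancel,
        List.getElem_cons_succ]
      by_cases hj' : j < d.length
      · rw [dif_pos hj', List.getElem_append_left hj']
        simp [hf]
      · rw [dif_neg hj', List.getElem_append_right (by omega)]
        simp [hf]
  have hin : Function.Injective (Sum.elim ![w, a₁, a₂] ![b₀, b₁, b₂] : Fin 3 ⊕ Fin 3 → V) := by
    simp only [List.nodup_cons, List.mem_cons, not_or] at hnd
    have e1 : Function.Injective ![w, a₁, a₂] := by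
      simp [Function.Injective, Fin.forall_fin_succ, eq_comm (a := w) (b := a₁),
        eq_comm (a := w) (b := a₂), eq_comm (a := a₂) (b := a₁)]
      tauto
    have e2 : Function.Injective ![b₀, b₁, b₂] := by
      simp [Function.Injective, Fin.forall_fin_succ, eq_comm (a := b₀) (b := b₁),
        eq_comm (a := b₀) (b := b₂), eq_comm (a := b₂) (b := b₁)]
      tauto
    refine e1.sumElim e2 ?_
    simp [Fin.forall_fin_succ, eq_comm (a := w)]
    tauto
  refine Models.mk_of_rel (fun x y =>
    (∃ c d, K33e.Adj c d ∧ s(c, d) ≠ s(Sum.inl 0, Sum.inr 2) ∧ x = Sum.inl c ∧ y = Sum.inl d) ∨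
    ∃ j < d.length + 1, x = subdivVertex (Sum.inl 0) (Sum.inr 2) d.length j ∧
      y = subdivVertex (Sum.inl 0) (Sum.inr 2) d.length (j + 1)) (fun a b hab => ?_) ?_
    (fun w' => ?_) (fun e => ?_) h.frame
  · rw [subdivideEdge, fromRel_adj]
    exact ⟨fun h => h.2, fun h => ⟨hab, h⟩⟩
  · refine hin.sumElim ?_ ?_
    · intro i j hij
      have : d.Nodup := hnd.sublist (List.sublist_append_right [a₁, a₂, b₁, b₂, b₀, w] d)
      exact Fin.ext (this.getElem_inj_iff.1 hij)
    · intro x j hxj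
      have h1 : Sum.elim ![w, a₁, a₂] ![b₀, b₁, b₂] x ∈ [a₁, a₂, b₁, b₂, b₀, w] := by
        rcases x with x | x <;> fin_cases x <;> simp
      have h2 : ([a₁, a₂, b₁, b₂, b₀, w] ++ d).Nodup := hnd
      exact List.disjoint_of_nodup_append h2 h1 (hxj ▸ List.getElem_mem _)
  · have h1 : w' ∈ a₁ :: a₂ :: b₁ :: b₂ :: b₀ :: w :: d ↔
        (∃ x, Sum.elim ![w, a₁, a₂] ![b₀, b₁, b₂] x = w') ∨ w' ∈ d := by
      simp [Fin.exists_fin_succ, eq_comm]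
      tauto
    rw [h1]
    constructor
    · rintro (⟨x, hx⟩ | hx)
      · exact ⟨Sum.inl x, hx⟩
      · obtain ⟨j, hj, rfl⟩ := List.mem_iff_getElem.1 hx
        exact ⟨Sum.inr ⟨j, hj⟩, rfl⟩
    · rintro ⟨x | j, rfl⟩
      · exact Or.inl ⟨x, rfl⟩
      · exact Or.inr (List.getElem_mem _)
  · have h1 : e ∈ K33eEdges a₁ a₂ b₁ b₂ b₀ (w :: d) ↔
        (∃ x y, (K33e.Adj x y ∧ s(x, y) ≠ s(Sum.inl 0, Sum.inr 2)) ∧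
          e = s(f (Sum.inl x), f (Sum.inl y))) ∨ e ∈ linkEdges w d b₂ := by
      have h2 : e ∈ K33eEdges a₁ a₂ b₁ b₂ b₀ (w :: d) ↔ e ∈ [s(a₁, b₁), s(a₁, b₂), s(a₂, b₁),
          s(a₂, b₂), s(a₁, b₀), s(a₂, b₀), s(w, b₁)] ∨ e ∈ linkEdges w d b₂ := by
        have h3 : linkEdges b₁ (w :: d) b₂ = s(b₁, w) :: linkEdges w d b₂ := rfl
        rw [K33eEdges, h3, List.mem_append, List.mem_cons (b := s(b₁, w)),
          Sym2.eq_swap (a := b₁)]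
        simp only [List.mem_cons, List.not_mem_nil, or_false]
        tauto
      rw [h2]
      refine or_congr_left ?_
      have h4 : [s(a₁, b₁), s(a₁, b₂), s(a₂, b₁), s(a₂, b₂), s(a₁, b₀), s(a₂, b₀), s(w, b₁)] =
          ([s(Sum.inl 1, Sum.inr 1), s(Sum.inl 1, Sum.inr 2), s(Sum.inl 2, Sum.inr 1),
          s(Sum.inl 2, Sum.inr 2), s(Sum.inl 1, Sum.inr 0), s(Sum.inl 2, Sum.inr 0),
          s(Sum.inl 0, Sum.inr 1)] : List (Sym2 (Fin 3 ⊕ Fin 3))).map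
            (Sym2.map fun x => f (Sum.inl x)) := rfl
      rw [h4, List.mem_map]
      constructor
      · rintro ⟨e', he', rfl⟩
        induction e' with | _ x y
        exact ⟨x, y, K33e_edges.2 he', rfl⟩
      · rintro ⟨x, y, hxy, rfl⟩
        exact ⟨s(x, y), K33e_edges.1 hxy, rfl⟩
    rw [h1]
    constructor
    · rintro (⟨x, y, ⟨h3, h4⟩, rfl⟩ | he)
      · exact ⟨_, _, Or.inl ⟨x, y, h3, h4, rfl, rfl⟩, rfl⟩
      · obtain ⟨j, hj, rfl⟩ := mem_ledges_iff.1 he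
        refine ⟨_, _, Or.inr ⟨j, by simp at hj; omega, rfl, rfl⟩, ?_⟩
        rw [hfv j (by omega), hfv (j + 1) hj]
    · rintro ⟨_, _, ⟨x, y, h3, h4, rfl, rfl⟩ | ⟨j, hj, rfl, rfl⟩, rfl⟩
      · exact Or.inl ⟨x, y, ⟨h3, h4⟩, rfl⟩
      · have hj' : j + 1 < (w :: (d ++ [b₂])).length := by simp; omega
        rw [hfv j (by omega), hfv (j + 1) hj']
        exact Or.inr (mem_ledges_iff.2 ⟨j, hj', rfl⟩)

end Models

/-! ### Blocks -/

/-- Some set of vertices is joined to its complement by the edge `xy` only. -/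
def Sep (G : SimpleGraph V) (x y : V) : Prop :=
  ∃ σ : V → Prop, ¬ (σ x ↔ σ y) ∧ ∀ a b, G.Adj a b → s(a, b) ≠ s(x, y) → (σ a ↔ σ b)

theorem Sep.symm {x y : V} (h : Sep G x y) : Sep G y x := by
  obtain ⟨σ, h1, h2⟩ := h
  exact ⟨σ, fun h => h1 h.symm, fun a b hab he => h2 a b hab fun h => he (h.trans Sym2.eq_swap)⟩

/-- `ρ` retracts `G` to the vertex set `S`, and all edges outside `S` separate the graph. -/
structure Pruning (G : SimpleGraph V) (S : Set V) (ρ : V → V) : Prop where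
  mem : ∀ x, ρ x ∈ S
  fix : ∀ x ∈ S, ρ x = x
  edge : ∀ x y, G.Adj x y → ¬ (x ∈ S ∧ y ∈ S) → ρ x = ρ y
  sep : ∀ x y, G.Adj x y → ¬ (x ∈ S ∧ y ∈ S) → Sep G x y

/-- When the leaf `v` with neighbour `w` is deleted, everything that retracted to `v` is sent on to
`w`. The edge `vw` is the only one between the preimage of `v` and the rest, so it separates the
graph. -/
theorem PrunesTo.exists_pruning {S : Set V} (h : PrunesTo G S) : ∃ ρ, Pruning G S ρ := by
  classical
  induction h with
  | start => exact ⟨id, fun _ => trivial, fun _ _ => rfl, fun _ _ _ h => absurd ⟨trivial, trivial⟩ h,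
      fun _ _ _ h => absurd ⟨trivial, trivial⟩ h⟩
  | @delete S v h hv hdeg ih =>
    obtain ⟨ρ, hρ⟩ := ih
    obtain ⟨w, hw⟩ := Set.ncard_eq_one.1 hdeg
    have hwS : w ∈ S ∧ G.Adj v w := by
      have : w ∈ {w ∈ S | G.Adj v w} := hw ▸ rfl
      exact this
    have huniq : ∀ y ∈ S, G.Adj v y → y = w := fun y hy hvy => by
      have : y ∈ {w ∈ S | G.Adj v w} := ⟨hy, hvy⟩
      rw [hw] at this
      exact this
    have hwv : w ≠ v := (G.ne_of_adj hwS.2).symm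
    have key : ∀ x y, G.Adj x y → ¬ (x ∈ S \ {v} ∧ y ∈ S \ {v}) →
        ¬ (x ∈ S ∧ y ∈ S) ∨ (x = v ∧ y = w) ∨ (x = w ∧ y = v) := by
      intro x y hxy hS
      by_cases hx : x ∈ S
      · by_cases hy : y ∈ S
        · right
          by_cases hxv : x = v
          · subst hxv
            exact Or.inl ⟨rfl, huniq y hy hxy⟩
          · by_cases hyv : y = v
            · subst hyv
              exact Or.inr ⟨huniq x hx hxy.symm, rfl⟩
            · exact absurd ⟨⟨hx, hxv⟩, hy, hyv⟩ hS
        · exact Or.inl fun h => hy h.2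
      · exact Or.inl fun h => hx h.1
    have hsep : Sep G v w := by
      refine ⟨fun a => ρ a = v, ?_, fun a b hab he => ?_⟩
      · beta_reduce
        rw [hρ.fix v hv, hρ.fix w hwS.1]
        simp [hwv]
      · beta_reduce
        by_cases hS : a ∈ S ∧ b ∈ S
        · rw [hρ.fix a hS.1, hρ.fix b hS.2]
          constructor
          · rintro rfl
            exact absurd (by rw [huniq b hS.2 hab]) he
          · rintro rfl
            exact absurd (by rw [huniq a hS.1 hab.symm, Sym2.eq_swap]) he
        · rw [hρ.edge a b hab hS]
    refine ⟨fun a => if ρ a = v then w else ρ a, fun x => ?_, fun x hx => ?_, fun x y hxy hS => ?_,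
      fun x y hxy hS => ?_⟩
    · split_ifs with hx
      exacts [⟨hwS.1, hwv⟩, ⟨hρ.mem x, hx⟩]
    · have hxv : x ≠ v := hx.2
      simp only [hρ.fix x hx.1, if_neg hxv]
    · rcases key x y hxy hS with h' | ⟨rfl, rfl⟩ | ⟨rfl, rfl⟩
      · simp only [hρ.edge x y hxy h']
      · rw [hρ.fix x hv, hρ.fix y hwS.1, if_pos rfl, if_neg hwv]
      · rw [hρ.fix y hv, hρ.fix x hwS.1, if_pos rfl, if_neg hwv]
    · rcases key x y hxy hS with h' | ⟨rfl, rfl⟩ | ⟨rfl, rfl⟩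
      exacts [hρ.sep x y hxy h', hsep, hsep.symm]

theorem preconnected_induction {W : Type*} {K : SimpleGraph W} (h : K.Preconnected) {P : W → Prop}
    (hP : ∀ x y, K.Adj x y → P x → P y) {x y : W} (hx : P x) : P y := by
  obtain ⟨p⟩ := h x y
  induction p with
  | nil => exact hx
  | cons hadj p ih => exact ih (hP _ _ hadj hx)

/-- Some edge is not a bridge of `H`; the ends are joined by a walk in `H` that avoids it, along
which the separating predicate cannot change. -/
theorem exists_not_sep {H : G.Subgraph} (h : ¬ H.coe.IsAcyclic) : ∃ a b, H.Adj a b ∧ ¬ Sep G a b := by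
  rw [isAcyclic_iff_forall_adj_isBridge] at h
  push Not at h
  obtain ⟨a, b, hab, h⟩ := h
  rw [isBridge_iff, not_not] at h
  refine ⟨a, b, hab, ?_⟩
  rintro ⟨σ, h1, h2⟩
  obtain ⟨p⟩ := h
  refine h1 ?_
  have : ∀ {x y : H.verts} (_ : (H.coe.deleteEdges {s(a, b)}).Walk x y), σ x.1 ↔ σ y.1 := by
    intro x y p
    induction p with
    | nil => exact Iff.rfl
    | @cons x y z hadj p ih =>
      rw [deleteEdges_adj] at hadj
      refine (h2 _ _ (H.adj_sub hadj.1) fun he => hadj.2 ?_).trans ih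
      rw [Set.mem_singleton_iff]
      rcases Sym2.eq_iff.1 he with ⟨h3, h4⟩ | ⟨h3, h4⟩
      · rw [Subtype.ext h3, Subtype.ext h4]
      · rw [Subtype.ext h3, Subtype.ext h4, Sym2.eq_swap]
  exact this p

/-- A walk from `b` to `a` that avoids `v` shows that the edge `va` is not a bridge. -/
theorem TwoConnected.not_isAcyclic {W : Type*} {K : SimpleGraph W} (h : TwoConnected K) {v a b : W}
    (ha : K.Adj v a) (hb : K.Adj v b) (hab : a ≠ b) : ¬ K.IsAcyclic := by
  rw [isAcyclic_iff_forall_adj_isBridge]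
  push Not
  refine ⟨v, a, ha, ?_⟩
  rw [isBridge_iff, not_not]
  have hv := not_not.1 (h.2 v)
  obtain ⟨p⟩ := hv ⟨b, fun h => K.ne_of_adj hb h.symm⟩ ⟨a, fun h => K.ne_of_adj ha h.symm⟩
  have h1 : (K.deleteEdges {s(v, a)}).Adj v b := by
    rw [deleteEdges_adj]
    refine ⟨hb, fun h => ?_⟩
    rcases Sym2.eq_iff.1 h with ⟨-, h⟩ | ⟨h, -⟩
    · exact hab h.symm
    · exact K.ne_of_adj ha h
  let φ : K.induce {v}ᶜ →g K.deleteEdges {s(v, a)} := ⟨Subtype.val, fun {x y} hxy => by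
    rw [deleteEdges_adj]
    refine ⟨hxy, fun h => ?_⟩
    rcases Sym2.eq_iff.1 h with ⟨h, -⟩ | ⟨-, h⟩
    · exact x.2 h
    · exact y.2 h⟩
  exact h1.reachable.trans ⟨p.map φ⟩

theorem reachable_of_isChain {W : Type*} {K : SimpleGraph W} {L : List W} (h : List.IsChain K.Adj L) :
    ∀ a ∈ L, ∀ b ∈ L, K.Reachable a b := by
  induction L with
  | nil => simp
  | cons x L ih =>
    have key : ∀ b ∈ L, K.Reachable x b := by
      intro b hb
      cases L with
      | nil => simp at hb
      | cons y L =>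
        rw [List.isChain_cons_cons] at h
        exact h.1.reachable.trans (ih h.2 y (by simp) b hb)
    intro a ha b hb
    rcases List.mem_cons.1 ha with rfl | ha' <;> rcases List.mem_cons.1 hb with rfl | hb'
    · exact Reachable.refl _
    · exact key b hb'
    · exact (key a ha').symm
    · exact ih h.of_cons a ha' b hb'

theorem preconnected_of_isChain {W : Type*} {K : SimpleGraph W} {f : W → V} {R : V → V → Prop}
    {L : List V} (h : List.IsChain R L) (hR : ∀ a b, R (f a) (f b) → K.Adj a b)
    (hL : ∀ v ∈ L, ∃ a, f a = v) (hf : Function.Injective f) (hcov : ∀ a, f a ∈ L) :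
    K.Preconnected := by
  obtain ⟨L', rfl⟩ : L ∈ Set.range (List.map f) := by
    rw [Set.range_list_map]
    exact hL
  have h' : List.IsChain K.Adj L' := by
    rw [List.isChain_map] at h
    exact h.imp fun a b => hR a b
  have hmem : ∀ a, a ∈ L' := fun a => by
    obtain ⟨b, hb, hab⟩ := List.mem_map.1 (hcov a)
    exact hf hab ▸ hb
  exact fun a b => reachable_of_isChain h' a (hmem a) b (hmem b)

section Blocks

variable {S : Set V} {X : List V} {D D' : List (Sym2 V)} {ρ : V → V}

/-- Spanning walks suffice for connectedness, so the lists may repeat vertices. -/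
theorem Frame.twoConnected (hF : Frame G X D)
    (hX : ∃ L, L ≠ [] ∧ List.IsChain (fun x y => s(x, y) ∈ D) L ∧ ∀ w, w ∈ L ↔ w ∈ X)
    (hX' : ∀ v ∈ X, ∃ L, List.IsChain (fun x y => s(x, y) ∈ D) L ∧ ∀ w, w ∈ L ↔ w ∈ X ∧ w ≠ v) :
    TwoConnected hF.subgraph.coe := by
  constructor
  · obtain ⟨L, hne, hL, hLX⟩ := hX
    obtain ⟨x, hx⟩ := List.exists_mem_of_ne_nil _ hne
    have : Nonempty hF.subgraph.verts := ⟨⟨x, (hLX x).1 hx⟩⟩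
    exact ⟨preconnected_of_isChain (f := Subtype.val) hL (fun a b h => h)
      (fun v hv => ⟨⟨v, (hLX v).1 hv⟩, rfl⟩) Subtype.val_injective fun a => (hLX _).2 a.2⟩
  · intro v
    obtain ⟨L, hL, hLX⟩ := hX' v.1 v.2
    refine not_not.2 (preconnected_of_isChain
      (f := fun a : ({v}ᶜ : Set hF.subgraph.verts) => a.1.1) hL (fun a b h => h)
      (fun w hw => ?_) (fun a b hab => Subtype.ext (Subtype.ext hab)) fun a => ?_)
    · have := (hLX w).1 hw
      exact ⟨⟨⟨w, this.1⟩, fun h => this.2 (congrArg Subtype.val h)⟩, rfl⟩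
    · exact (hLX _).2 ⟨a.1.2, fun h => a.2 (Subtype.ext h)⟩

/-- The graph with vertices `X` and edges `D` is a block of the graph with edges `D'`. -/
structure BlockData (G : SimpleGraph V) (X : List V) (D D' : List (Sym2 V)) : Prop where
  frame : Frame G X D
  two : TwoConnected frame.subgraph.coe
  cyc : ∃ v a b, s(v, a) ∈ D ∧ s(v, b) ∈ D ∧ a ≠ b
  retr : ∃ π : V → V, (∀ x ∈ X, π x = x) ∧ (∀ x, π x ∈ X) ∧
    ∀ x y, s(x, y) ∈ D' → s(x, y) ∉ D → π x = π y

theorem BlockData.not_isAcyclic (h : BlockData G X D D') : ¬ h.frame.subgraph.coe.IsAcyclic := by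
  obtain ⟨v, a, b, ha, hb, hab⟩ := h.cyc
  exact h.two.not_isAcyclic (v := ⟨v, (h.frame.mem _ _ ha).1⟩) (a := ⟨a, (h.frame.mem _ _ ha).2⟩)
    (b := ⟨b, (h.frame.mem _ _ hb).2⟩) ha hb fun h => hab (congrArg Subtype.val h)

/-- The retraction `π` onto `X` is constant along all edges outside `D`. If `H` had a vertex `w`
outside `X`, then deleting `π w` would leave `w` unable to reach the ends of `ab`, at least one of
which differs from `π w`: as long as `π w` is avoided, the value of `π` cannot change. This
contradicts 2-connectedness. -/
theorem BlockData.le_subgraph (h : BlockData G X D D') (hρ : Pruning G S ρ) (hXS : ∀ x ∈ X, x ∈ S)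
    (hsp : ∀ x ∈ S, ∀ y ∈ S, G.Adj x y → s(x, y) ∈ D') {H : G.Subgraph}
    (hH : TwoConnected H.coe) {a b : V} (hab : H.Adj a b) (habD : s(a, b) ∈ D) :
    H ≤ h.frame.subgraph := by
  obtain ⟨π₀, hfix₀, hmem₀, hedge₀⟩ := h.retr
  obtain ⟨π, hfix, hmem, hedge⟩ : ∃ π : V → V, (∀ x ∈ X, π x = x) ∧ (∀ x, π x ∈ X) ∧
      ∀ x y, G.Adj x y → s(x, y) ∉ D → π x = π y := by
    refine ⟨fun x => π₀ (ρ x), fun x hx => by simp only [hρ.fix x (hXS x hx), hfix₀ x hx],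
      fun x => hmem₀ _, fun x y hxy hD => ?_⟩
    by_cases hS : x ∈ S ∧ y ∈ S
    · simp only [hρ.fix x hS.1, hρ.fix y hS.2]
      exact hedge₀ x y (hsp x hS.1 y hS.2 hxy) hD
    · simp only [hρ.edge x y hxy hS]
  have hverts : ∀ w ∈ H.verts, w ∈ X := by
    intro w hw
    by_contra hwX
    have hwb : π w ≠ w := fun h => hwX (h ▸ hmem w)
    obtain ⟨a', ha', ha'X, hne⟩ : ∃ a', a' ∈ H.verts ∧ a' ∈ X ∧ a' ≠ π w := by
      by_cases h1 : a = π w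
      · exact ⟨b, hab.snd_mem, (h.frame.mem _ _ habD).2, fun h2 =>
          G.ne_of_adj (H.adj_sub hab) (h1.trans h2.symm)⟩
      · exact ⟨a, hab.fst_mem, (h.frame.mem _ _ habD).1, h1⟩
    have hstep : ∀ x y, H.Adj x y → x ≠ π w → π x = π w → π y = π w := by
      intro x y hxy hx hπ
      by_cases hD : s(x, y) ∈ D
      · exact absurd ((hfix x (h.frame.mem _ _ hD).1).symm.trans hπ) hx
      · rw [← hedge x y (H.adj_sub hxy) hD, hπ]
    have hfin : π a' = π w := by
      by_cases hb : π w ∈ H.verts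
      · have := not_not.1 (hH.2 ⟨π w, hb⟩)
        exact preconnected_induction this (P := fun x => π x.1.1 = π w)
          (x := ⟨⟨w, hw⟩, fun h => hwb (congrArg Subtype.val h).symm⟩)
          (y := ⟨⟨a', ha'⟩, fun h => hne (congrArg Subtype.val h)⟩)
          (fun x y hxy hx => hstep _ _ hxy (fun h => x.2 (Subtype.ext h)) hx) rfl
      · exact preconnected_induction hH.1.preconnected (P := fun x => π x.1 = π w)
          (x := ⟨w, hw⟩) (y := ⟨a', ha'⟩)
          (fun x y hxy hx => hstep _ _ hxy (fun h => hb (h ▸ x.2)) hx) rfl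
    exact hne ((hfix a' ha'X).symm.trans hfin)
  refine ⟨hverts, fun x y hxy => ?_⟩
  by_contra hD
  have := hedge x y (H.adj_sub hxy) hD
  rw [hfix x (hverts x hxy.fst_mem), hfix y (hverts y hxy.snd_mem)] at this
  exact G.ne_of_adj (H.adj_sub hxy) this

theorem BlockData.isBlock (h : BlockData G X D D') (hρ : Pruning G S ρ) (hXS : ∀ x ∈ X, x ∈ S)
    (hsp : ∀ x ∈ S, ∀ y ∈ S, G.Adj x y → s(x, y) ∈ D') : IsBlock G h.frame.subgraph := by
  refine ⟨h.two, fun H hH hle => ?_⟩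
  obtain ⟨v, a, b, ha, -, -⟩ := h.cyc
  exact h.le_subgraph hρ hXS hsp hH (hle.2 ha) ha

/-- A block with a cycle has an edge that does not separate `G`. This edge lies in the core, hence
in one of the listed blocks, and two blocks with a common edge coincide. -/
theorem cyclicBlocks_eq (hρ : Pruning G S ρ)
    (hsp : ∀ x ∈ S, ∀ y ∈ S, G.Adj x y → s(x, y) ∈ D') (Bs : Set G.Subgraph)
    (hBs : ∀ B ∈ Bs, ∃ X D, ∃ h : BlockData G X D D', (∀ x ∈ X, x ∈ S) ∧ B = h.frame.subgraph)
    (hcov : ∀ x y, s(x, y) ∈ D' → (∃ B ∈ Bs, B.Adj x y) ∨ Sep G x y) : cyclicBlocks G = Bs := by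
  ext B
  constructor
  · rintro ⟨hB, hcyc⟩
    obtain ⟨a, b, hab, hsep⟩ := exists_not_sep hcyc
    have hS : a ∈ S ∧ b ∈ S := by
      by_contra hS
      exact hsep (hρ.sep a b (B.adj_sub hab) hS)
    rcases hcov a b (hsp a hS.1 b hS.2 (B.adj_sub hab)) with ⟨B', hB', hab'⟩ | h
    · obtain ⟨X, D, h, hXS, rfl⟩ := hBs B' hB'
      have hle := h.le_subgraph hρ hXS hsp hB.prop hab hab'
      have : B = h.frame.subgraph := le_antisymm hle (hB.2 h.two hle)
      exact this ▸ hB'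
    · exact absurd h hsep
  · intro hB
    obtain ⟨X, D, h, hXS, rfl⟩ := hBs B hB
    exact ⟨h.isBlock hρ hXS hsp, h.not_isAcyclic⟩

theorem isChain_ledges : ∀ L : List V, List.IsChain (fun x y => s(x, y) ∈ ledges L) L
  | [] => by simp
  | [a] => by simp
  | a :: b :: L => by
    rw [List.isChain_cons_cons]
    exact ⟨by simp [ledges], (isChain_ledges (b :: L)).imp fun x y h => by
      rw [ledges]
      exact List.mem_cons_of_mem _ h⟩

theorem cycle_twoConnected {z : V} {c : List V} (h : Link G z c z) (hnd : (z :: c).Nodup) :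
    TwoConnected (frame_cycle h).subgraph.coe := by
  have key : ∀ {z : V} {c : List V}, List.IsChain (fun x y => s(x, y) ∈ linkEdges z c z) (z :: c) := by
    intro z c
    have := isChain_ledges (z :: (c ++ [z]))
    rw [← List.cons_append] at this
    exact this.left_of_append
  refine Frame.twoConnected _ ⟨z :: c, by simp, key, fun _ => Iff.rfl⟩ fun v hv => ?_
  obtain ⟨c', hc', hp, he⟩ := exists_rotate h hv
  have hnd' := hp.nodup_iff.2 hnd
  refine ⟨c', (key (z := v) (c := c')).of_cons.imp fun x y h => (he _).1 h, fun w => ?_⟩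
  rw [← hp.mem_iff]
  constructor
  · intro hw
    refine ⟨List.mem_cons_of_mem _ hw, ?_⟩
    rintro rfl
    exact (List.nodup_cons.1 hnd').1 hw
  · rintro ⟨hw, hwv⟩
    exact (List.mem_cons.1 hw).resolve_left hwv

theorem K23_twoConnected {u v a b d : V} (h : Theta G u v [a] [b] [d]) :
    TwoConnected h.frame.subgraph.coe := by
  have hnd := h.nd
  simp only [List.nodup_cons, List.cons_append, List.nil_append, List.mem_cons, List.not_mem_nil,
    or_false, not_or] at hnd
  have hne := hnd
  have hE : ∀ x y, s(x, y) ∈ thetaEdges u v [a] [b] [d] ↔ s(x, y) = s(u, a) ∨ s(x, y) = s(a, v) ∨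
      s(x, y) = s(u, b) ∨ s(x, y) = s(b, v) ∨ s(x, y) = s(u, d) ∨ s(x, y) = s(d, v) := by
    intro x y
    simp only [thetaEdges, linkEdges, ledges, List.mem_cons, List.not_mem_nil, or_false,
      List.nil_append, List.cons_append]
  refine Frame.twoConnected _ ⟨[a, u, b, v, d], by simp, ?_, fun w => ?_⟩ fun x hx => ?_
  · simp [hE]
  · simp only [List.mem_cons, List.not_mem_nil, or_false, List.nil_append, List.cons_append]
    tauto
  · have key : ∀ (L : List V), List.IsChain (fun x y => s(x, y) ∈ thetaEdges u v [a] [b] [d]) L →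
        (∀ w, w ∈ L ↔ w ∈ [u, v, a, b, d] ∧ w ≠ x) →
        ∃ L, List.IsChain (fun x y => s(x, y) ∈ thetaEdges u v [a] [b] [d]) L ∧
          ∀ w, w ∈ L ↔ w ∈ [u, v, a, b, d] ∧ w ≠ x := fun L h1 h2 => ⟨L, h1, h2⟩
    simp only [List.mem_cons, List.not_mem_nil, or_false, List.nil_append, List.cons_append] at hx
    rcases hx with rfl | rfl | rfl | rfl | rfl
    -- Without `u` there remains a star with centre `v`, which has no spanning path; the walk passes
    -- through `v` twice.
    · refine key [a, v, b, v, d] (by simp [hE]) fun w => ?_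
      grind
    · refine key [a, u, b, u, d] (by simp [hE]) fun w => ?_
      grind
    · refine key [u, b, v, d] (by simp [hE]) fun w => ?_
      grind
    · refine key [u, a, v, d] (by simp [hE]) fun w => ?_
      grind
    · refine key [u, a, v, b] (by simp [hE]) fun w => ?_
      grind

end Blocks

/-! ### Blocks of the possible cores -/

section Blocks

variable {S : Set V} {X : List V} {D D' : List (Sym2 V)} {ρ : V → V} {x y z : V} {t c : List V}

theorem Arm.split_edge {e : Sym2 V} (h : Arm G x t z) (he : e ∈ ledges (x :: t)) :
    ∃ t₁ a b t₂, t = t₁ ++ b :: t₂ ∧ Arm G x t₁ a ∧ Arm G b t₂ z ∧ e = s(a, b) ∧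
      ∀ e', e' ∈ ledges (x :: t) → e' = e ∨ e' ∈ ledges (x :: t₁) ∨ e' ∈ ledges (b :: t₂) := by
  induction t generalizing x with
  | nil => simp [ledges] at he
  | cons y t ih =>
    rw [ledges, List.mem_cons] at he
    rcases he with rfl | he
    · refine ⟨[], x, y, t, rfl, rfl, h.2, rfl, fun e' he' => ?_⟩
      rw [ledges, List.mem_cons] at he'
      tauto
    · obtain ⟨t₁, a, b, t₂, rfl, h₁, h₂, he', hall⟩ := ih h.2 he
      refine ⟨y :: t₁, a, b, t₂, rfl, ⟨h.1, h₁⟩, h₂, he', fun e' h' => ?_⟩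
      rw [ledges, List.mem_cons] at h' ⊢
      rcases h' with h' | h'
      · exact Or.inr (Or.inl (Or.inl h'))
      · have := hall e' h'
        tauto

/-- The far side consists of the arm beyond the edge together with the cycle; since the vertices are
distinct, no other edge of the lollipop leads there. -/
theorem IsLolli.exists_separation {a b : V} (h : IsLolli G x t z c) (hnd : (x :: (t ++ c)).Nodup)
    (hab : s(a, b) ∈ ledges (x :: t)) : ∃ σ : V → Prop, ¬ (σ a ↔ σ b) ∧ (∀ w, w ∉ t ++ c → ¬ σ w) ∧
      ∀ y w, s(y, w) ∈ lolliEdges x t z c → s(y, w) ≠ s(a, b) → (σ y ↔ σ w) := by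
  obtain ⟨t₁, a', b', t₂, rfl, h₁, h₂, he, hall⟩ := h.arm.split_edge hab
  have ha' := h₁.end_mem
  have hz := h₂.end_mem
  have hnd' : (x :: t₁ ++ (b' :: t₂ ++ c)).Nodup := by simpa using hnd
  have hdis := List.disjoint_of_nodup_append hnd'
  refine ⟨fun w => w ∈ b' :: t₂ ++ c, ?_, fun w hw hw' => hw ?_, fun y w hyw hne => ?_⟩
  · have h3 : b' ∈ b' :: t₂ ++ c := by simp
    have h4 : a' ∉ b' :: t₂ ++ c := fun h => hdis ha' h
    rcases Sym2.eq_iff.1 he with ⟨rfl, rfl⟩ | ⟨rfl, rfl⟩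
    · exact fun h => h4 (h.2 h3)
    · exact fun h => h4 (h.1 h3)
  · simp only [List.mem_cons, List.mem_append] at hw' ⊢
    tauto
  · have hin : ∀ {w}, w ∈ b' :: t₂ → w ∈ b' :: t₂ ++ c := fun h => List.mem_append_left _ h
    rcases List.mem_append.1 hyw with hyw | hyw
    · rcases hall _ hyw with h' | h' | h'
      · exact absurd h' hne
      · have := mem_of_mem_ledges h'
        exact ⟨fun h => (hdis this.1 h).elim, fun h => (hdis this.2 h).elim⟩
      · have := mem_of_mem_ledges h'
        exact ⟨fun _ => hin this.2, fun _ => hin this.1⟩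
    · have h3 := h.link.frame.mem _ _ hyw
      have h4 : ∀ w ∈ z :: z :: c, w ∈ b' :: t₂ ++ c := by
        intro w hw
        simp only [List.mem_cons] at hw
        rcases hw with rfl | rfl | hw
        exacts [hin hz, hin hz, List.mem_append_right _ hw]
      exact ⟨fun _ => h4 _ h3.2, fun _ => h4 _ h3.1⟩

/-- A separation of the core is pulled back along the retraction, which collapses all edges outside
`S`. -/
theorem Pruning.sep_of_separation (hρ : Pruning G S ρ) (hsp : Spans G S X D) {a b : V} (ha : a ∈ S)
    (hb : b ∈ S) {σ : V → Prop} (h1 : ¬ (σ a ↔ σ b))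
    (h2 : ∀ y w, s(y, w) ∈ D → s(y, w) ≠ s(a, b) → (σ y ↔ σ w)) : Sep G a b := by
  refine ⟨fun w => σ (ρ w), ?_, fun y w hyw hne => ?_⟩
  · simpa only [hρ.fix a ha, hρ.fix b hb] using h1
  · by_cases hS : y ∈ S ∧ w ∈ S
    · simpa only [hρ.fix y hS.1, hρ.fix w hS.2] using h2 y w (hsp.edges y hS.1 w hS.2 hyw) hne
    · simp only [hρ.edge y w hyw hS]

theorem IsLolli.sep_of_spans {E : List (Sym2 V)} {a b : V} (hρ : Pruning G S ρ)
    (hsp : Spans G S X D) (h : IsLolli G x t z c) (hnd : (x :: (t ++ c)).Nodup)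
    (hX : ∀ w ∈ x :: (t ++ c), w ∈ X) (hD : ∀ e ∈ D, e ∈ E ∨ e ∈ lolliEdges x t z c)
    (hE : ∀ y w, s(y, w) ∈ E → y ∉ t ++ c ∧ w ∉ t ++ c) (hab : s(a, b) ∈ ledges (x :: t)) :
    Sep G a b := by
  obtain ⟨σ, h1, h2, h3⟩ := h.exists_separation hnd hab
  have hm := mem_of_mem_ledges hab
  have hS : ∀ w ∈ x :: t, w ∈ S := fun w hw => hsp.sub w (hX w (by
    simp only [List.mem_cons, List.mem_append] at hw ⊢
    tauto))
  refine hρ.sep_of_separation hsp (hS _ hm.1) (hS _ hm.2) h1 fun y w hyw hne => ?_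
  rcases hD _ hyw with h' | h'
  · have := hE y w h'
    exact iff_of_false (h2 y this.1) (h2 w this.2)
  · exact h3 y w h' hne

/-- A block attached to the rest of the graph at a single vertex. -/
theorem BlockData.of_hang (hF : Frame G X D) (h2 : TwoConnected hF.subgraph.coe)
    (hcyc : ∃ v a b, s(v, a) ∈ D ∧ s(v, b) ∈ D ∧ a ≠ b) (hz : z ∈ X)
    (hD : ∀ y w, s(y, w) ∈ D' → s(y, w) ∉ D → (y ∈ X → y = z) ∧ (w ∈ X → w = z)) :
    BlockData G X D D' := by
  classical
  refine ⟨hF, h2, hcyc, fun w => if w ∈ X then w else z, fun w hw => if_pos hw, fun w => ?_,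
    fun y w hyw hne => ?_⟩
  · beta_reduce
    split_ifs with h
    exacts [h, hz]
  · have := hD y w hyw hne
    have key : ∀ {w}, (w ∈ X → w = z) → (if w ∈ X then w else z) = z := by
      intro w hw
      split_ifs with h
      exacts [hw h, rfl]
    simp only [key this.1, key this.2]

theorem cycle_exists_edges (h2 : 2 ≤ c.length) (hnd : (z :: c).Nodup) :
    ∃ v a b, s(v, a) ∈ linkEdges z c z ∧ s(v, b) ∈ linkEdges z c z ∧ a ≠ b := by
  match c, h2 with
  | a :: b :: c, _ =>
    refine ⟨a, z, b, by simp [linkEdges, ledges, Sym2.eq_swap], by simp [linkEdges, ledges], ?_⟩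
    simp at hnd
    tauto

/-- The cycle of a lollipop is attached to everything else at `z` only. -/
theorem IsLolli.blockData (h : IsLolli G x t z c) (hnd : (x :: (t ++ c)).Nodup)
    {E : List (Sym2 V)} (hD : ∀ e ∈ D', e ∈ E ∨ e ∈ lolliEdges x t z c)
    (hE : ∀ y w, s(y, w) ∈ E → y ∉ t ++ c ∧ w ∉ t ++ c) :
    BlockData G (z :: c) (linkEdges z c z) D' := by
  have hz := h.arm.end_mem
  have hnd' : (x :: t ++ c).Nodup := hnd
  have hdis := List.disjoint_of_nodup_append hnd'
  have hndc : (z :: c).Nodup := List.nodup_cons.2 ⟨hdis hz, hnd'.of_append_right⟩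
  refine .of_hang (frame_cycle h.link) (cycle_twoConnected h.link hndc)
    (cycle_exists_edges h.two hndc) (z := z) (by simp) fun y w hyw hne => ?_
  have key : ∀ w, w ∉ c → w ∈ z :: c → w = z := fun w h1 h2 => (List.mem_cons.1 h2).resolve_right h1
  rcases hD _ hyw with h' | h'
  · have := hE y w h'
    simp only [List.mem_append, not_or] at this
    exact ⟨key y this.1.2, key w this.2.2⟩
  · rcases List.mem_append.1 h' with h' | h'
    · have := mem_of_mem_ledges h'
      exact ⟨key y (hdis this.1), key w (hdis this.2)⟩
    · exact absurd h' hne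

theorem cycle_length_even {col : V → Bool} (hc : IsBicoloring G col) (h : Link G z c z)
    (h2 : 2 ≤ c.length) : ∃ s ≥ 2, 2 * s = (z :: c).length := by
  have := (h.parity hc).1 rfl
  refine ⟨(c.length + 1) / 2, by omega, ?_⟩
  simp
  omega

theorem mem_edgeSet_subgraph (hF : Frame G X D) {e : Sym2 V} : e ∈ hF.subgraph.edgeSet ↔ e ∈ D := by
  induction e with | _ x y
  rfl

/-- Both cycles are attached to the rest at a single vertex, `x` and `z` respectively, and each arm
edge separates the graph. -/
theorem two_cycles_blocks {col : V → Bool} (hc : IsBicoloring G col) (hρ : Pruning G S ρ)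
    {c₀ : List V} (h : Link G x c₀ x) (h2 : 2 ≤ c₀.length) (hq : IsLolli G x t z c)
    (hnd : (x :: (c₀ ++ (t ++ c))).Nodup)
    (hsp : Spans G S (x :: (c₀ ++ (t ++ c))) (linkEdges x c₀ x ++ lolliEdges x t z c)) :
    ∃ s ≥ 2, ∃ t ≥ 2, ∃ B₁ B₂ : G.Subgraph, B₁ ≠ B₂ ∧ cyclicBlocks G = {B₁, B₂} ∧
      Nonempty (B₁.coe ≃g cycleGraph (2 * s)) ∧ Nonempty (B₂.coe ≃g cycleGraph (2 * t)) := by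
  classical
  have hndq : (x :: (t ++ c)).Nodup := nodup_of_count hnd fun a => by
    simp [List.count_cons] <;> omega
  have hnd₀ : (x :: c₀).Nodup := nodup_of_count hnd fun a => by
    simp [List.count_cons] <;> omega
  have hdis : List.Disjoint (x :: c₀) (t ++ c) :=
    List.disjoint_of_nodup_append (by simpa using hnd)
  have hD : ∀ e ∈ linkEdges x c₀ x ++ lolliEdges x t z c,
      e ∈ linkEdges x c₀ x ∨ e ∈ lolliEdges x t z c := fun e he => List.mem_append.1 he
  have hE : ∀ y w, s(y, w) ∈ linkEdges x c₀ x → y ∉ t ++ c ∧ w ∉ t ++ c := fun y w hyw => by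
    have := (frame_cycle h).mem _ _ hyw
    exact ⟨hdis this.1, hdis this.2⟩
  have hB₁ : BlockData G (x :: c₀) (linkEdges x c₀ x)
      (linkEdges x c₀ x ++ lolliEdges x t z c) := by
    refine .of_hang (frame_cycle h) (cycle_twoConnected h hnd₀) (cycle_exists_edges h2 hnd₀)
      (z := x) (by simp) fun y w hyw hne => ?_
    have := hq.mem_of_mem_lolliEdges ((List.mem_append.1 hyw).resolve_left hne)
    have key : ∀ w, w ∈ x :: (t ++ c) → w ∈ x :: c₀ → w = x := fun w h1 h2 =>
      (List.mem_cons.1 h1).resolve_right (hdis h2)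
    exact ⟨key y this.1, key w this.2⟩
  have hB₂ := hq.blockData hndq hD hE
  have hz := hq.arm.end_mem
  have hndc : (z :: c).Nodup := List.nodup_cons.2
    ⟨List.disjoint_of_nodup_append (l₁ := x :: t) (l₂ := c) hndq hz, hndq.of_cons.of_append_right⟩
  obtain ⟨s, hs, hs'⟩ := cycle_length_even hc h h2
  obtain ⟨s', hs'', hs'''⟩ := cycle_length_even hc hq.link hq.two
  refine ⟨s, hs, s', hs'', hB₁.frame.subgraph, hB₂.frame.subgraph, fun heq => ?_,
    cyclicBlocks_eq hρ hsp.edges _ ?_ ?_,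
    hB₁.frame.nonempty_iso (models_cycle h h2 hnd₀ hs'),
    hB₂.frame.nonempty_iso (models_cycle hq.link hq.two hndc hs''')⟩
  · have h1 : c ≠ [] := by
      rintro rfl
      exact absurd hq.two (by simp)
    obtain ⟨w, hw⟩ := List.exists_mem_of_ne_nil _ h1
    have : w ∈ hB₁.frame.subgraph.verts := by
      rw [heq]
      exact List.mem_cons_of_mem _ hw
    exact hdis this (List.mem_append_right _ hw)
  · rintro B (rfl | rfl)
    · exact ⟨_, _, hB₁, fun w hw => hsp.sub w (by
        simp only [List.mem_cons, List.mem_append] at hw ⊢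
        tauto), rfl⟩
    · refine ⟨_, _, hB₂, fun w hw => hsp.sub w ?_, rfl⟩
      simp only [List.mem_cons, List.mem_append] at hw hz ⊢
      rcases hw with rfl | hw <;> tauto
  · intro a b hab
    rcases List.mem_append.1 hab with hab | hab
    · exact Or.inl ⟨_, Or.inl rfl, hab⟩
    · rcases List.mem_append.1 hab with hab | hab
      · refine Or.inr (hq.sep_of_spans hρ hsp hndq (fun w hw => ?_) hD hE hab)
        simp only [List.mem_cons, List.mem_append] at hw ⊢
        tauto
      · exact Or.inl ⟨_, Or.inr rfl, hab⟩

theorem theta_cycle_blocks {col : V → Bool} (hc : IsBicoloring G col) (hρ : Pruning G S ρ)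
    {u v a b d : V} (h : Theta G u v [a] [b] [d]) (hx : x ∈ [u, v, a, b, d])
    (hq : IsLolli G x t z c) (hnd : ([u, v, a, b, d] ++ (t ++ c)).Nodup)
    (hsp : Spans G S ([u, v, a, b, d] ++ (t ++ c))
      (thetaEdges u v [a] [b] [d] ++ lolliEdges x t z c)) :
    ∃ s ≥ 2, ∃ B₁ B₂ : G.Subgraph, B₁ ≠ B₂ ∧ cyclicBlocks G = {B₁, B₂} ∧
      Nonempty (B₁.coe ≃g theta ![2, 2, 2]) ∧ Nonempty (B₂.coe ≃g cycleGraph (2 * s)) := by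
  classical
  have hdis : List.Disjoint [u, v, a, b, d] (t ++ c) := List.disjoint_of_nodup_append hnd
  have hndq : (x :: (t ++ c)).Nodup := List.nodup_cons.2 ⟨hdis hx, hnd.of_append_right⟩
  have hD : ∀ e ∈ thetaEdges u v [a] [b] [d] ++ lolliEdges x t z c,
      e ∈ thetaEdges u v [a] [b] [d] ∨ e ∈ lolliEdges x t z c := fun e he => List.mem_append.1 he
  have hE : ∀ y w, s(y, w) ∈ thetaEdges u v [a] [b] [d] → y ∉ t ++ c ∧ w ∉ t ++ c :=
    fun y w hyw => by
      have := h.frame.mem _ _ hyw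
      exact ⟨hdis this.1, hdis this.2⟩
  have hB₁ : BlockData G [u, v, a, b, d] (thetaEdges u v [a] [b] [d])
      (thetaEdges u v [a] [b] [d] ++ lolliEdges x t z c) := by
    refine .of_hang h.frame (K23_twoConnected h) ⟨u, a, b, by simp [thetaEdges, linkEdges, ledges],
      by simp [thetaEdges, linkEdges, ledges], ?_⟩ (z := x) hx fun y w hyw hne => ?_
    · have := h.nd
      simp at this
      tauto
    have := hq.mem_of_mem_lolliEdges ((List.mem_append.1 hyw).resolve_left hne)
    have key : ∀ w, w ∈ x :: (t ++ c) → w ∈ [u, v, a, b, d] → w = x := fun w h1 h2 =>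
      (List.mem_cons.1 h1).resolve_right (hdis h2)
    exact ⟨key y this.1, key w this.2⟩
  have hB₂ := hq.blockData hndq hD hE
  have hz := hq.arm.end_mem
  have hndc : (z :: c).Nodup := List.nodup_cons.2
    ⟨List.disjoint_of_nodup_append (l₁ := x :: t) (l₂ := c) hndq hz, hndq.of_cons.of_append_right⟩
  obtain ⟨s, hs, hs'⟩ := cycle_length_even hc hq.link hq.two
  have hsub : ∀ w ∈ x :: (t ++ c), w ∈ [u, v, a, b, d] ++ (t ++ c) := by
    intro w hw
    rcases List.mem_cons.1 hw with rfl | hw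
    exacts [List.mem_append_left _ hx, List.mem_append_right _ hw]
  refine ⟨s, hs, hB₁.frame.subgraph, hB₂.frame.subgraph, fun heq => ?_,
    cyclicBlocks_eq hρ hsp.edges _ ?_ ?_,
    hB₁.frame.nonempty_iso (models_theta (ls := ![[a], [b], [d]]) (ℓ := ![2, 2, 2]) h
      (by simp [Fin.forall_fin_succ])),
    hB₂.frame.nonempty_iso (models_cycle hq.link hq.two hndc hs')⟩
  · have h1 : c ≠ [] := by
      rintro rfl
      exact absurd hq.two (by simp)
    obtain ⟨w, hw⟩ := List.exists_mem_of_ne_nil _ h1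
    have : w ∈ hB₁.frame.subgraph.verts := by
      rw [heq]
      exact List.mem_cons_of_mem _ hw
    exact hdis this (List.mem_append_right _ hw)
  · rintro B (rfl | rfl)
    · exact ⟨_, _, hB₁, fun w hw => hsp.sub w (List.mem_append_left _ hw), rfl⟩
    · refine ⟨_, _, hB₂, fun w hw => hsp.sub w (hsub w ?_), rfl⟩
      simp only [List.mem_cons, List.mem_append] at hw hz ⊢
      rcases hw with rfl | hw <;> tauto
  · intro a b hab
    rcases List.mem_append.1 hab with hab | hab
    · exact Or.inl ⟨_, Or.inl rfl, hab⟩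
    · rcases List.mem_append.1 hab with hab | hab
      · exact Or.inr (hq.sep_of_spans hρ hsp hndq hsub hD hE hab)
      · exact Or.inl ⟨_, Or.inr rfl, hab⟩

theorem exists_walk_of_isChain : ∀ {x : V} {l : List V}, List.IsChain G.Adj (x :: l) →
    ∃ (y : V) (p : G.Walk x y), p.support = x :: l ∧ p.edges = ledges (x :: l)
  | x, [], _ => ⟨x, Walk.nil, rfl, rfl⟩
  | x, w :: l, h => by
    rw [List.isChain_cons_cons] at h
    obtain ⟨y, p, h1, h2⟩ := exists_walk_of_isChain h.2
    exact ⟨y, Walk.cons h.1 p, by simp [h1], by simp [h2, ledges]⟩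

theorem IsLolli.exists_cycle_edge (h : IsLolli G x t z c) :
    ∃ e ∈ ledges (x :: (t ++ c)), e ∈ linkEdges z c z := by
  match c, h with
  | [], h => exact absurd h.two (by simp)
  | [_], h => exact absurd h.two (by simp)
  | a :: b :: c, _ =>
    -- The two ends are consecutive members of `c`, so the path along the arm and around the cycle
    -- uses this edge whatever the arm is.
    refine ⟨s(a, b), ?_, by simp [linkEdges, ledges]⟩
    rw [← List.cons_append, ledges_append, List.mem_append]
    exact Or.inr (by simp [ledges])

/-! ### Blocks and cut-vertices of the four-cycle with two lollipops -/

section Middle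

variable {p p' a b z' : V} {t' c' : List V}

/-- The path through the middle cycle and both lollipops. -/
theorem MiddleLayout.isChain (h : MiddleLayout G p p' a b t z c t' z' c') :
    List.IsChain G.Adj ((p :: (t ++ c)).reverse ++ b :: p' :: (t' ++ c')) := by
  have h1 := link_cons.1 h.hb
  rw [List.isChain_append]
  refine ⟨?_, List.isChain_cons_cons.2 ⟨link_nil.1 h1.2, h.hq'.isChain⟩, ?_⟩
  · rw [List.isChain_reverse]
    exact h.hq.isChain.imp fun _ _ h => h.symm
  · intro x hx y hy
    simp at hx hy
    subst hx hy
    exact h1.1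

theorem MiddleLayout.exists_path (h : MiddleLayout G p p' a b t z c t' z' c') :
    ∃ (x y : V) (w : G.Walk x y), w.IsPath ∧ ∃ e₁ ∈ linkEdges z c z,
      ∃ e₂ ∈ linkEdges p [a, p', b] p, ∃ e₃ ∈ linkEdges z' c' z', [e₁, e₂, e₃].Sublist w.edges := by
  classical
  obtain ⟨e₁, h1, h1'⟩ := h.hq.exists_cycle_edge
  obtain ⟨e₃, h3, h3'⟩ := h.hq'.exists_cycle_edge
  have hchain := h.isChain
  obtain ⟨x, l, hl⟩ : ∃ x l, (p :: (t ++ c)).reverse ++ b :: p' :: (t' ++ c') = x :: l :=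
    List.exists_cons_of_ne_nil (by simp)
  rw [hl] at hchain
  obtain ⟨y, w, hw1, hw2⟩ := exists_walk_of_isChain hchain
  refine ⟨x, y, w, ?_, e₁, h1', s(b, p'), by simp [linkEdges, ledges, Sym2.eq_swap], e₃, h3', ?_⟩
  · rw [Walk.isPath_def, hw1, ← hl]
    exact nodup_of_count h.nd fun a => by simp [List.count_cons] <;> omega
  · rw [hw2, ← hl, ledges_append]
    have h4 : e₁ ∈ ledges ((p :: (t ++ c)).reverse ++ [b]) := by
      have h5 : e₁ ∈ ledges (p :: (t ++ c)).reverse := (mem_ledges_reverse _).2 h1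
      rw [List.reverse_cons] at h5
      rw [List.reverse_cons, List.append_assoc, List.singleton_append, ledges_append]
      exact List.mem_append_left _ h5
    have h5 : [s(b, p'), e₃].Sublist (ledges (b :: p' :: (t' ++ c'))) :=
      (List.singleton_sublist.2 h3).cons_cons _
    exact (List.singleton_sublist.2 h4).append h5

theorem MiddleLayout.mem_edges_flip {e : Sym2 V} (he : e ∈ middleEdges p p' a b t z c t' z' c') :
    e ∈ middleEdges p' p a b t' z' c' t z c := by
  simp only [middleEdges, List.mem_append] at he ⊢
  rw [← mem_linkEdges_reverse (l := [a]), ← mem_linkEdges_reverse (l := [b])] at he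
  simp only [List.reverse_singleton] at he
  tauto

theorem MiddleLayout.spans_flip (h : Spans G S ([p, p', a, b] ++ ((t ++ c) ++ (t' ++ c')))
    (middleEdges p p' a b t z c t' z' c')) : Spans G S ([p', p, a, b] ++ ((t' ++ c') ++ (t ++ c)))
    (middleEdges p' p a b t' z' c' t z c) := by
  refine ⟨fun w hw => h.sub w ?_, fun x hx y hy hxy => mem_edges_flip (h.edges x hx y hy hxy)⟩
  simp only [List.mem_cons, List.mem_append] at hw ⊢
  tauto

theorem MiddleLayout.frame_edges (h : MiddleLayout G p p' a b t z c t' z' c') {x y : V}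
    (hxy : s(x, y) ∈ middleEdges p p' a b t z c t' z' c') :
    (x ∈ [p, p', a, b] ∧ y ∈ [p, p', a, b] ∧ s(x, y) ∈ linkEdges p [a, p', b] p) ∨
    s(x, y) ∈ lolliEdges p t z c ∨ s(x, y) ∈ lolliEdges p' t' z' c' := by
  simp only [middleEdges, List.mem_append] at hxy
  rcases hxy with hxy | hxy | hxy
  · left
    have h1 : s(x, y) ∈ linkEdges p ([a] ++ p' :: [b]) p := by
      rw [linkEdges_append, List.mem_append, ← mem_linkEdges_reverse (u := p') (v := p)]
      exact hxy
    have := (frame_cycle h.cycle).mem _ _ h1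
    refine ⟨?_, ?_, h1⟩
    · have := this.1
      simp only [List.mem_cons] at this ⊢
      tauto
    · have := this.2
      simp only [List.mem_cons] at this ⊢
      tauto
  · exact Or.inr (Or.inl hxy)
  · exact Or.inr (Or.inr hxy)

/-- Once `p` is deleted, no edge leaves the lollipop `t ++ c`, and `a` is outside it. -/
theorem MiddleLayout.isCutVertex (h : MiddleLayout G p p' a b t z c t' z' c')
    (hsp : Spans G S ([p, p', a, b] ++ ((t ++ c) ++ (t' ++ c')))
      (middleEdges p p' a b t z c t' z' c')) (hp : p ∈ S) : IsCutVertex (G.induce S) ⟨p, hp⟩ := by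
  classical
  intro hcon
  have hnd := h.nd
  have hdis : List.Disjoint [p, p', a, b] (t ++ c) := List.disjoint_of_nodup_append
    (nodup_of_count hnd fun a => by simp [List.count_cons] <;> omega)
  have hdis' : List.Disjoint (p' :: (t' ++ c')) (t ++ c) := List.disjoint_of_nodup_append
    (nodup_of_count hnd fun a => by simp [List.count_cons] <;> omega)
  obtain ⟨w, hw⟩ : ∃ w, w ∈ t ++ c := by
    refine List.exists_mem_of_ne_nil _ fun h0 => ?_
    have := h.hq.two
    simp at h0
    simp [h0.2] at this
  have hwp : w ≠ p := by
    rintro rfl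
    exact hdis (by simp) hw
  have hap : a ≠ p := by
    rintro rfl
    simp at hnd
  have hwS : w ∈ S := hsp.sub w (by simp only [List.mem_append] at hw ⊢; tauto)
  have haS : a ∈ S := hsp.sub a (by simp)
  have := preconnected_induction hcon (P := fun y => y.1.1 ∈ t ++ c)
    (x := ⟨⟨w, hwS⟩, fun h => hwp (congrArg Subtype.val h)⟩)
    (y := ⟨⟨a, haS⟩, fun h => hap (congrArg Subtype.val h)⟩) (fun x y hxy hx => by
      rcases h.frame_edges (hsp.edges _ x.1.2 _ y.1.2 hxy) with h1 | h1 | h1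
      · exact (hdis h1.1 hx).elim
      · refine (List.mem_cons.1 (h.hq.mem_of_mem_lolliEdges h1).2).resolve_left fun h2 => ?_
        exact y.2 (Subtype.ext h2)
      · exact (hdis' (h.hq'.mem_of_mem_lolliEdges h1).1 hx).elim) hw
  exact hdis (by simp) this

/-- The path through both lollipops by way of `b` contains every vertex of the core except `a`. -/
theorem MiddleLayout.not_isCutVertex (h : MiddleLayout G p p' a b t z c t' z' c')
    (hS : ∀ x, x ∈ S ↔ x ∈ [p, p', a, b] ++ ((t ++ c) ++ (t' ++ c'))) (ha : a ∈ S) :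
    ¬ IsCutVertex (G.induce S) ⟨a, ha⟩ := by
  classical
  have hnd : (a :: ((p :: (t ++ c)).reverse ++ b :: p' :: (t' ++ c'))).Nodup :=
    nodup_of_count h.nd fun a => by simp [List.count_cons] <;> omega
  have hmem : ∀ x, x ∈ S ↔ x = a ∨ x ∈ (p :: (t ++ c)).reverse ++ b :: p' :: (t' ++ c') := by
    intro x
    rw [hS]
    simp only [List.mem_cons, List.mem_append, List.mem_reverse, List.not_mem_nil]
    tauto
  refine not_not.2 (preconnected_of_isChain (f := fun y : ({⟨a, ha⟩}ᶜ : Set S) => y.1.1) h.isChain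
    (fun (x y : ({⟨a, ha⟩}ᶜ : Set S)) (h : G.Adj x.1.1 y.1.1) => h) (fun w hw => ?_)
    (fun x y hxy => Subtype.ext (Subtype.ext hxy)) fun x => ?_)
  · refine ⟨⟨⟨w, (hmem w).2 (Or.inr hw)⟩, fun h => ?_⟩, rfl⟩
    have : w = a := congrArg Subtype.val h
    exact (List.nodup_cons.1 hnd).1 (this ▸ hw)
  · exact ((hmem _).1 x.1.2).resolve_left fun h => x.2 (Subtype.ext h)

theorem MiddleLayout.blockData (h : MiddleLayout G p p' a b t z c t' z' c') :
    BlockData G (p :: [a, p', b]) (linkEdges p [a, p', b] p)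
      (middleEdges p p' a b t z c t' z' c') := by
  classical
  have hnd := h.nd
  have hdis : List.Disjoint (p :: [a, p', b]) ((t ++ c) ++ (t' ++ c')) :=
    List.disjoint_of_nodup_append
      (nodup_of_count hnd fun a => by simp [List.count_cons] <;> omega)
  have hdis' : List.Disjoint (t ++ c) (t' ++ c') := List.disjoint_of_nodup_append
    (nodup_of_count hnd fun a => by simp [List.count_cons] <;> omega)
  have hndc : (p :: [a, p', b]).Nodup :=
    nodup_of_count hnd fun a => by simp [List.count_cons] <;> omega
  -- The retraction collapses each lollipop to its root; off the core the value `p` is arbitrary.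
  refine ⟨frame_cycle h.cycle, cycle_twoConnected h.cycle hndc,
    cycle_exists_edges (by simp) hndc, fun w => if w ∈ p :: [a, p', b] then w else
      if w ∈ t' ++ c' then p' else p, fun w hw => if_pos hw, fun w => ?_, fun x y hxy hne => ?_⟩
  · beta_reduce
    split_ifs with h1
    · exact h1
    · simp
    · simp
  · have key1 : ∀ w ∈ p :: (t ++ c), (if w ∈ p :: [a, p', b] then w else
        if w ∈ t' ++ c' then p' else p) = p := by
      intro w hw
      rcases List.mem_cons.1 hw with rfl | hw
      · rw [if_pos (by simp)]
      · rw [if_neg fun h => hdis h (List.mem_append_left _ hw), if_neg (hdis' hw)]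
    have key2 : ∀ w ∈ p' :: (t' ++ c'), (if w ∈ p :: [a, p', b] then w else
        if w ∈ t' ++ c' then p' else p) = p' := by
      intro w hw
      rcases List.mem_cons.1 hw with rfl | hw
      · rw [if_pos (by simp)]
      · rw [if_neg fun h => hdis h (List.mem_append_right _ hw), if_pos hw]
    rcases h.frame_edges hxy with h1 | h1 | h1
    · exact absurd h1.2.2 hne
    · have := h.hq.mem_of_mem_lolliEdges h1
      simp only [key1 _ this.1, key1 _ this.2]
    · have := h.hq'.mem_of_mem_lolliEdges h1
      simp only [key2 _ this.1, key2 _ this.2]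

set_option maxHeartbeats 1000000 in
/-- The blocks of a cycle with two lollipops. -/
theorem MiddleLayout.blocks {col : V → Bool} (hc : IsBicoloring G col) (hρ : Pruning G S ρ)
    (h : MiddleLayout G p p' a b t z c t' z' c')
    (hsp : Spans G S ([p, p', a, b] ++ ((t ++ c) ++ (t' ++ c')))
      (middleEdges p p' a b t z c t' z' c'))
    (hS : ∀ x, x ∈ S ↔ x ∈ [p, p', a, b] ++ ((t ++ c) ++ (t' ++ c'))) :
    ∃ s ≥ 2, ∃ t ≥ 2, ∃ B₁ B₂ B₃ : G.Subgraph, B₁ ≠ B₂ ∧ B₁ ≠ B₃ ∧ B₂ ≠ B₃ ∧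
      cyclicBlocks G = {B₁, B₂, B₃} ∧ Nonempty (B₁.coe ≃g cycleGraph (2 * s)) ∧
      Nonempty (B₂.coe ≃g cycleGraph 4) ∧ Nonempty (B₃.coe ≃g cycleGraph (2 * t)) ∧
      (∃ (x y : V) (p : G.Walk x y), p.IsPath ∧
        ∃ e₁ ∈ B₁.edgeSet, ∃ e₂ ∈ B₂.edgeSet, ∃ e₃ ∈ B₃.edgeSet,
          [e₁, e₂, e₃].Sublist p.edges) ∧
      ∃ v w : V, v ≠ w ∧ ¬ G.Adj v w ∧
        {x ∈ B₂.verts | ∃ hx : x ∈ S, IsCutVertex (G.induce S) ⟨x, hx⟩} = {v, w} := by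
  classical
  have hnd := h.nd
  have hcyc : List.Disjoint (p :: [a, p', b]) ((t ++ c) ++ (t' ++ c')) :=
    List.disjoint_of_nodup_append
      (nodup_of_count hnd fun a => by simp [List.count_cons] <;> omega)
  have hdis : List.Disjoint (p' :: (t' ++ c')) (t ++ c) := List.disjoint_of_nodup_append
    (nodup_of_count hnd fun a => by simp [List.count_cons] <;> omega)
  have hdis' : List.Disjoint (p :: (t ++ c)) (t' ++ c') := List.disjoint_of_nodup_append
    (nodup_of_count hnd fun a => by simp [List.count_cons] <;> omega)
  have hndc : (p :: [a, p', b]).Nodup :=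
    nodup_of_count hnd fun a => by simp [List.count_cons] <;> omega
  have hndq : (p :: (t ++ c)).Nodup :=
    nodup_of_count hnd fun a => by simp [List.count_cons] <;> omega
  have hndq' : (p' :: (t' ++ c')).Nodup :=
    nodup_of_count hnd fun a => by simp [List.count_cons] <;> omega
  have hD : ∀ e ∈ middleEdges p p' a b t z c t' z' c',
      e ∈ linkEdges p [a] p' ++ linkEdges p [b] p' ++ lolliEdges p' t' z' c' ∨
        e ∈ lolliEdges p t z c := by
    intro e he
    simp only [middleEdges, List.mem_append] at he ⊢
    tauto
  have hD' : ∀ e ∈ middleEdges p p' a b t z c t' z' c',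
      e ∈ linkEdges p [a] p' ++ linkEdges p [b] p' ++ lolliEdges p t z c ∨
        e ∈ lolliEdges p' t' z' c' := by
    intro e he
    simp only [middleEdges, List.mem_append] at he ⊢
    tauto
  have hlink : ∀ x y, s(x, y) ∈ linkEdges p [a] p' ++ linkEdges p [b] p' →
      x ∈ p :: [a, p', b] ∧ y ∈ p :: [a, p', b] := by
    intro x y hxy
    have := (h.ha.frame.append h.hb.frame).mem _ _ hxy
    simp only [List.mem_cons, List.mem_append, List.not_mem_nil] at this ⊢
    tauto
  have hE : ∀ y w, s(y, w) ∈ linkEdges p [a] p' ++ linkEdges p [b] p' ++ lolliEdges p' t' z' c' →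
      y ∉ t ++ c ∧ w ∉ t ++ c := by
    intro y w hyw
    rcases List.mem_append.1 hyw with hyw | hyw
    · have := hlink y w hyw
      exact ⟨fun h => hcyc this.1 (List.mem_append_left _ h),
        fun h => hcyc this.2 (List.mem_append_left _ h)⟩
    · have := h.hq'.mem_of_mem_lolliEdges hyw
      exact ⟨hdis this.1, hdis this.2⟩
  have hE' : ∀ y w, s(y, w) ∈ linkEdges p [a] p' ++ linkEdges p [b] p' ++ lolliEdges p t z c →
      y ∉ t' ++ c' ∧ w ∉ t' ++ c' := by
    intro y w hyw
    rcases List.mem_append.1 hyw with hyw | hyw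
    · have := hlink y w hyw
      exact ⟨fun h => hcyc this.1 (List.mem_append_right _ h),
        fun h => hcyc this.2 (List.mem_append_right _ h)⟩
    · have := h.hq.mem_of_mem_lolliEdges hyw
      exact ⟨hdis' this.1, hdis' this.2⟩
  have hB₁ := h.hq.blockData hndq hD hE
  have hB₂ := h.blockData
  have hB₃ := h.hq'.blockData hndq' hD' hE'
  have hcycle : ∀ {p z : V} {t c : List V}, IsLolli G p t z c → (p :: (t ++ c)).Nodup →
      (z :: c).Nodup ∧ (∀ w ∈ z :: c, w ∈ p :: (t ++ c)) ∧ ∃ w, w ∈ c := by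
    intro p z t c h hnd
    have hz := h.arm.end_mem
    refine ⟨List.nodup_cons.2 ⟨List.disjoint_of_nodup_append (l₁ := p :: t) (l₂ := c) hnd hz,
      hnd.of_cons.of_append_right⟩, fun w hw => ?_, List.exists_mem_of_ne_nil _ ?_⟩
    · simp only [List.mem_cons, List.mem_append] at hw hz ⊢
      rcases hw with rfl | hw <;> tauto
    · rintro rfl
      exact absurd h.two (by simp)
  obtain ⟨hndz, hzc, w, hw⟩ := hcycle h.hq hndq
  obtain ⟨hndz', hzc', w', hw'⟩ := hcycle h.hq' hndq'
  have hXS : ∀ w ∈ p :: (t ++ c), w ∈ S := fun w hw => hsp.sub w (by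
    simp only [List.mem_cons, List.mem_append] at hw ⊢
    tauto)
  have hXS' : ∀ w ∈ p' :: (t' ++ c'), w ∈ S := fun w hw => hsp.sub w (by
    simp only [List.mem_cons, List.mem_append] at hw ⊢
    tauto)
  have hwt : w ∈ t ++ c := List.mem_append_right _ hw
  have hwt' : w' ∈ t' ++ c' := List.mem_append_right _ hw'
  have hw₁ : w ∈ hB₁.frame.subgraph.verts := List.mem_cons_of_mem _ hw
  have hw₃ : w' ∈ hB₃.frame.subgraph.verts := List.mem_cons_of_mem _ hw'
  obtain ⟨s, hs, hs'⟩ := cycle_length_even hc h.hq.link h.hq.two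
  obtain ⟨s', hs'', hs'''⟩ := cycle_length_even hc h.hq'.link h.hq'.two
  have hI₁ := hB₁.frame.nonempty_iso (models_cycle h.hq.link h.hq.two hndz hs')
  have hI₂ := hB₂.frame.nonempty_iso (models_cycle h.cycle (by simp) hndc (n := 4) rfl)
  have hI₃ := hB₃.frame.nonempty_iso (models_cycle h.hq'.link h.hq'.two hndz' hs''')
  obtain ⟨x, y, walk, hwalk, e₁, he₁, e₂, he₂, e₃, he₃, hsub⟩ := h.exists_path
  refine ⟨s, hs, s', hs'', hB₁.frame.subgraph, hB₂.frame.subgraph, hB₃.frame.subgraph,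
    fun heq => ?_, fun heq => ?_, fun heq => ?_, cyclicBlocks_eq hρ hsp.edges _ ?_ ?_,
    hI₁, hI₂, hI₃,
    ⟨x, y, walk, hwalk, e₁, (mem_edgeSet_subgraph _).2 he₁, e₂, (mem_edgeSet_subgraph _).2 he₂, e₃,
      (mem_edgeSet_subgraph _).2 he₃, hsub⟩, p, p', ?_, ?_, ?_⟩
  · rw [heq] at hw₁
    exact hcyc hw₁ (List.mem_append_left _ hwt)
  · rw [heq] at hw₁
    exact hdis (hzc' w hw₁) hwt
  · rw [← heq] at hw₃
    exact hcyc hw₃ (List.mem_append_right _ hwt')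
  · rintro B (rfl | rfl | rfl)
    · exact ⟨_, _, hB₁, fun w hw => hXS w (hzc w hw), rfl⟩
    · exact ⟨_, _, hB₂, fun w hw => hsp.sub w (by
        simp only [List.mem_cons, List.mem_append, List.not_mem_nil] at hw ⊢
        tauto), rfl⟩
    · exact ⟨_, _, hB₃, fun w hw => hXS' w (hzc' w hw), rfl⟩
  · intro x y hxy
    rcases h.frame_edges hxy with h1 | h1 | h1
    · exact Or.inl ⟨_, Or.inr (Or.inl rfl), h1.2.2⟩
    · rcases List.mem_append.1 h1 with h1 | h1
      · refine Or.inr (h.hq.sep_of_spans hρ hsp hndq (fun w hw => ?_) hD hE h1)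
        simp only [List.mem_cons, List.mem_append] at hw ⊢
        tauto
      · exact Or.inl ⟨_, Or.inl rfl, h1⟩
    · rcases List.mem_append.1 h1 with h1 | h1
      · refine Or.inr (h.hq'.sep_of_spans hρ hsp hndq' (fun w hw => ?_) hD' hE' h1)
        simp only [List.mem_cons, List.mem_append] at hw ⊢
        tauto
      · exact Or.inl ⟨_, Or.inr (Or.inr rfl), h1⟩
  · rintro rfl
    simp at hndc
  · intro hadj
    -- A path of length two joins `p` and `p'`, so they have the same colour.
    exact hc _ _ hadj ((h.ha.parity hc).2 (by simp))
  · ext x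
    constructor
    · rintro ⟨hx, hxS, hcut⟩
      have hx' : x ∈ p :: [a, p', b] := hx
      simp only [List.mem_cons, List.not_mem_nil, or_false] at hx'
      rcases hx' with rfl | rfl | rfl | rfl
      · exact Or.inl rfl
      · exact absurd hcut (h.not_isCutVertex hS hxS)
      · exact Or.inr rfl
      · refine absurd hcut (h.swap.not_isCutVertex (fun y => ?_) hxS)
        rw [hS]
        simp only [List.mem_cons, List.mem_append, List.not_mem_nil]
        tauto
    · rintro (rfl | rfl)
      · exact ⟨by show x ∈ x :: [a, p', b]; simp, hXS x (by simp),
          h.isCutVertex hsp _⟩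
      · exact ⟨by show x ∈ p :: [a, x, b]; simp, hXS' x (by simp),
          h.flip.isCutVertex (spans_flip hsp) _⟩

end Middle
end Blocks

/-! ### Isomorphism types of the 2-connected cores -/

section Cores

variable {S : Set V} {col : V → Bool} {u v : V} {l₁ l₂ l₃ : List V}

theorem Theta.spans_rotate
    (h : Spans G S (u :: v :: (l₁ ++ l₂ ++ l₃)) (thetaEdges u v l₁ l₂ l₃)) :
    Spans G S (u :: v :: (l₂ ++ l₃ ++ l₁)) (thetaEdges u v l₂ l₃ l₁) := by
  refine ⟨fun w hw => h.sub w ?_, fun x hx y hy hxy => ?_⟩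
  · simp only [List.mem_cons, List.mem_append] at hw ⊢
    tauto
  · have := h.edges x hx y hy hxy
    simp only [thetaEdges, List.mem_append] at this ⊢
    tauto

theorem Theta.nonempty_iso (hS : Linked G S) (h : Theta G u v l₁ l₂ l₃)
    (hsp : Spans G S (u :: v :: (l₁ ++ l₂ ++ l₃)) (thetaEdges u v l₁ l₂ l₃)) :
    Nonempty (G.induce S ≃g theta ![l₁.length + 1, l₂.length + 1, l₃.length + 1]) :=
  hsp.nonempty_iso hS h.frame (by simp)
    (models_theta (ls := ![l₁, l₂, l₃]) h (by simp [Fin.forall_fin_succ]))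

/-- If the ends have equal colours, all three paths are even and one has length 2; otherwise all are
odd and one is an edge. -/
theorem Theta.core (hS : Linked G S) (hc : IsBicoloring G col) (hch : Choosable G 4 2)
    (h : Theta G u v l₁ l₂ l₃)
    (hsp : Spans G S (u :: v :: (l₁ ++ l₂ ++ l₃)) (thetaEdges u v l₁ l₂ l₃)) :
    (∃ s ≥ 1, ∃ t ≥ 1, Nonempty (G.induce S ≃g theta ![2, 2 * s, 2 * t])) ∨
    ∃ s ≥ 1, ∃ t ≥ 1, Nonempty (G.induce S ≃g theta ![1, 2 * s + 1, 2 * t + 1]) := by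
  by_cases hu : col u = col v
  · left
    have key : ∀ {l₁ l₂ l₃ : List V}, Theta G u v l₁ l₂ l₃ →
        Spans G S (u :: v :: (l₁ ++ l₂ ++ l₃)) (thetaEdges u v l₁ l₂ l₃) → l₁.length = 1 →
        ∃ s ≥ 1, ∃ t ≥ 1, Nonempty (G.induce S ≃g theta ![2, 2 * s, 2 * t]) := by
      intro l₁ l₂ l₃ h hsp hl
      have h2 := (h.h₂.parity hc).1 hu
      have h3 := (h.h₃.parity hc).1 hu
      refine ⟨(l₂.length + 1) / 2, by omega, (l₃.length + 1) / 2, by omega, ?_⟩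
      have := h.nonempty_iso hS hsp
      rw [hl] at this
      rwa [show 2 * ((l₂.length + 1) / 2) = l₂.length + 1 by omega,
        show 2 * ((l₃.length + 1) / 2) = l₃.length + 1 by omega]
    rcases h.exists_length_eq_one hc hch hu with hl | hl | hl
    · exact key h hsp hl
    · exact key h.rotate (spans_rotate hsp) hl
    · exact key h.rotate.rotate (spans_rotate (spans_rotate hsp)) hl
  · right
    have key : ∀ {l₁ l₂ l₃ : List V}, Theta G u v l₁ l₂ l₃ →
        Spans G S (u :: v :: (l₁ ++ l₂ ++ l₃)) (thetaEdges u v l₁ l₂ l₃) → l₁ = [] →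
        ∃ s ≥ 1, ∃ t ≥ 1, Nonempty (G.induce S ≃g theta ![1, 2 * s + 1, 2 * t + 1]) := by
      rintro l₁ l₂ l₃ h hsp rfl
      have h2 := mt (h.h₂.parity hc).2 hu
      have h3 := mt (h.h₃.parity hc).2 hu
      have h2' := List.length_pos_iff.2 (h.ne₁₂.resolve_left (by simp))
      have h3' := List.length_pos_iff.2 (h.ne₁₃.resolve_left (by simp))
      refine ⟨l₂.length / 2, by omega, l₃.length / 2, by omega, ?_⟩
      have := h.nonempty_iso hS hsp
      rw [List.length_nil, Nat.zero_add] at this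
      rwa [show 2 * (l₂.length / 2) = l₂.length by omega,
        show 2 * (l₃.length / 2) = l₃.length by omega]
    rcases h.exists_eq_nil hc hch hu with hl | hl | hl
    · exact key h hsp hl
    · exact key h.rotate (spans_rotate hsp) hl
    · exact key h.rotate.rotate (spans_rotate (spans_rotate hsp)) hl

/-- Since `b₁` and `b₂` have a common neighbour, the path between them has an odd number of interior
vertices. One is a vertex of K_{3,3} minus an edge; an even number remains for the subdivision. -/
theorem K33eLayout.core {a₁ a₂ b₁ b₂ b₀ : V} {d : List V} (hS : Linked G S)
    (hc : IsBicoloring G col) (h : K33eLayout G a₁ a₂ b₁ b₂ b₀ d)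
    (hsp : Spans G S (a₁ :: a₂ :: b₁ :: b₂ :: b₀ :: d) (K33eEdges a₁ a₂ b₁ b₂ b₀ d)) :
    ∃ a b, K33e.Adj a b ∧ (K33e.neighborSet a).ncard = 2 ∧
      ∃ m, Nonempty (G.induce S ≃g subdivideEdge K33e a b (2 * m)) := by
  have hb : col b₁ = col b₂ := by
    have h1 := hc _ _ h.h₁₁
    have h2 := hc _ _ h.h₁₂
    revert h1 h2
    cases col a₁ <;> cases col b₁ <;> cases col b₂ <;> simp
  have hd := (h.link.parity hc).1 hb
  cases d with
  | nil => simp at hd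
  | cons w d =>
    rw [List.length_cons] at hd
    refine ⟨Sum.inl 0, Sum.inr 2, by rw [K33e_adj_iff]; simp, K33e_neighborSet, d.length / 2, ?_⟩
    rw [show 2 * (d.length / 2) = d.length by omega]
    exact hsp.nonempty_iso hS h.frame (by simp) (h.models rfl)

end Cores
end FourTwo

/-! ### The classification -/

theorem mainTheorem2 {V : Type u} [Finite V] (G : SimpleGraph V) (hconn : G.Connected)
    (hch : FourTwo.Choosable G 4 2) (S : Set V) (hS : FourTwo.IsCore G S) :
    -- (i) the core is `K₁`
    Nonempty (G.induce S ≃g (⊤ : SimpleGraph (Fin 1))) ∨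
    -- (ii) the core is `C_{2s}`
    (∃ s ≥ 2, Nonempty (G.induce S ≃g cycleGraph (2 * s))) ∨
    -- (iii) the core is `θ_{2,2s,2t}`
    (∃ s ≥ 1, ∃ t ≥ 1, Nonempty (G.induce S ≃g FourTwo.theta ![2, 2 * s, 2 * t])) ∨
    -- (iv) the core is `θ_{1,2s+1,2t+1}`
    (∃ s ≥ 1, ∃ t ≥ 1, Nonempty (G.induce S ≃g FourTwo.theta ![1, 2 * s + 1, 2 * t + 1])) ∨
    -- (v) the core is `K_{2,4}`
    Nonempty (G.induce S ≃g completeBipartiteGraph (Fin 2) (Fin 4)) ∨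
    -- (vi) the core is `K_{3,3} - e` with one edge at a vertex of degree 2 subdivided evenly often
    (∃ a b, FourTwo.K33e.Adj a b ∧ (FourTwo.K33e.neighborSet a).ncard = 2 ∧
      ∃ m, Nonempty (G.induce S ≃g FourTwo.subdivideEdge FourTwo.K33e a b (2 * m))) ∨
    -- (vii) the blocks with a cycle are `C_{2s}`, `C_{2t}`
    (∃ s ≥ 2, ∃ t ≥ 2, ∃ B₁ B₂ : G.Subgraph, B₁ ≠ B₂ ∧ FourTwo.cyclicBlocks G = {B₁, B₂} ∧
      Nonempty (B₁.coe ≃g cycleGraph (2 * s)) ∧ Nonempty (B₂.coe ≃g cycleGraph (2 * t))) ∨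
    -- (viii) the blocks with a cycle are `θ_{2,2,2}`, `C_{2s}`
    (∃ s ≥ 2, ∃ B₁ B₂ : G.Subgraph, B₁ ≠ B₂ ∧ FourTwo.cyclicBlocks G = {B₁, B₂} ∧
      Nonempty (B₁.coe ≃g FourTwo.theta ![2, 2, 2]) ∧
      Nonempty (B₂.coe ≃g cycleGraph (2 * s))) ∨
    -- (ix) the blocks with a cycle are `C_{2s}`, `C₄`, `C_{2t}`; some path of `G` has edges of
    -- all three, in this order; exactly two vertices of the `C₄` are cut-vertices of the core,
    -- and these two are non-adjacent
    (∃ s ≥ 2, ∃ t ≥ 2, ∃ B₁ B₂ B₃ : G.Subgraph, B₁ ≠ B₂ ∧ B₁ ≠ B₃ ∧ B₂ ≠ B₃ ∧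
      FourTwo.cyclicBlocks G = {B₁, B₂, B₃} ∧
      Nonempty (B₁.coe ≃g cycleGraph (2 * s)) ∧
      Nonempty (B₂.coe ≃g cycleGraph 4) ∧
      Nonempty (B₃.coe ≃g cycleGraph (2 * t)) ∧
      (∃ (x y : V) (p : G.Walk x y), p.IsPath ∧
        ∃ e₁ ∈ B₁.edgeSet, ∃ e₂ ∈ B₂.edgeSet, ∃ e₃ ∈ B₃.edgeSet,
          [e₁, e₂, e₃].Sublist p.edges) ∧
      ∃ v w : V, v ≠ w ∧ ¬ G.Adj v w ∧
        {x ∈ B₂.verts | ∃ hx : x ∈ S, FourTwo.IsCutVertex (G.induce S) ⟨x, hx⟩} = {v, w}) := by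
  open FourTwo in
  obtain ⟨col, hc⟩ := hch.exists_isBicoloring
  have hlinked := hS.1.linked hconn
  obtain ⟨ρ, hρ⟩ := hS.1.exists_pruning
  rcases hS.minDegTwo hconn with ⟨v, rfl⟩ | hdeg
  · left
    have : Unique ({v} : Set V) := Set.uniqueSingleton v
    refine ⟨⟨Equiv.ofUnique _ _, fun {a b} => ?_⟩⟩
    rw [Subsingleton.elim a b]
    simp
  right
  rcases exists_shape hlinked hdeg hc hch with ⟨x, c, h, h2, nd, sp⟩ | ⟨u, v, l₁, l₂, l₃, h, sp⟩ |
    ⟨u, v, a, b, d, e, h, sp⟩ | ⟨a₁, a₂, b₁, b₂, b₀, d, h, sp⟩ |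
    ⟨x, c₀, t, z, c, h, h2, hq, nd, sp⟩ | ⟨u, v, a, b, d, x, t, z, c, h, hx, hq, nd, sp⟩ |
    ⟨p, p', a, b, t, z, c, t', z', c', h, sp⟩
  · obtain ⟨s, hs, hs'⟩ := cycle_length_even hc h h2
    exact Or.inl ⟨s, hs, sp.nonempty_iso hlinked (frame_cycle h) (by simp)
      (models_cycle h h2 nd hs')⟩
  · rcases h.core hlinked hc hch sp with h' | h'
    · exact Or.inr (Or.inl h')
    · exact Or.inr (Or.inr (Or.inl h'))
  · exact Or.inr (Or.inr (Or.inr (Or.inl (sp.nonempty_iso hlinked h.frame (by simp) h.models))))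
  · exact Or.inr (Or.inr (Or.inr (Or.inr (Or.inl (h.core hlinked hc sp)))))
  · exact Or.inr (Or.inr (Or.inr (Or.inr (Or.inr (Or.inl
      (two_cycles_blocks hc hρ h h2 hq nd sp))))))
  · exact Or.inr (Or.inr (Or.inr (Or.inr (Or.inr (Or.inr (Or.inl
      (theta_cycle_blocks hc hρ h hx hq nd sp)))))))
  · refine Or.inr (Or.inr (Or.inr (Or.inr (Or.inr (Or.inr (Or.inr
      (h.blocks hc hρ sp fun x => sp.mem_iff hlinked ⟨fun _ _ h' => h.mem_of_mem_edges h', ?_⟩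
        (by simp) x)))))))
    intro x y hxy
    rcases h.frame_edges hxy with h1 | h1 | h1
    exacts [h.cycle.frame.adj _ _ h1.2.2, h.hq.frame.adj _ _ h1, h.hq'.frame.adj _ _ h1]
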